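/- **Setting.** Let $\Omega\subset\mathbb R^d$ be a closed parallelepiped (for instance a box) with periodic boundary conditions, so that functions on $\Omega$ are identified with functions on $\mathbb R^d$ that are periodic with respect to the edge vectors of $\Omega$. Let $F,G,R$ be smooth functions on $(0,\infty)$ with $F'>0$ and $G''>0$. Put $$V_1=\frac{F'}{G''},\qquad V_2=-\frac{R}{G'},$$ where it is assumed that $V_2$ is smooth on $(0,\infty)$ (at a zero of $G'$ the quotient is understood as its smooth extension, i.e. $V_2G'=-R$) and that either $V_2>0$ on $(0,\infty)$, or $R\equiv 0$ and $V_2\equiv 0$. Let $\mathcal G(u)=\int_\Omega G(u)\,dx$, let $\Delta t>0$ and $t_k=k\Delta t$. Given $u_k$, consider the problem $$\inf_{u,v_1,v_2}\ \int_{t_k}^{t_{k+1}}\!\!\int_\Omega \Big(\tfrac12\|v_1\|^2V_1(u)+\tfrac12|v_2|^2V_2(u)\Big)dx\,dt+\mathcal G(u(t_{k+1},\cdot)),\tag{P}$$ over densities $u>0$, vector fields $v_1$ and functions $v_2$, all smooth on $[t_k,t_{k+1}]\times\Omega$ and periodic in $x$, with $$\partial_tu+\nabla\cdot(V_1(u)v_1)=v_2V_2(u),\qquad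 u(t_k,\cdot)=u_k .$$ The update is $u_{k+1}=u(t_{k+1},\cdot)$, where $(u,v_1,v_2)$ is a minimizer of (P). **Proposition.** 1. For every minimizer $(u,v_1,v_2)$ of (P) there is a smooth periodic $\Phi$ on $[t_k,t_{k+1}]\times\Omega$ with $v_1=\nabla\Phi$ and $V_2(u)v_2=V_2(u)\Phi$ (so $v_2=\Phi$ if $V_2>0$), and $$\left\{\begin{aligned}&\partial_tu+\nabla\cdot(V_1(u)\nabla\Phi)=V_2(u)\Phi,\\&\partial_t\Phi+\tfrac12\|\nabla\Phi\|^2V_1'(u)+\tfrac12|\Phi|^2V_2'(u)=0,\\&u(t_k,\cdot)=u_k,\qquad \Phi(t_{k+1},\cdot)=-\frac{\delta}{\delta u}\mathcal G(u_{k+1})=-G'(u_{k+1}),\end{aligned}\right.\tag{HFL}$$ where $\frac{\delta}{\delta u}$ is the $L^2$ first variation. 2. The resulting sequence $u_k$ approximates the reaction–diffusion equation $\partial_tu=\Delta F(u)+R(u)$ with first-order accuracy in $\Delta t$. Precisely, call a step *$M$-regular* if $u\ge 1/M$ on $[t_k,t_{k+1}]\times\Omega$ and the spatial derivatives of $u(t,\cdot)$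 of order at most $3$ are bounded by $M$ for all $t\in[t_k,t_{k+1}]$. - (Consistency.) For every $M$ there is $C$ such that for all $\Delta t>0$, all $k$ and every $M$-regular step, $$\sup_{x}\big|u_{k+1}-u_k-\Delta t\,\big(\Delta F(u_{k+1})+R(u_{k+1})\big)\big|\le C\,\Delta t^2 .$$ - (Convergence.) Let $T>0$ and let $U>0$ be a smooth periodic solution of $\partial_tU=\Delta F(U)+R(U)$ on $[0,T]\times\Omega$. For every $M$ there is $C$ such that for all $\Delta t>0$, all $N$ with $N\Delta t\le T$, and all $u_0,\dots,u_N$ obtained from $u_0=U(0,\cdot)$ by $N$ successive $M$-regular steps, $$\sup_x|u_k(x)-U(t_k,x)|\le C\,\Delta t\qquad(0\le k\le N).$$ Both hold when the steps are given by minimizers of (P), and also when they are given by solutions $(u,\Phi)$ of (HFL) with $u>0$, $u$ and $\Phi$ smooth and periodic. -/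

import Mathlib

noncomputable section

namespace MeanField

open Set MeasureTheory
open scoped ContDiff

variable {d : ℕ}

/-- The Euclidean space `ℝ^d`. -/
abbrev Space (d : ℕ) := EuclideanSpace ℝ (Fin d)

/-- The spatial domain `Ω`: the closed parallelepiped spanned by the period vectors `b i`.
For `b i = L i • e i` it is a box with side lengths `L i`. -/
def domain (b : Module.Basis (Fin d) ℝ (Space d)) : Set (Space d) := parallelepiped b

/-- Periodic boundary conditions on `Ω`: functions on `Ω` are identified with their periodic
extensions to `ℝ^d`. -/
def IsPeriodic (b : Module.Basis (Fin d) ℝ (Space d)) {Y : Type*} (f : Space d → Y) : Prop :=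
  ∀ (i : Fin d) (x : Space d), f (x + b i) = f x

/-- Time-dependent functions or vector fields on `[s, t] × Ω` which are `C^∞` up to the end points
of the time interval and satisfy periodic boundary conditions in space. -/
structure IsSmoothField (b : Module.Basis (Fin d) ℝ (Space d)) {Y : Type*}
    [NormedAddCommGroup Y] [NormedSpace ℝ Y] (s t : ℝ) (f : ℝ → Space d → Y) : Prop where
  smooth : ContDiffOn ℝ ∞ (fun p : ℝ × Space d => f p.1 p.2) (Icc s t ×ˢ univ)
  periodic : ∀ r ∈ Icc s t, IsPeriodic b (f r)

/-- A smooth path `[s, t] → {u ∈ C^∞(Ω) : u > 0}` of positive densities. -/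
structure IsDensityPath (b : Module.Basis (Fin d) ℝ (Space d)) (s t : ℝ)
    (u : ℝ → Space d → ℝ) : Prop extends IsSmoothField b s t u where
  pos : ∀ r ∈ Icc s t, ∀ x, 0 < u r x

/-- The partial derivative `∂_t f` on `[s, t]` (one-sided at the two end points). -/
def timeDeriv (s t : ℝ) (f : ℝ → Space d → ℝ) (r : ℝ) (x : Space d) : ℝ :=
  derivWithin (fun τ => f τ x) (Icc s t) r

/-- The divergence of a vector field. -/
def divergence (w : Space d → Space d) (x : Space d) : ℝ :=
  ∑ i, fderiv ℝ (fun y => w y i) x (EuclideanSpace.single i 1)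

/-- The mobility `V₁ = F' / G''`. -/
def V₁ (F G : ℝ → ℝ) (s : ℝ) : ℝ := deriv F s / iteratedDeriv 2 G s

/-- The standing assumptions on the reaction-diffusion equation and its entropy density, on the
range `(0, ∞)` of the densities. The mobility `V₂ = -R / G'` is written in the form `V₂ G' = -R`,
so that it is the smooth extension of the quotient to the zero of `G'`, when `G'` has one. -/
structure StandingAssumptions (F G R V₂ : ℝ → ℝ) : Prop where
  smooth_F : ContDiffOn ℝ ∞ F (Ioi 0)
  smooth_G : ContDiffOn ℝ ∞ G (Ioi 0)
  smooth_R : ContDiffOn ℝ ∞ R (Ioi 0)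
  smooth_V₂ : ContDiffOn ℝ ∞ V₂ (Ioi 0)
  deriv_F_pos : ∀ s, 0 < s → 0 < deriv F s
  deriv2_G_pos : ∀ s, 0 < s → 0 < iteratedDeriv 2 G s
  V₂_mul : ∀ s, 0 < s → V₂ s * deriv G s = -R s
  /-- Either a genuine reaction term, `-R / G' > 0`, or pure diffusion, `R = 0`. -/
  V₂_sign : (∀ s, 0 < s → 0 < V₂ s) ∨ (∀ s, 0 < s → V₂ s = 0)

/-- The Lyapunov functional `𝒢(u) = ∫_Ω G(u) dx`. -/
def energy (b : Module.Basis (Fin d) ℝ (Space d)) (G : ℝ → ℝ) (u : Space d → ℝ) : ℝ :=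
  ∫ x in domain b, G (u x)

/-- `f` is the `L²` first variation of the functional `𝒥` at `u`. -/
def IsFirstVariation (b : Module.Basis (Fin d) ℝ (Space d)) (𝒥 : (Space d → ℝ) → ℝ)
    (u f : Space d → ℝ) : Prop :=
  ∀ η : Space d → ℝ, ContDiff ℝ ∞ η → IsPeriodic b η →
    HasDerivAt (fun ε : ℝ => 𝒥 (fun x => u x + ε * η x)) (∫ x in domain b, f x * η x) 0

/-- The right-hand side `Δ F(u) + R(u)` of the reaction-diffusion equation. -/
def reactionDiffusion (F R : ℝ → ℝ) (u : Space d → ℝ) (x : Space d) : ℝ :=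
  Laplacian.laplacian (fun y => F (u y)) x + R (u x)

/-- `U` is a smooth positive solution of `∂_t U = Δ F(U) + R(U)` on `[0, T] × Ω`. -/
structure SolvesReactionDiffusion (b : Module.Basis (Fin d) ℝ (Space d)) (F R : ℝ → ℝ) (T : ℝ)
    (U : ℝ → Space d → ℝ) : Prop extends IsDensityPath b 0 T U where
  equation : ∀ r ∈ Icc 0 T, ∀ x, timeDeriv 0 T U r x = reactionDiffusion F R (U r) x

/-- The competitors `(u, v₁, v₂)` of the control problem on `[s, t]` with initial density `u₀`. -/
structure IsAdmissible (b : Module.Basis (Fin d) ℝ (Space d)) (F G V₂ : ℝ → ℝ) (s t : ℝ)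
    (u₀ : Space d → ℝ) (u : ℝ → Space d → ℝ) (v₁ : ℝ → Space d → Space d)
    (v₂ : ℝ → Space d → ℝ) : Prop where
  density : IsDensityPath b s t u
  smooth_v₁ : IsSmoothField b s t v₁
  smooth_v₂ : IsSmoothField b s t v₂
  continuity : ∀ r ∈ Icc s t, ∀ x,
    timeDeriv s t u r x + divergence (fun y => V₁ F G (u r y) • v₁ r y) x = v₂ r x * V₂ (u r x)
  initial : u s = u₀

/-- The objective functional: kinetic energy on `[s, t]` plus terminal energy `𝒢(u(t))`. -/
def cost (b : Module.Basis (Fin d) ℝ (Space d)) (F G V₂ : ℝ → ℝ) (s t : ℝ)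
    (u : ℝ → Space d → ℝ) (v₁ : ℝ → Space d → Space d) (v₂ : ℝ → Space d → ℝ) : ℝ :=
  (∫ r in s..t, ∫ x in domain b,
    (1 / 2 * ‖v₁ r x‖ ^ 2 * V₁ F G (u r x) + 1 / 2 * |v₂ r x| ^ 2 * V₂ (u r x)))
    + energy b G (u t)

/-- `(u, v₁, v₂)` attains the infimum in the control problem on `[s, t]`. -/
structure IsMinimizer (b : Module.Basis (Fin d) ℝ (Space d)) (F G V₂ : ℝ → ℝ) (s t : ℝ)
    (u₀ : Space d → ℝ) (u : ℝ → Space d → ℝ) (v₁ : ℝ → Space d → Space d)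
    (v₂ : ℝ → Space d → ℝ) : Prop where
  admissible : IsAdmissible b F G V₂ s t u₀ u v₁ v₂
  minimal : ∀ u' v₁' v₂', IsAdmissible b F G V₂ s t u₀ u' v₁' v₂' →
    cost b F G V₂ s t u v₁ v₂ ≤ cost b F G V₂ s t u' v₁' v₂'

/-- The Hamiltonian system on `[s, t]` for the density `u` and the momentum `Φ`, with initial
condition for `u` and terminal condition for `Φ`. -/
structure SolvesHamiltonianSystem (b : Module.Basis (Fin d) ℝ (Space d)) (F G V₂ : ℝ → ℝ)
    (s t : ℝ) (u₀ : Space d → ℝ) (u Φ : ℝ → Space d → ℝ) : Prop where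
  density : IsDensityPath b s t u
  smooth_Φ : IsSmoothField b s t Φ
  eq_u : ∀ r ∈ Icc s t, ∀ x,
    timeDeriv s t u r x + divergence (fun y => V₁ F G (u r y) • gradient (Φ r) y) x
      = V₂ (u r x) * Φ r x
  eq_Φ : ∀ r ∈ Icc s t, ∀ x,
    timeDeriv s t Φ r x + 1 / 2 * ‖gradient (Φ r) x‖ ^ 2 * deriv (V₁ F G) (u r x)
      + 1 / 2 * |Φ r x| ^ 2 * deriv V₂ (u r x) = 0
  initial : u s = u₀
  terminal : ∀ x, Φ t x = -deriv G (u t x)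

/-- The time grid `t_k = k Δt`. -/
def gridTime (Δt : ℝ) (k : ℕ) : ℝ := k * Δt

/-- The density `u` stays, on `[s, t]`, in the set of densities which are at least `1 / M` and whose
spatial derivatives of order at most three are bounded by `M`. -/
def IsRegular (M s t : ℝ) (u : ℝ → Space d → ℝ) : Prop :=
  ∀ r ∈ Icc s t, ∀ x, M⁻¹ ≤ u r x ∧ ∀ j ≤ 3, ‖iteratedFDeriv ℝ j (u r) x‖ ≤ M

/-- One step of an implicit scheme: `Step s t u₀ u` says that `u` is a path of densities on `[s, t]`
which the scheme produces from the initial density `u₀`; the update is `u t`. -/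
abbrev StepRelation (d : ℕ) :=
  ℝ → ℝ → (Space d → ℝ) → (ℝ → Space d → ℝ) → Prop

/-- The step given by a minimizer of the control problem. -/
def minimizerStep (b : Module.Basis (Fin d) ℝ (Space d)) (F G V₂ : ℝ → ℝ) : StepRelation d :=
  fun s t u₀ u => ∃ v₁ v₂, IsMinimizer b F G V₂ s t u₀ u v₁ v₂

/-- The step given by a solution of the Hamiltonian system. -/
def hamiltonianStep (b : Module.Basis (Fin d) ℝ (Space d)) (F G V₂ : ℝ → ℝ) : StepRelation d :=
  fun s t u₀ u => ∃ Φ, SolvesHamiltonianSystem b F G V₂ s t u₀ u Φ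

/-- `w 0, …, w N` are successive updates of the scheme, the path of each step being regular
with constant `M`. -/
def IsSchemeSequence (Step : StepRelation d) (M Δt : ℝ) (N : ℕ) (w : ℕ → Space d → ℝ) : Prop :=
  ∀ k < N, ∃ u : ℝ → Space d → ℝ,
    Step (gridTime Δt k) (gridTime Δt (k + 1)) (w k) u ∧
    IsRegular M (gridTime Δt k) (gridTime Δt (k + 1)) u ∧
    w (k + 1) = u (gridTime Δt (k + 1))

/-- Consistency: a step is a backward Euler step for the reaction-diffusion equation up to an error
`O(Δt²)`, uniformly in space, in `k` and over all steps that are regular with a given constant. -/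
def FirstOrderConsistent (F R : ℝ → ℝ) (Step : StepRelation d) : Prop :=
  ∀ M : ℝ, ∃ C : ℝ, ∀ Δt : ℝ, 0 < Δt → ∀ (k : ℕ) (u₀ : Space d → ℝ) (u : ℝ → Space d → ℝ),
    Step (gridTime Δt k) (gridTime Δt (k + 1)) u₀ u →
    IsRegular M (gridTime Δt k) (gridTime Δt (k + 1)) u →
    ∀ x, |u (gridTime Δt (k + 1)) x
      - (u₀ x + Δt * reactionDiffusion F R (u (gridTime Δt (k + 1))) x)| ≤ C * Δt ^ 2

/-- Convergence of order one on every interval `[0, T]` on which the reaction-diffusion equation has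
a smooth positive solution `U`. -/
def FirstOrderConvergent (b : Module.Basis (Fin d) ℝ (Space d)) (F R : ℝ → ℝ)
    (Step : StepRelation d) : Prop :=
  ∀ (T : ℝ) (U : ℝ → Space d → ℝ), 0 < T → SolvesReactionDiffusion b F R T U →
    ∀ M : ℝ, ∃ C : ℝ, ∀ Δt : ℝ, 0 < Δt → ∀ (N : ℕ) (w : ℕ → Space d → ℝ),
      gridTime Δt N ≤ T → w 0 = U 0 → IsSchemeSequence Step M Δt N w →
      ∀ k ≤ N, ∀ x, |w k x - U (gridTime Δt k) x| ≤ C * Δt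

/-- The scheme approximates the reaction-diffusion equation with first-order accuracy in time. -/
structure FirstOrderAccurate (b : Module.Basis (Fin d) ℝ (Space d)) (F R : ℝ → ℝ)
    (Step : StepRelation d) : Prop where
  consistent : FirstOrderConsistent F R Step
  convergent : FirstOrderConvergent b F R Step

end MeanField

end

noncomputable section

namespace MeanField

open Set MeasureTheory
open scoped ContDiff

variable {d : ℕ}

/-! ### Calculus of smooth periodic fields on a time slab -/

/-! Minimizers. In the fluxes m = V₁(u) v₁ and n = V₂(u) v₂ the constraint is linear: if ∂_t η + div
w = ζ and η vanishes initially, then (u + εη, m + εw, n + εζ) is again a competitor for small |ε|.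
Differentiating the cost at ε = 0 gives the weak Euler-Lagrange identity
`IsMinimizer.first_variation`. Suitable test variations turn it into vanishing integrals of squares,
so no Helmholtz decomposition or elliptic theory is needed. If V₂ > 0, then v₂ itself is the
potential: the variation w = v₁ - ∇v₂, η = 0 gives v₁ = ∇v₂, and then w = 0 with arbitrary η gives
the equation for Φ and its terminal value (`IsMinimizer.isPotential_of_pos`). If V₂ = 0, the
equation for Φ contains only known quantities; Φ is defined by integrating it backward from -G'(u),
and the source-free variation with w = v₁ - ∇Φ gives v₁ = ∇Φ (`IsMinimizer.exists_potential`).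

Consistency. At the terminal time Φ = -G'(u), and the choice of V₁ and V₂ makes V₁∇Φ = -∇F(u) and
V₂Φ = R(u). Hence ∂_t u = ΔF(u) + R(u) holds exactly there (`RegularSolution.timeDeriv_u_terminal`),
and a step is a backward Euler step up to the Taylor remainder, governed by ∂_t² u. The equations
express ∂_t² u as a differential polynomial of order three in u and Φ. Regularity controls u; what
remains is a C³ bound on Φ, uniform over regular solutions. At the terminal time it follows from the
bound on u. Backward in time it is propagated by a maximum principle (`transport_comparison`): every
spatial derivative of Φ solves a transport equation with drift V₁'(u)∇Φ, and the drift term drops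
out at spatial extrema, so the estimate closes without loss of derivatives
(`RegularSolution.exists_transport`). This works on intervals of a fixed short length; longer steps
satisfy the estimate trivially.

Convergence. At a maximum of the difference of two densities the gradients agree and the second
derivatives are ordered. Since F' > 0, the operator ΔF(u) + R(u) is one-sided Lipschitz there
(`exists_reactionDiffusion_sub_le`), so backward Euler is stable in the sup norm and the discrete
Gronwall inequality sums up the local errors. -/

lemma uniqueDiffOn_slab {s t : ℝ} (h : s < t) :
    UniqueDiffOn ℝ (Icc s t ×ˢ (univ : Set (Space d))) :=
  (uniqueDiffOn_Icc h).prod uniqueDiffOn_univ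

/-- Lets symmetry of second derivatives be used up to the end points of the time interval. -/
lemma subset_closure_interior_slab {s t : ℝ} (h : s < t) :
    Icc s t ×ˢ (univ : Set (Space d)) ⊆ closure (interior (Icc s t ×ˢ (univ : Set (Space d)))) := by
  rw [interior_prod_eq, closure_prod_eq, closure_interior_Icc h.ne]
  simp

/-- The spatial partial derivative `∂_i f`. -/
def dx (i : Fin d) (f : ℝ → Space d → ℝ) : ℝ → Space d → ℝ :=
  fun r x => fderiv ℝ (f r) x (EuclideanSpace.single i 1)

/-- Iterated spatial partial derivatives. -/
def dxs (α : List (Fin d)) (f : ℝ → Space d → ℝ) : ℝ → Space d → ℝ := α.foldr dx f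

@[simp] lemma dxs_nil (f : ℝ → Space d → ℝ) : dxs [] f = f := rfl

@[simp] lemma dxs_cons (i : Fin d) (α : List (Fin d)) (f : ℝ → Space d → ℝ) :
    dxs (i :: α) f = dx i (dxs α f) := rfl

/-- Agreement on a single time slice is enough, so the terminal condition can be differentiated in
space. -/
lemma dx_congr {f g : ℝ → Space d → ℝ} {r : ℝ} (h : ∀ x, f r x = g r x) (i : Fin d)
    (x : Space d) : dx i f r x = dx i g r x := by
  have : f r = g r := funext h
  simp only [dx, this]

lemma dxs_congr {f g : ℝ → Space d → ℝ} {r : ℝ} (h : ∀ x, f r x = g r x) (α : List (Fin d))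
    (x : Space d) : dxs α f r x = dxs α g r x := by
  induction α generalizing x with
  | nil => exact h x
  | cons i α ih => exact dx_congr ih i x

section Slices

variable {Y : Type*} [NormedAddCommGroup Y] [NormedSpace ℝ Y] {s t : ℝ}

lemma contDiff_slice {n : WithTop ℕ∞} {f : ℝ × Space d → Y}
    (hf : ContDiffOn ℝ n f (Icc s t ×ˢ univ)) {r : ℝ} (hr : r ∈ Icc s t) :
    ContDiff ℝ n (fun x => f (r, x)) := by
  rw [← contDiffOn_univ]
  exact hf.comp (contDiff_prodMk_right r).contDiffOn fun x _ => ⟨hr, mem_univ x⟩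

lemma hasFDerivAt_slice {n : WithTop ℕ∞} (hn : n ≠ 0) {f : ℝ × Space d → Y}
    (hf : ContDiffOn ℝ n f (Icc s t ×ˢ univ)) {r : ℝ} (hr : r ∈ Icc s t) (x : Space d) :
    HasFDerivAt (fun x => f (r, x))
      ((fderivWithin ℝ f (Icc s t ×ˢ univ) (r, x)).comp (ContinuousLinearMap.inr ℝ ℝ (Space d)))
      x := by
  rw [← hasFDerivWithinAt_univ]
  exact ((hf.differentiableOn hn) (r, x) ⟨hr, mem_univ x⟩).hasFDerivWithinAt.comp x
    (hasFDerivAt_prodMk_right r x).hasFDerivWithinAt fun y _ => ⟨hr, mem_univ y⟩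

lemma hasDerivWithinAt_slice {n : WithTop ℕ∞} (hn : n ≠ 0) {f : ℝ × Space d → Y}
    (hf : ContDiffOn ℝ n f (Icc s t ×ˢ univ)) {r : ℝ} (hr : r ∈ Icc s t) (x : Space d) :
    HasDerivWithinAt (fun τ => f (τ, x))
      (fderivWithin ℝ f (Icc s t ×ˢ univ) (r, x) (1, 0)) (Icc s t) r := by
  have := ((hf.differentiableOn hn) (r, x) ⟨hr, mem_univ x⟩).hasFDerivWithinAt.comp r
    (hasFDerivAt_prodMk_left (𝕜 := ℝ) r x).hasFDerivWithinAt
    (fun y (hy : y ∈ Icc s t) => (⟨hy, mem_univ x⟩ : (y, x) ∈ Icc s t ×ˢ univ))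
  simpa [Function.comp_def] using this.hasDerivWithinAt

end Slices

namespace IsSmoothField

variable {b : Module.Basis (Fin d) ℝ (Space d)} {s t : ℝ} {f g : ℝ → Space d → ℝ}

lemma slice (hf : IsSmoothField b s t f) {r : ℝ} (hr : r ∈ Icc s t) : ContDiff ℝ ∞ (f r) :=
  contDiff_slice hf.smooth hr

lemma differentiable (hf : IsSmoothField b s t f) {r : ℝ} (hr : r ∈ Icc s t) :
    Differentiable ℝ (f r) := (hf.slice hr).differentiable (by simp)

lemma continuousOn (hf : IsSmoothField b s t f) :
    ContinuousOn (fun p : ℝ × Space d => f p.1 p.2) (Icc s t ×ˢ univ) := hf.smooth.continuousOn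

lemma continuous_slice (hf : IsSmoothField b s t f) {r : ℝ} (hr : r ∈ Icc s t) :
    Continuous (f r) := (hf.slice hr).continuous

lemma hasDerivWithinAt (hf : IsSmoothField b s t f) {r : ℝ} (hr : r ∈ Icc s t) (x : Space d) :
    HasDerivWithinAt (fun τ => f τ x) (timeDeriv s t f r x) (Icc s t) r :=
  (hasDerivWithinAt_slice (by simp) hf.smooth hr x).differentiableWithinAt.hasDerivWithinAt

lemma dx_eq (hf : IsSmoothField b s t f) (i : Fin d) {r : ℝ} (hr : r ∈ Icc s t) (x : Space d) :
    dx i f r x = fderivWithin ℝ (fun p : ℝ × Space d => f p.1 p.2) (Icc s t ×ˢ univ) (r, x)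
      (0, EuclideanSpace.single i 1) := by
  have := (hasFDerivAt_slice (by simp) hf.smooth hr x).fderiv
  simp only [dx]
  rw [this]
  simp

lemma timeDeriv_eq (hst : s < t) (hf : IsSmoothField b s t f) {r : ℝ} (hr : r ∈ Icc s t)
    (x : Space d) : timeDeriv s t f r x =
      fderivWithin ℝ (fun p : ℝ × Space d => f p.1 p.2) (Icc s t ×ˢ univ) (r, x) (1, 0) :=
  (hasDerivWithinAt_slice (by simp) hf.smooth hr x).derivWithin (uniqueDiffOn_Icc hst r hr)

lemma congr (hf : IsSmoothField b s t f) (h : ∀ r ∈ Icc s t, ∀ x, g r x = f r x) :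
    IsSmoothField b s t g where
  smooth := hf.smooth.congr fun p hp => h p.1 hp.1 p.2
  periodic r hr i x := by rw [h r hr, h r hr, hf.periodic r hr i x]

lemma dx (hst : s < t) (hf : IsSmoothField b s t f) (i : Fin d) :
    IsSmoothField b s t (dx i f) where
  smooth := by
    have h := (hf.smooth.fderivWithin (uniqueDiffOn_slab hst) (m := ∞) (by simp)).clm_apply
      (contDiffOn_const (c := ((0 : ℝ), EuclideanSpace.single i (1 : ℝ))))
    exact h.congr fun p hp => hf.dx_eq i hp.1 p.2
  periodic r hr j x := by
    have : f r = fun y => f r (y + b j) := funext fun y => (hf.periodic r hr j y).symm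
    simp only [MeanField.dx]
    conv_rhs => rw [this]
    rw [fderiv_comp_add_right]

lemma dxs (hst : s < t) (hf : IsSmoothField b s t f) (α : List (Fin d)) :
    IsSmoothField b s t (dxs α f) := by
  induction α with
  | nil => exact hf
  | cons i α ih => exact ih.dx hst i

lemma timeDeriv (hst : s < t) (hf : IsSmoothField b s t f) :
    IsSmoothField b s t (timeDeriv s t f) where
  smooth := by
    have h := (hf.smooth.fderivWithin (uniqueDiffOn_slab hst) (m := ∞) (by simp)).clm_apply
      (contDiffOn_const (c := ((1 : ℝ), (0 : Space d))))
    exact h.congr fun p hp => hf.timeDeriv_eq hst hp.1 p.2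
  periodic r hr j x := by
    simp only [MeanField.timeDeriv]
    exact derivWithin_congr (fun τ hτ => hf.periodic τ hτ j x) (hf.periodic r hr j x)

lemma add (hf : IsSmoothField b s t f) (hg : IsSmoothField b s t g) :
    IsSmoothField b s t (fun r x => f r x + g r x) where
  smooth := hf.smooth.add hg.smooth
  periodic r hr i x := by simp only [hf.periodic r hr i x, hg.periodic r hr i x]

lemma sub (hf : IsSmoothField b s t f) (hg : IsSmoothField b s t g) :
    IsSmoothField b s t (fun r x => f r x - g r x) where
  smooth := hf.smooth.sub hg.smooth
  periodic r hr i x := by simp only [hf.periodic r hr i x, hg.periodic r hr i x]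

lemma mul (hf : IsSmoothField b s t f) (hg : IsSmoothField b s t g) :
    IsSmoothField b s t (fun r x => f r x * g r x) where
  smooth := hf.smooth.mul hg.smooth
  periodic r hr i x := by simp only [hf.periodic r hr i x, hg.periodic r hr i x]

lemma time {h : ℝ → ℝ} (hh : ContDiff ℝ ∞ h) : IsSmoothField b s t (fun r _ => h r) where
  smooth := (hh.comp contDiff_fst).contDiffOn
  periodic _ _ _ _ := rfl

lemma const (c : ℝ) : IsSmoothField b s t (fun _ _ => c) := time contDiff_const

lemma space {h : Space d → ℝ} (hh : ContDiff ℝ ∞ h) (hp : IsPeriodic b h) :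
    IsSmoothField b s t (fun _ x => h x) where
  smooth := (hh.comp contDiff_snd).contDiffOn
  periodic _ _ := hp

lemma neg (hf : IsSmoothField b s t f) : IsSmoothField b s t (fun r x => -f r x) where
  smooth := hf.smooth.neg
  periodic r hr i x := by simp only [hf.periodic r hr i x]

lemma sum {ι : Type*} (A : Finset ι) {F : ι → ℝ → Space d → ℝ}
    (h : ∀ i ∈ A, IsSmoothField b s t (F i)) :
    IsSmoothField b s t (fun r x => ∑ i ∈ A, F i r x) where
  smooth := ContDiffOn.sum fun i hi => (h i hi).smooth
  periodic r hr j x := Finset.sum_congr rfl fun i hi => (h i hi).periodic r hr j x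

lemma comp {h : ℝ → ℝ} (hh : ContDiffOn ℝ ∞ h (Ioi 0)) (hf : IsSmoothField b s t f)
    (hpos : ∀ r ∈ Icc s t, ∀ x, 0 < f r x) : IsSmoothField b s t (fun r x => h (f r x)) where
  smooth := hh.comp hf.smooth fun p hp => hpos p.1 hp.1 p.2
  periodic r hr i x := by simp only [hf.periodic r hr i x]

/-- Both sides evaluate the second derivative of f within the slab on the vectors (1, 0) and (0,
e_i), in opposite orders. -/
lemma timeDeriv_dx (hst : s < t) (hf : IsSmoothField b s t f) (i : Fin d) {r : ℝ}
    (hr : r ∈ Icc s t) (x : Space d) :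
    MeanField.timeDeriv s t (MeanField.dx i f) r x =
      MeanField.dx i (MeanField.timeDeriv s t f) r x := by
  have hS := uniqueDiffOn_slab (d := d) hst
  have hmem : (r, x) ∈ Icc s t ×ˢ (univ : Set (Space d)) := ⟨hr, mem_univ x⟩
  have hsymm := (hf.smooth (r, x) hmem).isSymmSndFDerivWithinAt
      (by simpa using (by norm_cast : (2 : WithTop ℕ∞) ≤ ∞)) hS
    (subset_closure_interior_slab hst hmem) hmem
  have hd : DifferentiableWithinAt ℝ
      (fderivWithin ℝ (fun p : ℝ × Space d => f p.1 p.2) (Icc s t ×ˢ univ))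
      (Icc s t ×ˢ univ) (r, x) :=
    (hf.smooth.fderivWithin hS (m := 1) (by norm_cast)).differentiableOn (by simp) _ hmem
  rw [(hf.dx hst i).timeDeriv_eq hst hr, (hf.timeDeriv hst).dx_eq i hr,
    fderivWithin_congr (f₁ := fun p : ℝ × Space d => MeanField.dx i f p.1 p.2)
      (fun p hp => hf.dx_eq i hp.1 p.2) (hf.dx_eq i hr x),
    fderivWithin_congr (f₁ := fun p : ℝ × Space d => MeanField.timeDeriv s t f p.1 p.2)
      (fun p hp => hf.timeDeriv_eq hst hp.1 p.2) (hf.timeDeriv_eq hst hr x)]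
  have key : ∀ v : ℝ × Space d, fderivWithin ℝ (fun p => fderivWithin ℝ
      (fun p : ℝ × Space d => f p.1 p.2) (Icc s t ×ˢ univ) p v) (Icc s t ×ˢ univ) (r, x) =
      (fderivWithin ℝ (fderivWithin ℝ (fun p : ℝ × Space d => f p.1 p.2) (Icc s t ×ˢ univ))
        (Icc s t ×ˢ univ) (r, x)).flip v := fun v => by
    have := (hd.hasFDerivWithinAt.clm_apply (hasFDerivWithinAt_const v _ _)).fderivWithin
      (hS _ hmem)
    simpa using this
  rw [key, key]
  exact hsymm _ _

end IsSmoothField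

section Rules

variable {b : Module.Basis (Fin d) ℝ (Space d)} {s t : ℝ} {f g : ℝ → Space d → ℝ} {r : ℝ}

lemma dx_add (hf : IsSmoothField b s t f) (hg : IsSmoothField b s t g) (hr : r ∈ Icc s t)
    (i : Fin d) (x : Space d) :
    dx i (fun r x => f r x + g r x) r x = dx i f r x + dx i g r x := by
  simp only [dx]
  rw [fderiv_fun_add (hf.differentiable hr x) (hg.differentiable hr x)]
  rfl

lemma dx_sub (hf : IsSmoothField b s t f) (hg : IsSmoothField b s t g) (hr : r ∈ Icc s t)
    (i : Fin d) (x : Space d) :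
    dx i (fun r x => f r x - g r x) r x = dx i f r x - dx i g r x := by
  simp only [dx]
  rw [fderiv_fun_sub (hf.differentiable hr x) (hg.differentiable hr x)]
  rfl

lemma dx_neg (i : Fin d) (x : Space d) : dx i (fun r x => -f r x) r x = -dx i f r x := by
  simp only [dx, fderiv_fun_neg]
  rfl

lemma dx_sum {ι : Type*} (A : Finset ι) {F : ι → ℝ → Space d → ℝ}
    (h : ∀ i ∈ A, IsSmoothField b s t (F i)) (hr : r ∈ Icc s t) (j : Fin d) (x : Space d) :
    dx j (fun r x => ∑ i ∈ A, F i r x) r x = ∑ i ∈ A, dx j (F i) r x := by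
  simp only [dx]
  rw [fderiv_fun_sum fun i hi => (h i hi).differentiable hr x]
  simp

lemma dx_mul (hf : IsSmoothField b s t f) (hg : IsSmoothField b s t g) (hr : r ∈ Icc s t)
    (i : Fin d) (x : Space d) :
    dx i (fun r x => f r x * g r x) r x = f r x * dx i g r x + dx i f r x * g r x := by
  simp only [dx]
  rw [fderiv_fun_mul (hf.differentiable hr x) (hg.differentiable hr x)]
  simp [mul_comm]

lemma dx_comp {h : ℝ → ℝ} (hh : ContDiffOn ℝ ∞ h (Ioi 0)) (hf : IsSmoothField b s t f)
    (hpos : ∀ r ∈ Icc s t, ∀ x, 0 < f r x) (hr : r ∈ Icc s t) (i : Fin d) (x : Space d) :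
    dx i (fun r x => h (f r x)) r x = deriv h (f r x) * dx i f r x := by
  simp only [dx]
  have h1 : HasDerivAt h (deriv h (f r x)) (f r x) :=
    ((hh.differentiableOn (by simp) _ (hpos r hr x)).differentiableAt
      (Ioi_mem_nhds (hpos r hr x))).hasDerivAt
  have := (h1.comp_hasFDerivAt x (hf.differentiable hr x).hasFDerivAt).fderiv
  simp only [Function.comp_def] at this
  rw [this]
  simp

lemma timeDeriv_add (hst : s < t) (hf : IsSmoothField b s t f) (hg : IsSmoothField b s t g)
    (hr : r ∈ Icc s t) (x : Space d) :
    timeDeriv s t (fun r x => f r x + g r x) r x = timeDeriv s t f r x + timeDeriv s t g r x :=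
  ((hf.hasDerivWithinAt hr x).add (hg.hasDerivWithinAt hr x)).derivWithin
    (uniqueDiffOn_Icc hst r hr)

lemma timeDeriv_mul (hst : s < t) (hf : IsSmoothField b s t f) (hg : IsSmoothField b s t g)
    (hr : r ∈ Icc s t) (x : Space d) :
    timeDeriv s t (fun r x => f r x * g r x) r x =
      f r x * timeDeriv s t g r x + timeDeriv s t f r x * g r x := by
  rw [add_comm]
  exact ((hf.hasDerivWithinAt hr x).mul (hg.hasDerivWithinAt hr x)).derivWithin
    (uniqueDiffOn_Icc hst r hr)

lemma timeDeriv_neg : timeDeriv s t (fun r x => -f r x) = fun r x => -timeDeriv s t f r x := by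
  funext r x
  exact derivWithin.fun_neg

lemma timeDeriv_sum (hst : s < t) {ι : Type*} (A : Finset ι) {F : ι → ℝ → Space d → ℝ}
    (h : ∀ i ∈ A, IsSmoothField b s t (F i)) (hr : r ∈ Icc s t) (x : Space d) :
    timeDeriv s t (fun r x => ∑ i ∈ A, F i r x) r x = ∑ i ∈ A, timeDeriv s t (F i) r x :=
  (HasDerivWithinAt.fun_sum fun i hi => (h i hi).hasDerivWithinAt hr x).derivWithin
    (uniqueDiffOn_Icc hst r hr)

lemma timeDeriv_comp (hst : s < t) {h : ℝ → ℝ} (hh : ContDiffOn ℝ ∞ h (Ioi 0))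
    (hf : IsSmoothField b s t f) (hpos : ∀ r ∈ Icc s t, ∀ x, 0 < f r x) (hr : r ∈ Icc s t)
    (x : Space d) :
    timeDeriv s t (fun r x => h (f r x)) r x = deriv h (f r x) * timeDeriv s t f r x := by
  have h1 : HasDerivAt h (deriv h (f r x)) (f r x) :=
    ((hh.differentiableOn (by simp) _ (hpos r hr x)).differentiableAt
      (Ioi_mem_nhds (hpos r hr x))).hasDerivAt
  exact (h1.comp_hasDerivWithinAt r (hf.hasDerivWithinAt hr x)).derivWithin
    (uniqueDiffOn_Icc hst r hr)

lemma timeDeriv_congr (h : ∀ r ∈ Icc s t, ∀ x, f r x = g r x) (hr : r ∈ Icc s t) (x : Space d) :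
    timeDeriv s t f r x = timeDeriv s t g r x :=
  derivWithin_congr (fun τ hτ => h τ hτ x) (h r hr x)

end Rules

/-! ### Primitives in time -/

section TimePrimitive

open Filter Topology

/-- Clamping the time variable extends a function on the slab to a globally continuous one, as the
theorems on parametric integrals require. -/
lemma continuous_projIcc_extend {Y : Type*} [TopologicalSpace Y] {s t : ℝ} (h : s ≤ t)
    {f : ℝ × Space d → Y} (hf : ContinuousOn f (Icc s t ×ˢ univ)) :
    Continuous fun p : ℝ × Space d => f ((projIcc s t h p.1 : ℝ), p.2) := by
  rw [← continuousOn_univ]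
  refine hf.comp (Continuous.continuousOn ?_) fun p _ => ⟨(projIcc s t h p.1).2, mem_univ _⟩
  exact ((continuous_subtype_val.comp continuous_projIcc).comp continuous_fst).prodMk
    continuous_snd

/-- The partial derivative in time comes from the fundamental theorem of calculus, the one in space
from dominated convergence; both are jointly continuous, which gives joint differentiability. -/
lemma hasFDerivAt_timeIntegral {Y : Type*} [NormedAddCommGroup Y] [NormedSpace ℝ Y]
    [CompleteSpace Y] (s : ℝ) {f : ℝ × Space d → Y} {f' : ℝ × Space d → Space d →L[ℝ] Y}
    (hf : Continuous f) (hf' : Continuous f')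
    (hd : ∀ r x, HasFDerivAt (fun x => f (r, x)) (f' (r, x)) x) (p : ℝ × Space d) :
    HasFDerivAt (fun p : ℝ × Space d => ∫ τ in s..p.1, f (τ, p.2))
      ((ContinuousLinearMap.toSpanSingleton ℝ (f p)).coprod (∫ τ in s..p.1, f' (τ, p.2))) p := by
  have hc' : Continuous fun p : ℝ × Space d => ∫ τ in s..p.1, f' (τ, p.2) :=
    intervalIntegral.continuous_parametric_intervalIntegral_of_continuous
      (f := fun (p : ℝ × Space d) τ => f' (τ, p.2)) (by fun_prop) continuous_fst
  have hx : ∀ p : ℝ × Space d, HasFDerivAt (fun x => ∫ τ in s..p.1, f (τ, x))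
      (∫ τ in s..p.1, f' (τ, p.2)) p.2 := fun p => by
    obtain ⟨C, hC⟩ := (isCompact_uIcc.prod (isCompact_closedBall p.2 1)).exists_bound_of_continuousOn
      (hf'.continuousOn (s := uIcc s p.1 ×ˢ Metric.closedBall p.2 1))
    refine intervalIntegral.hasFDerivAt_integral_of_dominated_of_fderiv_le
      (F' := fun x τ => f' (τ, x)) (bound := fun _ => C)
      (Metric.closedBall_mem_nhds p.2 one_pos) (Eventually.of_forall fun x => ?_) ?_ ?_ ?_ ?_ ?_
    · exact (hf.comp (by fun_prop : Continuous fun τ : ℝ => (τ, x))).aestronglyMeasurable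
    · exact (hf.comp (by fun_prop : Continuous fun τ : ℝ => (τ, p.2))).intervalIntegrable _ _
    · exact (hf'.comp (by fun_prop : Continuous fun τ : ℝ => (τ, p.2))).aestronglyMeasurable
    · exact Eventually.of_forall fun τ hτ x hx => hC (τ, x) ⟨uIoc_subset_uIcc hτ, hx⟩
    · exact intervalIntegrable_const
    · exact Eventually.of_forall fun τ _ x _ => hd τ x
  have ht : ∀ p : ℝ × Space d, HasFDerivAt (fun r => ∫ τ in s..r, f (τ, p.2))
      (ContinuousLinearMap.toSpanSingleton ℝ (f p)) p.1 := fun p => by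
    have hc : Continuous fun τ : ℝ => f (τ, p.2) := by fun_prop
    exact (hc.integral_hasStrictDerivAt s p.1).hasDerivAt.hasFDerivAt
  have := hasStrictFDerivAt_uncurry_coprod (𝕜 := ℝ) (u := p)
    (f := fun r x => ∫ τ in s..r, f (τ, x))
    (f₁ := fun r x => ContinuousLinearMap.toSpanSingleton ℝ (f (r, x)))
    (f₂ := fun r x => ∫ τ in s..r, f' (τ, x))
    (Eventually.of_forall ht) (Eventually.of_forall hx)
    (Continuous.continuousAt (by
      change Continuous fun p : ℝ × Space d => ContinuousLinearMap.toSpanSingleton ℝ (f (p.1, p.2))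
      exact (ContinuousLinearMap.toSpanSingletonCLE (𝕜 := ℝ) (E := Y)).continuous.comp hf))
    hc'.continuousAt
  exact this.hasFDerivAt

/-- Induction on n: the derivative of the primitive of f consists of f and of the primitive of the
spatial derivative of f. The latter takes values in a space of linear maps, so the target space is
quantified inside the induction. -/
lemma contDiffOn_timeIntegral {s t : ℝ} (hst : s < t) (n : ℕ) :
    ∀ {Y : Type*} [NormedAddCommGroup Y] [NormedSpace ℝ Y] [CompleteSpace Y]
      {f : ℝ × Space d → Y}, ContDiffOn ℝ n f (Icc s t ×ˢ univ) →
      ContDiffOn ℝ n (fun p : ℝ × Space d => ∫ τ in s..p.1, f (τ, p.2)) (Icc s t ×ˢ univ) := by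
  have hext : ∀ {Y : Type _} [NormedAddCommGroup Y] [NormedSpace ℝ Y] (f : ℝ × Space d → Y),
      ∀ p ∈ Icc s t ×ˢ (univ : Set (Space d)), ∫ τ in s..p.1, f (τ, p.2) =
        ∫ τ in s..p.1, f ((projIcc s t hst.le τ : ℝ), p.2) := fun f p hp => by
    refine intervalIntegral.integral_congr fun τ hτ => ?_
    rw [uIcc_of_le hp.1.1] at hτ
    rw [projIcc_of_mem hst.le ⟨hτ.1, hτ.2.trans hp.1.2⟩]
  induction n with
  | zero =>
    intro Y _ _ _ f hf
    rw [Nat.cast_zero, contDiffOn_zero] at hf ⊢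
    refine ContinuousOn.congr (Continuous.continuousOn ?_) (hext f)
    exact intervalIntegral.continuous_parametric_intervalIntegral_of_continuous
      (f := fun (p : ℝ × Space d) τ => f ((projIcc s t hst.le τ : ℝ), p.2))
      ((continuous_projIcc_extend hst.le hf).comp
        (by fun_prop : Continuous fun q : (ℝ × Space d) × ℝ => (q.2, q.1.2))) continuous_fst
  | succ n ih =>
    intro Y _ _ _ f hf
    set S : Set (ℝ × Space d) := Icc s t ×ˢ univ with hS
    have hU : UniqueDiffOn ℝ S := uniqueDiffOn_slab hst
    have hn0 : ((n + 1 : ℕ) : WithTop ℕ∞) ≠ 0 := by exact_mod_cast n.succ_ne_zero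
    let f' : ℝ × Space d → Space d →L[ℝ] Y := fun p =>
      (fderivWithin ℝ f S p).comp (ContinuousLinearMap.inr ℝ ℝ (Space d))
    have hf' : ContDiffOn ℝ n f' S :=
      (hf.fderivWithin hU (by norm_cast)).clm_comp contDiffOn_const
    push_cast
    rw [contDiffOn_succ_iff_hasFDerivWithinAt_of_uniqueDiffOn hU]
    refine ⟨by simp, fun p => (ContinuousLinearMap.toSpanSingleton ℝ (f p)).coprod
      (∫ τ in s..p.1, f' (τ, p.2)), ?_, fun p hp => ?_⟩
    · have h1 : ContDiffOn ℝ n (fun p => ContinuousLinearMap.toSpanSingleton ℝ (f p)) S :=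
        (ContinuousLinearMap.toSpanSingletonCLE (𝕜 := ℝ) (E := Y)).contDiff.comp_contDiffOn
          (hf.of_le (by norm_cast; omega))
      have h2 := ih hf'
      have h3 := (h1.clm_comp (contDiffOn_const (c := ContinuousLinearMap.fst ℝ ℝ (Space d)))).add
        (h2.clm_comp (contDiffOn_const (c := ContinuousLinearMap.snd ℝ ℝ (Space d))))
      refine h3.congr fun p _ => ?_
      ext <;> simp
    · have := (hasFDerivAt_timeIntegral s (continuous_projIcc_extend hst.le hf.continuousOn)
        (continuous_projIcc_extend hst.le hf'.continuousOn)
        (fun r x => hasFDerivAt_slice hn0 hf (projIcc s t hst.le r).2 x) p).hasFDerivWithinAt (s := S)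
      have h2 := this.congr (hext f) (hext f p hp)
      rw [projIcc_of_mem hst.le hp.1] at h2
      rwa [← hext f' p hp] at h2

variable {b : Module.Basis (Fin d) ℝ (Space d)} {s t : ℝ} {f : ℝ → Space d → ℝ}

lemma IsSmoothField.timeIntegral (hst : s < t) (hf : IsSmoothField b s t f) :
    IsSmoothField b s t (fun r x => ∫ τ in s..r, f τ x) where
  smooth := contDiffOn_infty.2 fun n =>
    contDiffOn_timeIntegral hst n (hf.smooth.of_le (by exact_mod_cast le_top))
  periodic r hr i x := by
    refine intervalIntegral.integral_congr fun τ hτ => ?_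
    rw [uIcc_of_le hr.1] at hτ
    exact hf.periodic τ ⟨hτ.1, hτ.2.trans hr.2⟩ i x

lemma timeDeriv_timeIntegral (hst : s < t) (hf : IsSmoothField b s t f) {r : ℝ}
    (hr : r ∈ Icc s t) (x : Space d) :
    timeDeriv s t (fun r x => ∫ τ in s..r, f τ x) r x = f r x := by
  have hc : ContinuousOn (fun τ => f τ x) (Icc s t) := fun τ hτ =>
    (hf.hasDerivWithinAt hτ x).continuousWithinAt
  have : Fact (r ∈ Icc s t) := ⟨hr⟩
  refine (intervalIntegral.integral_hasDerivWithinAt_right (s := Icc s t) (t := Icc s t)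
    ?_ ?_ (hc r hr)).derivWithin (uniqueDiffOn_Icc hst r hr)
  · refine (hc.mono ?_).intervalIntegrable
    rw [uIcc_of_le hr.1]
    exact Icc_subset_Icc_right hr.2
  · exact hc.stronglyMeasurableAtFilter_nhdsWithin measurableSet_Icc r

end TimePrimitive

/-! ### Periodicity and integration over the period cell -/

section Cell

variable {b : Module.Basis (Fin d) ℝ (Space d)}

lemma isCompact_domain (b : Module.Basis (Fin d) ℝ (Space d)) : IsCompact (domain b) :=
  b.parallelepiped.isCompact

lemma interior_domain_nonempty (b : Module.Basis (Fin d) ℝ (Space d)) :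
    (interior (domain b)).Nonempty := b.parallelepiped.interior_nonempty

lemma domain_subset_closure_interior (b : Module.Basis (Fin d) ℝ (Space d)) :
    domain b ⊆ closure (interior (domain b)) := by
  rw [domain, (convex_parallelepiped b).closure_interior_eq_closure_of_nonempty_interior
    (by exact interior_domain_nonempty b)]
  exact subset_closure

lemma IsPeriodic.add_span {Y : Type*} {f : Space d → Y} (hf : IsPeriodic b f) {v : Space d}
    (hv : v ∈ Submodule.span ℤ (range b)) (x : Space d) : f (x + v) = f x := by
  induction hv using Submodule.span_induction generalizing x with
  | mem v hv => obtain ⟨i, rfl⟩ := hv; exact hf i x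
  | zero => simp
  | add v w _ _ hv hw => rw [← add_assoc, hw, hv]
  | smul n v _ hv =>
    have hneg : ∀ x, f (x + -v) = f x := fun x => by rw [← hv (x + -v), neg_add_cancel_right]
    induction n using Int.induction_on generalizing x with
    | zero => simp
    | succ n ih => rw [add_smul, one_smul, ← add_assoc, hv, ih]
    | pred n ih => rw [sub_smul, one_smul, sub_eq_add_neg, ← add_assoc, hneg, ih]

lemma IsPeriodic.exists_mem_domain {Y : Type*} {f : Space d → Y} (hf : IsPeriodic b f)
    (x : Space d) : f (ZSpan.fract b x) = f x := by
  have h := hf.add_span (ZSpan.floor b x).2 (ZSpan.fract b x)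
  rw [ZSpan.fract_apply] at h ⊢
  rw [← h]
  simp

lemma fract_mem_domain (x : Space d) : ZSpan.fract b x ∈ domain b :=
  ZSpan.fundamentalDomain_subset_parallelepiped b (ZSpan.fract_mem_fundamentalDomain b x)

open scoped Pointwise in
-- The translate of a fundamental domain of the period lattice is again one, and the closed
-- parallelepiped agrees with the half-open domain up to a null set.
lemma IsPeriodic.integral_translate {f : Space d → ℝ} (hf : IsPeriodic b f) (v : Space d) :
    ∫ x in domain b, f (x + v) = ∫ x in domain b, f x := by
  have hae := ZSpan.fundamentalDomain_ae_parallelepiped b (volume : Measure (Space d))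
  have hD := ZSpan.isAddFundamentalDomain' b (volume : Measure (Space d))
  rw [domain, ← setIntegral_congr_set hae, ← setIntegral_congr_set hae]
  have hV : IsAddFundamentalDomain (Submodule.span ℤ (range b)).toAddSubgroup
      (v +ᵥ ZSpan.fundamentalDomain b) (volume : Measure (Space d)) := by
    have : VAddCommClass (Space d) (Submodule.span ℤ (range b)).toAddSubgroup (Space d) :=
      ⟨fun a g x => add_left_comm a g.1 x⟩
    exact hD.vadd_of_comm v
  have : Countable (Submodule.span ℤ (range b)).toAddSubgroup :=
    inferInstanceAs (Countable (Submodule.span ℤ (range b)))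
  have h := (measurePreserving_add_right (volume : Measure (Space d)) v).setIntegral_image_emb
    (MeasurableEquiv.addRight v).measurableEmbedding f (ZSpan.fundamentalDomain b)
  refine h.symm.trans (Eq.trans ?_ (hV.setIntegral_eq hD (f := f) fun g x => ?_))
  · congr 2
    ext x
    simp only [mem_vadd_set, mem_image, vadd_eq_add, add_comm]
  · rw [AddSubgroup.vadd_def, vadd_eq_add, add_comm]
    exact hf.add_span g.2 x

end Cell

lemma hasDerivAt_setIntegral {X : Type*} [TopologicalSpace X] [MeasurableSpace X]
    [OpensMeasurableSpace X] [T2Space X] {μ : Measure X} [IsFiniteMeasureOnCompacts μ] {K : Set X}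
    (hK : IsCompact K) {δ : ℝ} (hδ : 0 < δ) {H H' : ℝ → X → ℝ}
    (hH : ∀ ε ∈ Icc (-δ) δ, ContinuousOn (H ε) K)
    (hH' : ContinuousOn (fun p : ℝ × X => H' p.1 p.2) (Icc (-δ) δ ×ˢ K))
    (hd : ∀ ε ∈ Icc (-δ) δ, ∀ x ∈ K, HasDerivAt (fun ε => H ε x) (H' ε x) ε) :
    HasDerivAt (fun ε => ∫ x in K, H ε x ∂μ) (∫ x in K, H' 0 x ∂μ) 0 := by
  have hm : MeasurableSet K := hK.measurableSet
  have hnhds : Icc (-δ) δ ∈ nhds (0 : ℝ) := Icc_mem_nhds (by linarith) hδ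
  have h0 : (0 : ℝ) ∈ Icc (-δ) δ := ⟨by linarith, hδ.le⟩
  obtain ⟨C, hC⟩ := (isCompact_Icc.prod hK).exists_bound_of_continuousOn hH'
  refine (hasDerivAt_integral_of_dominated_loc_of_deriv_le (bound := fun _ => C) hnhds ?_ ?_ ?_ ?_ ?_
    ?_).2
  · filter_upwards [hnhds] with ε hε
    exact ((hH ε hε).integrableOn_compact hK).aestronglyMeasurable
  · exact (hH 0 h0).integrableOn_compact hK
  · refine ContinuousOn.integrableOn_compact hK ?_ |>.aestronglyMeasurable
    exact hH'.comp (by fun_prop : Continuous fun x : X => ((0 : ℝ), x)).continuousOn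
      fun x hx => ⟨h0, hx⟩
  · filter_upwards [ae_restrict_mem hm] with x hx ε hε using hC (ε, x) ⟨hε, hx⟩
  · exact integrableOn_const (hK.measure_lt_top.ne)
  · filter_upwards [ae_restrict_mem hm] with x hx ε hε using hd ε hε x hx

section Cell

variable {b : Module.Basis (Fin d) ℝ (Space d)}

/-- By translation invariance ε ↦ ∫ f(x + εv) is constant; its derivative at 0 is the integral in
question. This replaces a divergence theorem with cancelling boundary faces. -/
lemma IsPeriodic.integral_fderiv_eq_zero {f : Space d → ℝ} (hp : IsPeriodic b f)
    (hf : ContDiff ℝ ∞ f) (v : Space d) : ∫ x in domain b, fderiv ℝ f x v = 0 := by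
  have hc : Continuous fun p : ℝ × Space d => fderiv ℝ f (p.2 + p.1 • v) v :=
    ((hf.continuous_fderiv (by simp)).comp (by fun_prop)).clm_apply continuous_const
  have h := hasDerivAt_setIntegral (μ := (volume : Measure (Space d))) (isCompact_domain b)
    one_pos (H := fun ε x => f (x + ε • v)) (H' := fun ε x => fderiv ℝ f (x + ε • v) v)
    (fun ε _ => (hf.continuous.comp (by fun_prop)).continuousOn) hc.continuousOn
    (fun ε _ x _ => by
      have h1 : HasDerivAt (fun ε : ℝ => x + ε • v) v ε := by
        simpa using ((hasDerivAt_id ε).smul_const v).const_add x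
      exact ((hf.differentiable (by simp) _).hasFDerivAt.comp_hasDerivAt ε h1))
  simp only [hp.integral_translate, zero_smul, add_zero] at h
  exact h.unique (hasDerivAt_const _ _)

lemma eqOn_zero_of_setIntegral_eq_zero {X : Type*} [TopologicalSpace X] [MeasurableSpace X]
    [OpensMeasurableSpace X] [T2Space X] {μ : Measure X} [IsFiniteMeasureOnCompacts μ]
    [μ.IsOpenPosMeasure] {K : Set X} (hK : IsCompact K) (hKi : K ⊆ closure (interior K))
    {f : X → ℝ} (hf : ContinuousOn f K) (h0 : ∀ x ∈ K, 0 ≤ f x) (hi : ∫ x in K, f x ∂μ = 0) :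
    EqOn f 0 K := by
  have hae : f =ᵐ[μ.restrict K] 0 := by
    rwa [integral_eq_zero_iff_of_nonneg_ae _ (hf.integrableOn_compact hK)] at hi
    filter_upwards [ae_restrict_mem hK.measurableSet] with x hx using h0 x hx
  exact Measure.eqOn_of_ae_eq hae hf continuousOn_const hKi

lemma IsPeriodic.eq_zero_of_integral_eq_zero {f : Space d → ℝ} (hp : IsPeriodic b f)
    (hf : Continuous f) (h0 : ∀ x, 0 ≤ f x) (hi : ∫ x in domain b, f x = 0) (x : Space d) :
    f x = 0 := by
  rw [← hp.exists_mem_domain]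
  exact eqOn_zero_of_setIntegral_eq_zero (isCompact_domain b) (domain_subset_closure_interior b)
    hf.continuousOn (fun x _ => h0 x) hi (fract_mem_domain x)

/-- The space-time cell `[s, t] × Ω`. -/
def cell (b : Module.Basis (Fin d) ℝ (Space d)) (s t : ℝ) : Set (ℝ × Space d) :=
  Icc s t ×ˢ domain b

variable {s t : ℝ}

lemma isCompact_cell : IsCompact (cell b s t) := isCompact_Icc.prod (isCompact_domain b)

lemma cell_subset_slab : cell b s t ⊆ Icc s t ×ˢ univ := prod_mono_right (subset_univ _)

lemma cell_subset_closure_interior (hst : s < t) : cell b s t ⊆ closure (interior (cell b s t)) := by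
  rw [cell, interior_prod_eq, closure_prod_eq, closure_interior_Icc hst.ne]
  exact prod_mono_right (domain_subset_closure_interior b)

lemma integral_cell_eq (hst : s ≤ t) {f : ℝ → Space d → ℝ}
    (hf : ContinuousOn (fun p : ℝ × Space d => f p.1 p.2) (cell b s t)) :
    ∫ p in cell b s t, f p.1 p.2 = ∫ r in s..t, ∫ x in domain b, f r x := by
  rw [intervalIntegral.integral_of_le hst, ← integral_Icc_eq_integral_Ioc, cell,
    Measure.volume_eq_prod, setIntegral_prod]
  rw [← Measure.volume_eq_prod]
  exact hf.integrableOn_compact isCompact_cell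

lemma integral_cell_eq_symm (hst : s ≤ t) {f : ℝ → Space d → ℝ}
    (hf : ContinuousOn (fun p : ℝ × Space d => f p.1 p.2) (cell b s t)) :
    ∫ p in cell b s t, f p.1 p.2 = ∫ x in domain b, ∫ r in s..t, f r x := by
  have h : IntegrableOn (fun p : ℝ × Space d => f p.1 p.2) (cell b s t) :=
    hf.integrableOn_compact isCompact_cell
  simp only [intervalIntegral.integral_of_le hst, ← integral_Icc_eq_integral_Ioc]
  rw [cell, Measure.volume_eq_prod, ← Measure.prod_restrict]
  rw [IntegrableOn, cell, Measure.volume_eq_prod, ← Measure.prod_restrict] at h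
  exact integral_prod_symm _ h

/-! ### Bounds and integration by parts on the space-time cell. -/

namespace IsSmoothField

variable {f g : ℝ → Space d → ℝ}

lemma integrableOn_cell (hf : IsSmoothField b s t f) :
    IntegrableOn (fun p : ℝ × Space d => f p.1 p.2) (cell b s t) :=
  (hf.continuousOn.mono cell_subset_slab).integrableOn_compact isCompact_cell

lemma exists_bound (hf : IsSmoothField b s t f) :
    ∃ C, ∀ r ∈ Icc s t, ∀ x, |f r x| ≤ C := by
  obtain ⟨C, hC⟩ := (isCompact_cell (b := b)).exists_bound_of_continuousOn
    (hf.continuousOn.mono cell_subset_slab)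
  refine ⟨C, fun r hr x => ?_⟩
  rw [← (hf.periodic r hr).exists_mem_domain]
  exact hC (r, _) ⟨hr, fract_mem_domain x⟩

lemma eq_zero_of_integral_cell_eq_zero (hst : s < t) (hf : IsSmoothField b s t f)
    (h0 : ∀ r ∈ Icc s t, ∀ x, 0 ≤ f r x) (hi : ∫ p in cell b s t, f p.1 p.2 = 0)
    {r : ℝ} (hr : r ∈ Icc s t) (x : Space d) : f r x = 0 := by
  rw [← (hf.periodic r hr).exists_mem_domain]
  exact eqOn_zero_of_setIntegral_eq_zero isCompact_cell (cell_subset_closure_interior hst)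
    (hf.continuousOn.mono cell_subset_slab) (fun p hp => h0 p.1 hp.1 p.2) hi
    (show (r, _) ∈ cell b s t from ⟨hr, fract_mem_domain x⟩)

lemma integral_dx (hst : s < t) (hf : IsSmoothField b s t f) (i : Fin d) :
    ∫ p in cell b s t, MeanField.dx i f p.1 p.2 = 0 := by
  rw [integral_cell_eq hst.le ((hf.dx hst i).continuousOn.mono cell_subset_slab)]
  refine (intervalIntegral.integral_congr (g := fun _ => (0 : ℝ)) fun r hr => ?_).trans (by simp)
  rw [uIcc_of_le hst.le] at hr
  exact (hf.periodic r hr).integral_fderiv_eq_zero (hf.slice hr) _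

lemma integral_mul_dx (hst : s < t) (hf : IsSmoothField b s t f) (hg : IsSmoothField b s t g)
    (i : Fin d) :
    ∫ p in cell b s t, f p.1 p.2 * MeanField.dx i g p.1 p.2 =
      -∫ p in cell b s t, MeanField.dx i f p.1 p.2 * g p.1 p.2 := by
  rw [eq_neg_iff_add_eq_zero, ← integral_add (hf.mul (hg.dx hst i)).integrableOn_cell
    ((hf.dx hst i).mul hg).integrableOn_cell, ← (hf.mul hg).integral_dx hst i]
  exact setIntegral_congr_fun isCompact_cell.measurableSet fun p hp =>
    (dx_mul hf hg hp.1 i p.2).symm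

lemma integral_timeDeriv (hst : s < t) (hf : IsSmoothField b s t f) :
    ∫ p in cell b s t, MeanField.timeDeriv s t f p.1 p.2 = ∫ x in domain b, (f t x - f s x) := by
  rw [integral_cell_eq_symm hst.le ((hf.timeDeriv hst).continuousOn.mono cell_subset_slab)]
  refine integral_congr_ae (Filter.Eventually.of_forall fun x => ?_)
  refine intervalIntegral.integral_eq_sub_of_hasDeriv_right_of_le hst.le
    (fun r hr => (hf.hasDerivWithinAt hr x).continuousWithinAt)
    (fun r hr => ((hf.hasDerivWithinAt (Ioo_subset_Icc_self hr) x).hasDerivAt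
      (Icc_mem_nhds hr.1 hr.2)).hasDerivWithinAt) ?_
  refine ContinuousOn.intervalIntegrable fun r hr => ?_
  rw [uIcc_of_le hst.le] at hr ⊢
  exact ((hf.timeDeriv hst).hasDerivWithinAt hr x).continuousWithinAt

/-- Variations keep the initial density fixed, so only the terminal boundary term survives. -/
lemma integral_mul_timeDeriv (hst : s < t) (hf : IsSmoothField b s t f)
    (hg : IsSmoothField b s t g) (h0 : ∀ x, g s x = 0) :
    ∫ p in cell b s t, f p.1 p.2 * MeanField.timeDeriv s t g p.1 p.2 =
      (∫ x in domain b, f t x * g t x) -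
        ∫ p in cell b s t, MeanField.timeDeriv s t f p.1 p.2 * g p.1 p.2 := by
  have h := (hf.mul hg).integral_timeDeriv hst
  simp only [h0, mul_zero, sub_zero] at h
  rw [eq_sub_iff_add_eq, ← integral_add (hf.mul (hg.timeDeriv hst)).integrableOn_cell
    ((hf.timeDeriv hst).mul hg).integrableOn_cell, ← h]
  exact setIntegral_congr_fun isCompact_cell.measurableSet fun p hp =>
    (timeDeriv_mul hst hf hg hp.1 p.2).symm

end IsSmoothField

end Cell

/-! ### The first variation of the control problem -/

section Mobility

variable {F G R V₂ : ℝ → ℝ}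

lemma contDiffOn_deriv {h : ℝ → ℝ} (hh : ContDiffOn ℝ ∞ h (Ioi 0)) :
    ContDiffOn ℝ ∞ (deriv h) (Ioi 0) :=
  hh.deriv_of_isOpen isOpen_Ioi (by simp)

lemma hasDerivAt_of_contDiffOn {h : ℝ → ℝ} (hh : ContDiffOn ℝ ∞ h (Ioi 0)) {a : ℝ} (ha : 0 < a) :
    HasDerivAt h (deriv h a) a :=
  ((hh.differentiableOn (by simp) _ ha).differentiableAt (Ioi_mem_nhds ha)).hasDerivAt

namespace StandingAssumptions

lemma smooth_deriv2_G (hyp : StandingAssumptions F G R V₂) :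
    ContDiffOn ℝ ∞ (iteratedDeriv 2 G) (Ioi 0) := by
  rw [iteratedDeriv_succ, iteratedDeriv_one]
  exact contDiffOn_deriv (contDiffOn_deriv hyp.smooth_G)

lemma smooth_V₁ (hyp : StandingAssumptions F G R V₂) : ContDiffOn ℝ ∞ (V₁ F G) (Ioi 0) :=
  (contDiffOn_deriv hyp.smooth_F).div hyp.smooth_deriv2_G fun s hs => (hyp.deriv2_G_pos s hs).ne'

lemma V₁_pos (hyp : StandingAssumptions F G R V₂) {s : ℝ} (hs : 0 < s) : 0 < V₁ F G s :=
  div_pos (hyp.deriv_F_pos s hs) (hyp.deriv2_G_pos s hs)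

end StandingAssumptions

/-- A mobility is smooth on `(0, ∞)` and either positive or identically zero there. -/
structure IsMobility (V : ℝ → ℝ) : Prop where
  smooth : ContDiffOn ℝ ∞ V (Ioi 0)
  sign : (∀ s, 0 < s → 0 < V s) ∨ (∀ s, 0 < s → V s = 0)

lemma IsMobility.deriv_eq_zero {V : ℝ → ℝ} (h : ∀ s, 0 < s → V s = 0) {s : ℝ} (hs : 0 < s) :
    deriv V s = 0 := by
  have : V =ᶠ[nhds s] fun _ => 0 := by
    filter_upwards [Ioi_mem_nhds hs] with a ha using h a ha
  rw [this.deriv_eq]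
  simp

/-- The derivative of `ε ↦ (a + ε c)² / V (u + ε η)`. -/
def actionDeriv (V : ℝ → ℝ) (a c u η ε : ℝ) : ℝ :=
  2 * (a + ε * c) * c / V (u + ε * η) -
    (a + ε * c) ^ 2 * (deriv V (u + ε * η) * η) / V (u + ε * η) ^ 2

/-- For a vanishing mobility the convention a / 0 = 0 makes the action and its derivative zero, so
the reactive and the purely diffusive case share one flux functional. -/
lemma IsMobility.hasDerivAt_action {V : ℝ → ℝ} (hV : IsMobility V) {a c u η ε : ℝ}
    (hpos : 0 < u + ε * η) :
    HasDerivAt (fun ε => (a + ε * c) ^ 2 / V (u + ε * η)) (actionDeriv V a c u η ε) ε := by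
  have hlin : ∀ a c : ℝ, HasDerivAt (fun ε : ℝ => a + ε * c) c ε := fun a c => by
    simpa using ((hasDerivAt_id ε).mul_const c).const_add a
  rcases hV.sign with h | h
  · have h1 : HasDerivAt (fun ε => V (u + ε * η)) (deriv V (u + ε * η) * η) ε :=
      (hasDerivAt_of_contDiffOn hV.smooth hpos).comp ε (hlin u η)
    have h2 := ((hlin a c).pow 2).div h1 (h _ hpos).ne'
    have := (h _ hpos).ne'
    refine h2.congr_deriv ?_
    simp only [actionDeriv, Pi.pow_apply]
    field_simp
    ring
  · have h0 : (fun ε => (a + ε * c) ^ 2 / V (u + ε * η)) =ᶠ[nhds ε] fun _ => 0 := by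
      filter_upwards [(hlin u η).continuousAt.eventually (Ioi_mem_nhds hpos)] with e he
      rw [h _ he, div_zero]
    rw [actionDeriv, h _ hpos]
    simpa using (hasDerivAt_const ε (0 : ℝ)).congr_of_eventuallyEq h0

lemma IsMobility.continuousOn_action {X : Type*} [TopologicalSpace X] {V : ℝ → ℝ}
    (hV : IsMobility V) {K : Set X} {a u : X → ℝ}
    (ha : ContinuousOn a K) (hu : ContinuousOn u K) (hpos : ∀ x ∈ K, 0 < u x) :
    ContinuousOn (fun x => a x ^ 2 / V (u x)) K := by
  rcases hV.sign with h | h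
  · exact (ha.pow 2).div (hV.smooth.continuousOn.comp hu hpos) fun x hx => (h _ (hpos x hx)).ne'
  · exact continuousOn_const.congr fun x hx => by rw [h _ (hpos x hx), div_zero]

lemma IsMobility.continuousOn_actionDeriv {X : Type*} [TopologicalSpace X] {V : ℝ → ℝ}
    (hV : IsMobility V) {K : Set X} {δ : ℝ} {a c u η : X → ℝ}
    (ha : ContinuousOn a K) (hc : ContinuousOn c K) (hu : ContinuousOn u K)
    (hη : ContinuousOn η K) (hpos : ∀ ε ∈ Icc (-δ) δ, ∀ x ∈ K, 0 < u x + ε * η x) :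
    ContinuousOn (fun p : ℝ × X => actionDeriv V (a p.2) (c p.2) (u p.2) (η p.2) p.1)
      (Icc (-δ) δ ×ˢ K) := by
  have hpos' : ∀ p ∈ Icc (-δ) δ ×ˢ K, 0 < u p.2 + p.1 * η p.2 := fun p hp => hpos _ hp.1 _ hp.2
  have hsnd : ∀ {f : X → ℝ}, ContinuousOn f K →
      ContinuousOn (fun p : ℝ × X => f p.2) (Icc (-δ) δ ×ˢ K) := fun hf =>
    hf.comp continuousOn_snd fun p hp => hp.2
  have hU := (hsnd hu).add (continuousOn_fst.mul (hsnd hη))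
  have hA := (hsnd ha).add (continuousOn_fst.mul (hsnd hc))
  rcases hV.sign with h | h
  · have hVc := hV.smooth.continuousOn.comp hU hpos'
    have hVd := (contDiffOn_deriv hV.smooth).continuousOn.comp hU hpos'
    have hne : ∀ p ∈ Icc (-δ) δ ×ˢ K, V (u p.2 + p.1 * η p.2) ≠ 0 := fun p hp =>
      (h _ (hpos' p hp)).ne'
    exact (((continuousOn_const.mul hA).mul (hsnd hc)).div hVc hne).sub
      (((hA.pow 2).mul (hVd.mul (hsnd hη))).div (hVc.pow 2) fun p hp => pow_ne_zero 2 (hne p hp))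
  · exact (continuousOn_const (c := (0 : ℝ))).congr fun p hp => by
      simp [actionDeriv, h _ (hpos' p hp)]

end Mobility

lemma exists_pos_perturbation {X : Type*} [TopologicalSpace X] {K : Set X} (hK : IsCompact K)
    {u η : X → ℝ} (hu : ContinuousOn u K) (hη : ContinuousOn η K) (hpos : ∀ x ∈ K, 0 < u x) :
    ∃ δ > 0, ∀ ε ∈ Icc (-δ) δ, ∀ x ∈ K, 0 < u x + ε * η x := by
  obtain ⟨C, hC⟩ := hK.exists_bound_of_continuousOn (hη.div hu fun x hx => (hpos x hx).ne')
  -- Since |η| ≤ |C| u, this choice gives |εη| ≤ |C| u / (|C| + 1) < u.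
  refine ⟨1 / (|C| + 1), by positivity, fun ε hε x hx => ?_⟩
  have hu0 := hpos x hx
  have h1 : |η x| ≤ |C| * u x := by
    have := (hC x hx).trans (le_abs_self C)
    simp only [Pi.div_apply, norm_div, Real.norm_eq_abs, abs_of_pos hu0] at this
    rwa [div_le_iff₀ hu0] at this
  have h2 : |ε| ≤ 1 / (|C| + 1) := abs_le.2 hε
  have h3 : |ε * η x| ≤ 1 / (|C| + 1) * (|C| * u x) := by
    rw [abs_mul]
    exact mul_le_mul h2 h1 (abs_nonneg _) (by positivity)
  have h4 : 1 / (|C| + 1) * (|C| * u x) < u x := by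
    rw [div_mul_eq_mul_div, one_mul, div_lt_iff₀ (by positivity)]
    nlinarith
  linarith [neg_abs_le (ε * η x)]

section Energy

variable {b : Module.Basis (Fin d) ℝ (Space d)} {G : ℝ → ℝ}

lemma hasDerivAt_energy (hG : ContDiffOn ℝ ∞ G (Ioi 0)) {u η : Space d → ℝ} (hu : Continuous u)
    (hη : Continuous η) (hpos : ∀ x, 0 < u x) :
    HasDerivAt (fun ε : ℝ => energy b G (fun x => u x + ε * η x))
      (∫ x in domain b, deriv G (u x) * η x) 0 := by
  obtain ⟨δ, hδ, hp⟩ := exists_pos_perturbation (isCompact_domain b) hu.continuousOn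
    hη.continuousOn fun x _ => hpos x
  have h := hasDerivAt_setIntegral (μ := (volume : Measure (Space d))) (isCompact_domain b) hδ
    (H := fun ε x => G (u x + ε * η x)) (H' := fun ε x => deriv G (u x + ε * η x) * η x)
    (fun ε hε => hG.continuousOn.comp (by fun_prop) fun x hx => hp ε hε x hx)
    (((contDiffOn_deriv hG).continuousOn.comp (by fun_prop)
      fun p hq => hp p.1 hq.1 p.2 hq.2).mul (by fun_prop))
    (fun ε hε x hx => by
      have hlin : HasDerivAt (fun ε : ℝ => u x + ε * η x) (η x) ε := by
        simpa using ((hasDerivAt_id ε).mul_const (η x)).const_add (u x)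
      exact (hasDerivAt_of_contDiffOn hG (hp ε hε x hx)).comp ε hlin)
  simpa [energy] using h

end Energy

section Variation

variable {b : Module.Basis (Fin d) ℝ (Space d)} {F G R V₂ : ℝ → ℝ} {s t : ℝ}
  {u₀ : Space d → ℝ} {u : ℝ → Space d → ℝ} {v₁ : ℝ → Space d → Space d} {v₂ : ℝ → Space d → ℝ}

lemma IsSmoothField.component {v : ℝ → Space d → Space d} (hv : IsSmoothField b s t v)
    (i : Fin d) : IsSmoothField b s t (fun r x => v r x i) where
  smooth := contDiffOn_euclidean.1 hv.smooth i
  periodic r hr j x := by simp only [hv.periodic r hr j x]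

lemma IsSmoothField.ofComponents {w : Fin d → ℝ → Space d → ℝ}
    (hw : ∀ i, IsSmoothField b s t (w i)) :
    IsSmoothField b s t (fun r x => (WithLp.toLp 2 fun i => w i r x : Space d)) where
  smooth := contDiffOn_euclidean.2 fun i => (hw i).smooth
  periodic r hr j x := by
    ext i
    exact (hw i).periodic r hr j x

/-- Division by a mobility, with value zero where the mobility vanishes. -/
lemma IsMobility.div_smooth {V : ℝ → ℝ} (hV : IsMobility V) {f g : ℝ → Space d → ℝ}
    (hf : IsSmoothField b s t f) (hg : IsSmoothField b s t g)
    (hpos : ∀ r ∈ Icc s t, ∀ x, 0 < g r x) :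
    IsSmoothField b s t (fun r x => f r x / V (g r x)) := by
  rcases hV.sign with h | h
  · refine (hf.mul (hg.comp (h := fun a => (V a)⁻¹) (hV.smooth.inv fun a ha => (h a ha).ne')
      hpos)).congr fun r _ x => div_eq_mul_inv _ _
  · exact (IsSmoothField.const 0).congr fun r hr x => by rw [h _ (hpos r hr x), div_zero]

lemma cost_eq (hst : s ≤ t) {L : ℝ → Space d → ℝ}
    (hL : ContinuousOn (fun p : ℝ × Space d => L p.1 p.2) (cell b s t))
    (h : ∀ r ∈ Icc s t, ∀ x, 1 / 2 * ‖v₁ r x‖ ^ 2 * V₁ F G (u r x)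
      + 1 / 2 * |v₂ r x| ^ 2 * V₂ (u r x) = L r x) :
    cost b F G V₂ s t u v₁ v₂ = (∫ p in cell b s t, L p.1 p.2) + energy b G (u t) := by
  rw [cost, integral_cell_eq hst hL]
  congr 1
  refine intervalIntegral.integral_congr fun r hr => ?_
  rw [uIcc_of_le hst] at hr
  simp only [h r hr]

/-- The lagrangian in terms of the fluxes `m + ε w`, `n + ε ζ` along the density `u + ε η`. -/
def fluxLagrangian (F G V₂ : ℝ → ℝ) (m w : Fin d → ℝ) (n ζ u η ε : ℝ) : ℝ :=
  1 / 2 * (∑ i, (m i + ε * w i) ^ 2 / V₁ F G (u + ε * η)) +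
    1 / 2 * ((n + ε * ζ) ^ 2 / V₂ (u + ε * η))

lemma half_sq_div_mul {V : ℝ → ℝ} (hV : IsMobility V) {a u : ℝ} (hu : 0 < u) :
    (a / V u) ^ 2 * V u = a ^ 2 / V u := by
  rcases hV.sign with h | h
  · have := (h u hu).ne'
    field_simp
  · simp [h u hu]

variable {w : Fin d → ℝ → Space d → ℝ} {η ζ : ℝ → Space d → ℝ}

/-- The fluxes are perturbed linearly and then divided by the mobility at the new density, so the
constraint follows from its linearity. If V₂ vanishes there is no reaction flux to perturb, whence
the condition on ζ. -/
lemma IsAdmissible.perturb (hyp : StandingAssumptions F G R V₂) (hst : s < t)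
    (ha : IsAdmissible b F G V₂ s t u₀ u v₁ v₂) (hη : IsSmoothField b s t η)
    (hw : ∀ i, IsSmoothField b s t (w i)) (hζ : IsSmoothField b s t ζ) (hη0 : ∀ x, η s x = 0)
    (hcont : ∀ r ∈ Icc s t, ∀ x, timeDeriv s t η r x + ∑ i, dx i (w i) r x = ζ r x)
    (hζ0 : (∀ a, 0 < a → V₂ a = 0) → ∀ r ∈ Icc s t, ∀ x, ζ r x = 0) {ε : ℝ}
    (hpos : ∀ r ∈ Icc s t, ∀ x, 0 < u r x + ε * η r x) :
    IsAdmissible b F G V₂ s t u₀ (fun r x => u r x + ε * η r x)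
      (fun r x => WithLp.toLp 2 fun i =>
        (V₁ F G (u r x) * v₁ r x i + ε * w i r x) / V₁ F G (u r x + ε * η r x))
      (fun r x => (V₂ (u r x) * v₂ r x + ε * ζ r x) / V₂ (u r x + ε * η r x)) := by
  have hu := ha.density.toIsSmoothField
  have hV₁ : IsMobility (V₁ F G) := ⟨hyp.smooth_V₁, Or.inl fun _ => hyp.V₁_pos⟩
  have hV₂ : IsMobility V₂ := ⟨hyp.smooth_V₂, hyp.V₂_sign⟩
  have huε : IsSmoothField b s t (fun r x => u r x + ε * η r x) :=
    hu.add ((IsSmoothField.const ε).mul hη)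
  have hm : ∀ i, IsSmoothField b s t (fun r x => V₁ F G (u r x) * v₁ r x i) := fun i =>
    (hu.comp hyp.smooth_V₁ ha.density.pos).mul (ha.smooth_v₁.component i)
  have hεw : ∀ i, IsSmoothField b s t (fun r x => ε * w i r x) := fun i =>
    (IsSmoothField.const ε).mul (hw i)
  refine ⟨⟨huε, hpos⟩, IsSmoothField.ofComponents fun i => ?_, ?_, fun r hr x => ?_, ?_⟩
  · exact hV₁.div_smooth ((hm i).add (hεw i)) huε hpos
  · exact hV₂.div_smooth (((hu.comp hyp.smooth_V₂ ha.density.pos).mul ha.smooth_v₂).add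
      ((IsSmoothField.const ε).mul hζ)) huε hpos
  · have h1 : timeDeriv s t (fun r x => u r x + ε * η r x) r x =
        timeDeriv s t u r x + ε * timeDeriv s t η r x := by
      rw [timeDeriv_add hst hu ((IsSmoothField.const ε).mul hη) hr,
        timeDeriv_mul hst (IsSmoothField.const (b := b) ε) hη hr]
      simp [timeDeriv]
    have h2 := ha.continuity r hr x
    have h3 : divergence (fun y => V₁ F G (u r y) • v₁ r y) x =
      ∑ i, dx i (fun r x => V₁ F G (u r x) * v₁ r x i) r x := rfl
    have h4 : divergence (fun y => V₁ F G (u r y + ε * η r y) • (WithLp.toLp 2 fun i =>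
        (V₁ F G (u r y) * v₁ r y i + ε * w i r y) / V₁ F G (u r y + ε * η r y) : Space d)) x =
        ∑ i, (dx i (fun r x => V₁ F G (u r x) * v₁ r x i) r x + ε * dx i (w i) r x) := by
      refine Finset.sum_congr rfl fun i _ => ?_
      have h5 : ε * dx i (w i) r x = dx i (fun r x => ε * w i r x) r x := by
        rw [dx_mul (IsSmoothField.const (b := b) ε) (hw i) hr]
        simp [dx]
      rw [h5, ← dx_add (hm i) (hεw i) hr]
      refine dx_congr (f := fun r y => (V₁ F G (u r y + ε * η r y) • (WithLp.toLp 2 fun i =>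
        (V₁ F G (u r y) * v₁ r y i + ε * w i r y) / V₁ F G (u r y + ε * η r y) : Space d)) i)
        (fun y => ?_) i x
      have := (hyp.V₁_pos (hpos r hr y)).ne'
      simp only [PiLp.smul_apply, smul_eq_mul]
      field_simp
    rw [h1, h4, Finset.sum_add_distrib, ← Finset.mul_sum]
    rw [h3] at h2
    have h6 : (V₂ (u r x) * v₂ r x + ε * ζ r x) / V₂ (u r x + ε * η r x) *
        V₂ (u r x + ε * η r x) = v₂ r x * V₂ (u r x) + ε * ζ r x := by
      rcases hyp.V₂_sign with h | h
      · rw [div_mul_cancel₀ _ (h _ (hpos r hr x)).ne', mul_comm]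
      · simp [h _ (hpos r hr x), h _ (ha.density.pos r hr x), hζ0 h r hr x]
    rw [h6, ← h2, ← hcont r hr x]
    ring
  · funext x
    rw [hη0, ha.initial]
    ring

set_option maxHeartbeats 400000 in
/-- The Euler-Lagrange equation of the control problem in weak form. -/
lemma IsMinimizer.first_variation (hyp : StandingAssumptions F G R V₂) (hst : s < t)
    (hmin : IsMinimizer b F G V₂ s t u₀ u v₁ v₂) (hη : IsSmoothField b s t η)
    (hw : ∀ i, IsSmoothField b s t (w i)) (hζ : IsSmoothField b s t ζ) (hη0 : ∀ x, η s x = 0)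
    (hcont : ∀ r ∈ Icc s t, ∀ x, timeDeriv s t η r x + ∑ i, dx i (w i) r x = ζ r x)
    (hζ0 : (∀ a, 0 < a → V₂ a = 0) → ∀ r ∈ Icc s t, ∀ x, ζ r x = 0) :
    (∫ p in cell b s t, ((∑ i, v₁ p.1 p.2 i * w i p.1 p.2) + v₂ p.1 p.2 * ζ p.1 p.2
      - (1 / 2 * ‖v₁ p.1 p.2‖ ^ 2 * deriv (V₁ F G) (u p.1 p.2)
        + 1 / 2 * |v₂ p.1 p.2| ^ 2 * deriv V₂ (u p.1 p.2)) * η p.1 p.2))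
      + ∫ x in domain b, deriv G (u t x) * η t x = 0 := by
  have ha := hmin.admissible
  have hu := ha.density.toIsSmoothField
  have hV₁ : IsMobility (V₁ F G) := ⟨hyp.smooth_V₁, Or.inl fun _ => hyp.V₁_pos⟩
  have hV₂ : IsMobility V₂ := ⟨hyp.smooth_V₂, hyp.V₂_sign⟩
  have htt : t ∈ Icc s t := ⟨hst.le, le_rfl⟩
  have hcell : ∀ {f : ℝ → Space d → ℝ}, IsSmoothField b s t f →
      ContinuousOn (fun p : ℝ × Space d => f p.1 p.2) (cell b s t) := fun hf =>
    hf.continuousOn.mono cell_subset_slab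
  have hm : ∀ i, IsSmoothField b s t (fun r x => V₁ F G (u r x) * v₁ r x i) := fun i =>
    (hu.comp hyp.smooth_V₁ ha.density.pos).mul (ha.smooth_v₁.component i)
  have hn : IsSmoothField b s t (fun r x => V₂ (u r x) * v₂ r x) :=
    (hu.comp hyp.smooth_V₂ ha.density.pos).mul ha.smooth_v₂
  have hmc := fun i => hcell (hm i)
  have hwc := fun i => hcell (hw i)
  have hnc := hcell hn
  have huc := hcell hu
  have hηc := hcell hη
  have hζc := hcell hζ
  obtain ⟨δ, hδ, hpc⟩ := exists_pos_perturbation (isCompact_cell (b := b) (s := s) (t := t))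
    huc hηc fun p hp => ha.density.pos p.1 hp.1 p.2
  -- Compactness gave positivity on one period cell; periodicity carries it to the whole space.
  have hpos : ∀ ε ∈ Icc (-δ) δ, ∀ r ∈ Icc s t, ∀ x, 0 < u r x + ε * η r x := fun ε hε r hr x => by
    have := ((hu.add ((IsSmoothField.const ε).mul hη)).periodic r hr).exists_mem_domain x
    rw [← this]
    exact hpc ε hε (r, _) ⟨hr, fract_mem_domain x⟩
  set L : ℝ → ℝ → Space d → ℝ := fun ε r x => fluxLagrangian F G V₂
    (fun i => V₁ F G (u r x) * v₁ r x i) (fun i => w i r x) (V₂ (u r x) * v₂ r x) (ζ r x)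
    (u r x) (η r x) ε with hLdef
  have hLc : ∀ ε ∈ Icc (-δ) δ, ContinuousOn (fun p : ℝ × Space d => L ε p.1 p.2) (cell b s t) := by
    intro ε hε
    have hU : ContinuousOn (fun p : ℝ × Space d => u p.1 p.2 + ε * η p.1 p.2) (cell b s t) :=
      huc.add (continuousOn_const.mul hηc)
    refine (continuousOn_const.mul (continuousOn_finsetSum _ fun i _ => ?_)).add
      (continuousOn_const.mul ?_)
    · exact hV₁.continuousOn_action ((hmc i).add (continuousOn_const.mul (hwc i))) hU
        (hpc ε hε)
    · exact hV₂.continuousOn_action (hnc.add (continuousOn_const.mul hζc)) hU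
        (hpc ε hε)
  -- J ε is the cost of the competitor with fluxes m + εw and n + εζ. As ε takes both signs,
  -- minimality makes 0 an interior minimum of J.
  set J : ℝ → ℝ := fun ε => (∫ p in cell b s t, L ε p.1 p.2) +
    energy b G (fun x => u t x + ε * η t x) with hJ
  have hJ0 : J 0 = cost b F G V₂ s t u v₁ v₂ := by
    rw [cost_eq hst.le (hLc 0 ⟨by linarith, hδ.le⟩)]
    · simp [hJ]
    · intro r hr x
      have h1 := (hyp.V₁_pos (ha.density.pos r hr x)).ne'
      simp only [hLdef, fluxLagrangian, zero_mul, add_zero, EuclideanSpace.real_norm_sq_eq, sq_abs]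
      rw [mul_assoc, Finset.sum_mul, mul_assoc]
      congr 2
      · refine Finset.sum_congr rfl fun i _ => ?_
        field_simp
      · rcases hyp.V₂_sign with h | h
        · have := (h _ (ha.density.pos r hr x)).ne'
          field_simp
        · simp [h _ (ha.density.pos r hr x)]
  have hJmin : ∀ ε ∈ Icc (-δ) δ, J 0 ≤ J ε := fun ε hε => by
    rw [hJ0]
    refine (hmin.minimal _ _ _ (ha.perturb hyp hst hη hw hζ hη0 hcont hζ0 (hpos ε hε))).trans_eq ?_
    rw [cost_eq hst.le (hLc ε hε)]
    intro r hr x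
    simp only [hLdef, fluxLagrangian, EuclideanSpace.real_norm_sq_eq, sq_abs]
    rw [mul_assoc, Finset.sum_mul, mul_assoc, half_sq_div_mul hV₂ (hpos ε hε r hr x)]
    simp only [half_sq_div_mul hV₁ (hpos ε hε r hr x)]
  have hJd : HasDerivAt J ((∫ p in cell b s t,
      (1 / 2 * (∑ i, actionDeriv (V₁ F G) (V₁ F G (u p.1 p.2) * v₁ p.1 p.2 i) (w i p.1 p.2)
        (u p.1 p.2) (η p.1 p.2) 0) + 1 / 2 * actionDeriv V₂ (V₂ (u p.1 p.2) * v₂ p.1 p.2)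
          (ζ p.1 p.2) (u p.1 p.2) (η p.1 p.2) 0)) + ∫ x in domain b, deriv G (u t x) * η t x) 0 := by
    refine HasDerivAt.add ?_ (hasDerivAt_energy hyp.smooth_G (hu.continuous_slice htt)
      (hη.continuous_slice htt) (ha.density.pos t htt))
    have hc₁ := fun i => hV₁.continuousOn_actionDeriv (hmc i) (hwc i) huc hηc hpc
    have hc₂ := hV₂.continuousOn_actionDeriv hnc hζc huc hηc hpc
    refine hasDerivAt_setIntegral (μ := volume) isCompact_cell hδ (H := fun ε p => L ε p.1 p.2)
      (H' := fun ε p => 1 / 2 * (∑ i, actionDeriv (V₁ F G) (V₁ F G (u p.1 p.2) * v₁ p.1 p.2 i)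
        (w i p.1 p.2) (u p.1 p.2) (η p.1 p.2) ε) + 1 / 2 * actionDeriv V₂
          (V₂ (u p.1 p.2) * v₂ p.1 p.2) (ζ p.1 p.2) (u p.1 p.2) (η p.1 p.2) ε) hLc ?_ ?_
    · exact (continuousOn_const.mul (continuousOn_finsetSum _ fun i _ => hc₁ i)).add
        (continuousOn_const.mul hc₂)
    · intro ε hε p hp
      exact ((HasDerivAt.fun_sum fun i _ => hV₁.hasDerivAt_action (hpc ε hε p hp)).const_mul _).add
        ((hV₂.hasDerivAt_action (hpc ε hε p hp)).const_mul _)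
  have hloc : IsLocalMin J 0 := by
    filter_upwards [Icc_mem_nhds (a := -δ) (x := (0 : ℝ)) (b := δ) (by linarith) hδ] with ε hε
      using hJmin ε hε
  have h0 := hloc.hasDerivAt_eq_zero hJd
  rw [← h0]
  congr 1
  refine setIntegral_congr_fun isCompact_cell.measurableSet fun p hp => ?_
  have hp0 := ha.density.pos p.1 hp.1 p.2
  have h1 := (hyp.V₁_pos hp0).ne'
  -- At ε = 0 the flux is V₂ v₂ and the powers of V₂ cancel. If V₂ = 0, both sides vanish because ζ
  -- = 0 and V₂' = 0.
  have e2 : actionDeriv V₂ (V₂ (u p.1 p.2) * v₂ p.1 p.2) (ζ p.1 p.2) (u p.1 p.2) (η p.1 p.2) 0 =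
      2 * (v₂ p.1 p.2 * ζ p.1 p.2) -
        |v₂ p.1 p.2| ^ 2 * (deriv V₂ (u p.1 p.2) * η p.1 p.2) := by
    simp only [actionDeriv, zero_mul, add_zero, sq_abs]
    rcases hyp.V₂_sign with h | h
    · have := (h _ hp0).ne'
      field_simp
    · simp [h _ hp0, hζ0 h p.1 hp.1 p.2, IsMobility.deriv_eq_zero h hp0]
  have e1 : ∀ i, actionDeriv (V₁ F G) (V₁ F G (u p.1 p.2) * v₁ p.1 p.2 i) (w i p.1 p.2)
      (u p.1 p.2) (η p.1 p.2) 0 = 2 * (v₁ p.1 p.2 i * w i p.1 p.2) -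
        v₁ p.1 p.2 i ^ 2 * (deriv (V₁ F G) (u p.1 p.2) * η p.1 p.2) := fun i => by
    simp only [actionDeriv, zero_mul, add_zero]
    field_simp
  simp only [e1, e2, Finset.sum_sub_distrib, ← Finset.mul_sum, ← Finset.sum_mul,
    EuclideanSpace.real_norm_sq_eq]
  ring

end Variation

/-! ### Minimizers solve the Hamiltonian system -/

lemma gradient_apply (f : Space d → ℝ) (x : Space d) (i : Fin d) :
    gradient f x i = fderiv ℝ f x (EuclideanSpace.single i 1) := by
  have h := InnerProductSpace.toDual_symm_apply (𝕜 := ℝ) (x := EuclideanSpace.single i (1 : ℝ))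
    (y := fderiv ℝ f x)
  rw [← h, ← gradient, EuclideanSpace.inner_single_right]
  simp

section

variable {b : Module.Basis (Fin d) ℝ (Space d)} {F G R V₂ : ℝ → ℝ} {s t : ℝ}
  {u₀ : Space d → ℝ} {u : ℝ → Space d → ℝ} {v₁ : ℝ → Space d → Space d} {v₂ : ℝ → Space d → ℝ}

/-- The derivative of the kinetic energy density with respect to the density, at fixed fluxes. -/
def kineticForce (F G V₂ : ℝ → ℝ) (u : ℝ → Space d → ℝ) (v₁ : ℝ → Space d → Space d)
    (v₂ : ℝ → Space d → ℝ) : ℝ → Space d → ℝ := fun r x =>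
  1 / 2 * ‖v₁ r x‖ ^ 2 * deriv (V₁ F G) (u r x) + 1 / 2 * |v₂ r x| ^ 2 * deriv V₂ (u r x)

lemma IsAdmissible.smooth_kineticForce (hyp : StandingAssumptions F G R V₂)
    (ha : IsAdmissible b F G V₂ s t u₀ u v₁ v₂) :
    IsSmoothField b s t (kineticForce F G V₂ u v₁ v₂) := by
  have hu := ha.density.toIsSmoothField
  have h1 : IsSmoothField b s t (fun r x => ∑ i, v₁ r x i * v₁ r x i) :=
    IsSmoothField.sum _ fun i _ => (ha.smooth_v₁.component i).mul (ha.smooth_v₁.component i)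
  refine ((((IsSmoothField.const (1 / 2)).mul h1).mul
    (hu.comp (contDiffOn_deriv hyp.smooth_V₁) ha.density.pos)).add
    (((IsSmoothField.const (1 / 2)).mul (ha.smooth_v₂.mul ha.smooth_v₂)).mul
    (hu.comp (contDiffOn_deriv hyp.smooth_V₂) ha.density.pos))).congr fun r _ x => ?_
  simp only [kineticForce, EuclideanSpace.real_norm_sq_eq, sq_abs]
  simp only [sq]

lemma setIntegral_sum_sq_eq_zero (hst : s < t) {ψ : Fin d → ℝ → Space d → ℝ}
    (hψ : ∀ i, IsSmoothField b s t (ψ i))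
    (h : ∫ p in cell b s t, ∑ i, ψ i p.1 p.2 * ψ i p.1 p.2 = 0) {r : ℝ} (hr : r ∈ Icc s t)
    (x : Space d) (i : Fin d) : ψ i r x = 0 := by
  have h0 := (IsSmoothField.sum Finset.univ fun i _ =>
    (hψ i).mul (hψ i)).eq_zero_of_integral_cell_eq_zero hst
    (fun r _ x => Finset.sum_nonneg fun i _ => mul_self_nonneg _) h hr x
  exact mul_self_eq_zero.1 ((Finset.sum_eq_zero_iff_of_nonneg
    fun i _ => mul_self_nonneg _).1 h0 i (Finset.mem_univ i))

lemma integral_cell_mul_sum_dx (hst : s < t) {Φ : ℝ → Space d → ℝ} {w : Fin d → ℝ → Space d → ℝ}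
    (hΦ : IsSmoothField b s t Φ) (hw : ∀ i, IsSmoothField b s t (w i)) :
    ∫ p in cell b s t, Φ p.1 p.2 * ∑ i, dx i (w i) p.1 p.2 =
      -∫ p in cell b s t, ∑ i, dx i Φ p.1 p.2 * w i p.1 p.2 := by
  simp only [Finset.mul_sum]
  rw [integral_finsetSum _ fun i _ => (hΦ.mul ((hw i).dx hst i)).integrableOn_cell,
    integral_finsetSum _ fun i _ => ((hΦ.dx hst i).mul (hw i)).integrableOn_cell,
    ← Finset.sum_neg_distrib]
  exact Finset.sum_congr rfl fun i _ => hΦ.integral_mul_dx hst (hw i) i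

/-- With V₂ > 0 any pair (η, w) is allowed, ζ being read off from the continuity equation; v₂, which
is dual to ζ, is then the momentum. -/
lemma IsMinimizer.isPotential_of_pos (hyp : StandingAssumptions F G R V₂) (hst : s < t)
    (hmin : IsMinimizer b F G V₂ s t u₀ u v₁ v₂) (hV : ∀ a, 0 < a → 0 < V₂ a) :
    (∀ r ∈ Icc s t, ∀ x i, v₁ r x i = dx i v₂ r x) ∧
    (∀ r ∈ Icc s t, ∀ x, timeDeriv s t v₂ r x + kineticForce F G V₂ u v₁ v₂ r x = 0) ∧
    ∀ x, v₂ t x = -deriv G (u t x) := by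
  have ha := hmin.admissible
  have hu := ha.density.toIsSmoothField
  have hv₂ := ha.smooth_v₂
  have htt : t ∈ Icc s t := ⟨hst.le, le_rfl⟩
  have hH := ha.smooth_kineticForce hyp
  have hzero : IsSmoothField b s t (fun _ _ => (0 : ℝ)) := IsSmoothField.const 0
  have hV0 : ∀ {ζ : ℝ → Space d → ℝ}, (∀ a, 0 < a → V₂ a = 0) →
      ∀ r ∈ Icc s t, ∀ x, ζ r x = 0 := fun h => absurd (h 1 one_pos) (hV 1 one_pos).ne'
  refine ⟨?_, ?_⟩
  -- Variation η = 0, w = v₁ - ∇v₂, ζ = div w: after integration by parts the first variation is ∫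
  -- ‖v₁ - ∇v₂‖².
  · have hψ : ∀ i, IsSmoothField b s t (fun r x => v₁ r x i - dx i v₂ r x) := fun i =>
      (ha.smooth_v₁.component i).sub (hv₂.dx hst i)
    have hdiv : IsSmoothField b s t
        (fun r x => ∑ i, dx i (fun r x => v₁ r x i - dx i v₂ r x) r x) :=
      IsSmoothField.sum _ fun i _ => (hψ i).dx hst i
    have h := hmin.first_variation hyp hst hzero hψ hdiv (fun _ => rfl)
      (fun r _ x => by simp [timeDeriv]) hV0
    simp only [mul_zero, sub_zero, integral_zero, add_zero] at h
    have h1 : IsSmoothField b s t (fun r x => ∑ i, v₁ r x i * (v₁ r x i - dx i v₂ r x)) :=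
      IsSmoothField.sum _ fun i _ => (ha.smooth_v₁.component i).mul (hψ i)
    have h2 : IsSmoothField b s t (fun r x => ∑ i, dx i v₂ r x * (v₁ r x i - dx i v₂ r x)) :=
      IsSmoothField.sum _ fun i _ => (hv₂.dx hst i).mul (hψ i)
    rw [integral_add h1.integrableOn_cell (hv₂.mul hdiv).integrableOn_cell,
      integral_cell_mul_sum_dx hst hv₂ hψ, ← sub_eq_add_neg,
      ← integral_sub h1.integrableOn_cell h2.integrableOn_cell] at h
    intro r hr x i
    refine sub_eq_zero.1 (setIntegral_sum_sq_eq_zero hst hψ ?_ hr x i)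
    rw [← h]
    refine integral_congr_ae (Filter.Eventually.of_forall fun p => ?_)
    simp only [← Finset.sum_sub_distrib, sub_mul]
  -- Variations with w = 0 and ζ = ∂_t η, for arbitrary η vanishing initially.
  · have key : ∀ η : ℝ → Space d → ℝ, IsSmoothField b s t η → (∀ x, η s x = 0) →
        ∫ x in domain b, (v₂ t x + deriv G (u t x)) * η t x =
          ∫ p in cell b s t, (timeDeriv s t v₂ p.1 p.2 + kineticForce F G V₂ u v₁ v₂ p.1 p.2) *
            η p.1 p.2 := fun η hη h0 => by
      have h := hmin.first_variation hyp hst hη (w := fun _ _ _ => 0) (fun _ => hzero)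
        (hη.timeDeriv hst) h0 (fun r _ x => by simp [dx]) hV0
      simp only [mul_zero, Finset.sum_const_zero, zero_add] at h
      change (∫ p in cell b s t, (v₂ p.1 p.2 * timeDeriv s t η p.1 p.2 -
        kineticForce F G V₂ u v₁ v₂ p.1 p.2 * η p.1 p.2)) + _ = 0 at h
      rw [integral_sub (hv₂.mul (hη.timeDeriv hst)).integrableOn_cell
        (hH.mul hη).integrableOn_cell, hv₂.integral_mul_timeDeriv hst hη h0] at h
      have hi : ∀ {f : Space d → ℝ}, Continuous f → IntegrableOn f (domain b) := fun hf =>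
        hf.continuousOn.integrableOn_compact (isCompact_domain b)
      simp only [add_mul]
      rw [integral_add (hi (f := fun x => v₂ t x * η t x) ((hv₂.mul hη).continuous_slice htt))
        (hi (f := fun x => deriv G (u t x) * η t x)
          (((hu.comp (contDiffOn_deriv hyp.smooth_G) ha.density.pos).mul hη).continuous_slice
            htt)),
        integral_add ((hv₂.timeDeriv hst).mul hη).integrableOn_cell (hH.mul hη).integrableOn_cell]
      linarith
    have hA : IsSmoothField b s t
        (fun r x => timeDeriv s t v₂ r x + kineticForce F G V₂ u v₁ v₂ r x) :=
      (hv₂.timeDeriv hst).add hH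
    have hAzero : ∀ r ∈ Icc s t, ∀ x,
        timeDeriv s t v₂ r x + kineticForce F G V₂ u v₁ v₂ r x = 0 := by
      -- Test with the residual times a weight vanishing at both ends: the terminal term drops out
      -- and the residual is zero on the open interval, hence by continuity on the closed one.
      have hη : IsSmoothField b s t (fun r x => ((r - s) * (t - r)) *
          (timeDeriv s t v₂ r x + kineticForce F G V₂ u v₁ v₂ r x)) :=
        (IsSmoothField.time (by fun_prop)).mul hA
      have h := key _ hη fun x => by simp
      simp only [sub_self, mul_zero, zero_mul, integral_zero] at h
      have hz : ∀ r ∈ Ioo s t, ∀ x,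
          timeDeriv s t v₂ r x + kineticForce F G V₂ u v₁ v₂ r x = 0 := fun r hr x => by
        have := (hA.mul hη).eq_zero_of_integral_cell_eq_zero hst (fun r hr x => by
          rw [mul_left_comm]
          exact mul_nonneg (mul_nonneg (sub_nonneg.2 hr.1) (sub_nonneg.2 hr.2))
            (mul_self_nonneg _)) h.symm (Ioo_subset_Icc_self hr) x
        rw [mul_left_comm] at this
        have hne : (r - s) * (t - r) ≠ 0 :=
          (mul_pos (sub_pos.2 hr.1) (sub_pos.2 hr.2)).ne'
        exact mul_self_eq_zero.1 ((mul_eq_zero.1 this).resolve_left hne)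
      intro r hr x
      have hc : ContinuousOn
          (fun r => timeDeriv s t v₂ r x + kineticForce F G V₂ u v₁ v₂ r x) (Icc s t) :=
        fun r hr => (hA.hasDerivWithinAt hr x).continuousWithinAt
      have : EqOn (fun r => timeDeriv s t v₂ r x + kineticForce F G V₂ u v₁ v₂ r x) (fun _ => 0)
          (Icc s t) :=
        EqOn.of_subset_closure (fun r hr => hz r hr x) hc continuousOn_const
          Ioo_subset_Icc_self (by rw [closure_Ioo hst.ne])
      exact this hr
    refine ⟨hAzero, fun x => ?_⟩
    have hB : IsSmoothField b s t (fun r x => v₂ r x + deriv G (u r x)) :=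
      hv₂.add (hu.comp (contDiffOn_deriv hyp.smooth_G) ha.density.pos)
    -- With the interior equation known, only the terminal term is left; this η vanishes at s and
    -- equals t - s times the terminal residual at t.
    have hη : IsSmoothField b s t (fun r x => (r - s) * (v₂ t x + deriv G (u t x))) :=
      (IsSmoothField.time (by fun_prop)).mul
        (IsSmoothField.space (hB.slice htt) (hB.periodic t htt))
    have h := key _ hη fun x => by simp
    rw [setIntegral_congr_fun (g := fun _ => (0 : ℝ)) isCompact_cell.measurableSet (fun p hp => by
      simp only [hAzero p.1 hp.1 p.2, zero_mul]), integral_zero] at h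
    have h2 := IsPeriodic.eq_zero_of_integral_eq_zero (b := b)
      (f := fun x => (v₂ t x + deriv G (u t x)) * ((t - s) * (v₂ t x + deriv G (u t x))))
      (fun i y => by
        have := hB.periodic t htt i y
        simp only [this])
      ((hB.continuous_slice htt).mul (continuous_const.mul (hB.continuous_slice htt)))
      (fun y => by
        rw [mul_left_comm]
        exact mul_nonneg (sub_nonneg.2 hst.le) (mul_self_nonneg _)) h x
    rw [mul_left_comm] at h2
    have := mul_self_eq_zero.1 ((mul_eq_zero.1 h2).resolve_left (sub_pos.2 hst).ne')
    linarith

/-- Only variations with ζ = 0 are used. The force is evaluated at the given v₂, so the equation for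
Φ is an explicit time integration; it is the Hamiltonian one when V₂' = 0, the case in which this
lemma is applied. -/
lemma IsMinimizer.exists_potential (hyp : StandingAssumptions F G R V₂) (hst : s < t)
    (hmin : IsMinimizer b F G V₂ s t u₀ u v₁ v₂) :
    ∃ Φ, IsSmoothField b s t Φ ∧ (∀ r ∈ Icc s t, ∀ x i, v₁ r x i = dx i Φ r x) ∧
    (∀ r ∈ Icc s t, ∀ x, timeDeriv s t Φ r x + kineticForce F G V₂ u v₁ v₂ r x = 0) ∧
    ∀ x, Φ t x = -deriv G (u t x) := by
  have ha := hmin.admissible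
  have hu := ha.density.toIsSmoothField
  have htt : t ∈ Icc s t := ⟨hst.le, le_rfl⟩
  have hH := ha.smooth_kineticForce hyp
  set H := kineticForce F G V₂ u v₁ v₂ with hHdef
  have hP := hH.timeIntegral hst
  have hG' : IsSmoothField b s t (fun r x => deriv G (u r x)) :=
    hu.comp (contDiffOn_deriv hyp.smooth_G) ha.density.pos
  have hB : IsSmoothField b s t (fun _ x => (∫ τ in s..t, H τ x) - deriv G (u t x)) :=
    IsSmoothField.space ((hP.sub hG').slice htt) ((hP.sub hG').periodic t htt)
  -- This is -G'(u(t)) + ∫_r^t H, written with integrals starting at s.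
  let Φ : ℝ → Space d → ℝ := fun r x =>
    ((∫ τ in s..t, H τ x) - deriv G (u t x)) + -∫ τ in s..r, H τ x
  have hΦ : IsSmoothField b s t Φ := hB.add hP.neg
  have hΦt : ∀ r ∈ Icc s t, ∀ x, timeDeriv s t Φ r x = -H r x := fun r hr x => by
    rw [timeDeriv_add hst hB hP.neg hr, timeDeriv_neg]
    simp only
    rw [timeDeriv_timeIntegral hst hH hr]
    simp [timeDeriv]
  have hΦT : ∀ x, Φ t x = -deriv G (u t x) := fun x => by simp only [Φ]; ring
  refine ⟨Φ, hΦ, ?_, fun r hr x => by rw [hΦt r hr]; ring, hΦT⟩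
  have hψ : ∀ i, IsSmoothField b s t (fun r x => v₁ r x i - dx i Φ r x) := fun i =>
    (ha.smooth_v₁.component i).sub (hΦ.dx hst i)
  -- The variation is w = v₁ - ∇Φ with η the time primitive of -div w, so that ∂_t η + div w = 0.
  -- The identities below reduce the first variation to ∫ ‖w‖².
  have hdiv : IsSmoothField b s t
      (fun r x => -∑ i, dx i (fun r x => v₁ r x i - dx i Φ r x) r x) :=
    (IsSmoothField.sum _ fun i _ => (hψ i).dx hst i).neg
  have hη := hdiv.timeIntegral hst
  have hηt := fun r hr x => timeDeriv_timeIntegral hst hdiv (r := r) hr x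
  set η : ℝ → Space d → ℝ := fun r x =>
    ∫ τ in s..r, -∑ i, dx i (fun r x => v₁ r x i - dx i Φ r x) τ x with hηdef
  have hη0 : ∀ x, η s x = 0 := fun x => by simp [hηdef]
  have h := hmin.first_variation hyp hst hη hψ (IsSmoothField.const 0) hη0
    (fun r hr x => by rw [hηt r hr x]; ring) fun _ _ _ _ => rfl
  have h1 : IsSmoothField b s t (fun r x => ∑ i, v₁ r x i * (v₁ r x i - dx i Φ r x)) :=
    IsSmoothField.sum _ fun i _ => (ha.smooth_v₁.component i).mul (hψ i)
  have h2 : IsSmoothField b s t (fun r x => ∑ i, dx i Φ r x * (v₁ r x i - dx i Φ r x)) :=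
    IsSmoothField.sum _ fun i _ => (hΦ.dx hst i).mul (hψ i)
  simp only [mul_zero, add_zero] at h
  change (∫ p in cell b s t, ((∑ i, v₁ p.1 p.2 i * (v₁ p.1 p.2 i - dx i Φ p.1 p.2)) -
    H p.1 p.2 * η p.1 p.2)) + _ = 0 at h
  have hibp := hΦ.integral_mul_timeDeriv hst hη hη0
  have e1 : ∫ p in cell b s t, Φ p.1 p.2 * timeDeriv s t η p.1 p.2 =
      ∫ p in cell b s t, ∑ i, dx i Φ p.1 p.2 * (v₁ p.1 p.2 i - dx i Φ p.1 p.2) := by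
    rw [← neg_neg (∫ p in cell b s t, ∑ i, dx i Φ p.1 p.2 * (v₁ p.1 p.2 i - dx i Φ p.1 p.2)),
      ← integral_cell_mul_sum_dx hst hΦ hψ, ← integral_neg]
    refine setIntegral_congr_fun isCompact_cell.measurableSet fun p hp => ?_
    simp only [hηt p.1 hp.1 p.2, mul_neg]
  have e2 : ∫ p in cell b s t, timeDeriv s t Φ p.1 p.2 * η p.1 p.2 =
      -∫ p in cell b s t, H p.1 p.2 * η p.1 p.2 := by
    rw [← integral_neg]
    refine setIntegral_congr_fun isCompact_cell.measurableSet fun p hp => ?_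
    simp only [hΦt p.1 hp.1 p.2, neg_mul]
  have e3 : ∫ x in domain b, Φ t x * η t x = -∫ x in domain b, deriv G (u t x) * η t x := by
    rw [← integral_neg]
    simp only [hΦT, neg_mul]
  rw [integral_sub h1.integrableOn_cell (hH.mul hη).integrableOn_cell] at h
  rw [e1, e2, e3] at hibp
  intro r hr x i
  refine sub_eq_zero.1 (setIntegral_sum_sq_eq_zero hst hψ ?_ hr x i)
  have h3 : ∫ p in cell b s t, ∑ i, (v₁ p.1 p.2 i - dx i Φ p.1 p.2) *
      (v₁ p.1 p.2 i - dx i Φ p.1 p.2) =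
      (∫ p in cell b s t, ∑ i, v₁ p.1 p.2 i * (v₁ p.1 p.2 i - dx i Φ p.1 p.2)) -
      ∫ p in cell b s t, ∑ i, dx i Φ p.1 p.2 * (v₁ p.1 p.2 i - dx i Φ p.1 p.2) := by
    rw [← integral_sub h1.integrableOn_cell h2.integrableOn_cell]
    refine integral_congr_ae (Filter.Eventually.of_forall fun p => ?_)
    simp only [← Finset.sum_sub_distrib, sub_mul]
  rw [h3]
  linarith

/-- A minimizer of the control problem is driven by a potential which solves the Hamiltonian
system. -/
theorem IsMinimizer.exists_momentum (hyp : StandingAssumptions F G R V₂) (hst : s < t)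
    (hmin : IsMinimizer b F G V₂ s t u₀ u v₁ v₂) :
    ∃ Φ, SolvesHamiltonianSystem b F G V₂ s t u₀ u Φ ∧
      ∀ r ∈ Icc s t, ∀ x, v₁ r x = gradient (Φ r) x ∧
        V₂ (u r x) * v₂ r x = V₂ (u r x) * Φ r x := by
  have ha := hmin.admissible
  obtain ⟨Φ, hΦ, hgrad, hv₂, hHJ, hT⟩ : ∃ Φ, IsSmoothField b s t Φ ∧
      (∀ r ∈ Icc s t, ∀ x i, v₁ r x i = dx i Φ r x) ∧
      (∀ r ∈ Icc s t, ∀ x, V₂ (u r x) * v₂ r x = V₂ (u r x) * Φ r x) ∧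
      (∀ r ∈ Icc s t, ∀ x, timeDeriv s t Φ r x +
        (1 / 2 * ‖v₁ r x‖ ^ 2 * deriv (V₁ F G) (u r x)
          + 1 / 2 * |Φ r x| ^ 2 * deriv V₂ (u r x)) = 0) ∧
      ∀ x, Φ t x = -deriv G (u t x) := by
    rcases hyp.V₂_sign with h | h
    · obtain ⟨h1, h2, h3⟩ := hmin.isPotential_of_pos hyp hst h
      exact ⟨v₂, ha.smooth_v₂, h1, fun _ _ _ => rfl, h2, h3⟩
    · obtain ⟨Φ, hΦ, h1, h2, h3⟩ := hmin.exists_potential hyp hst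
      refine ⟨Φ, hΦ, h1, fun r hr x => ?_, fun r hr x => ?_, h3⟩
      · simp [h _ (ha.density.pos r hr x)]
      · have := h2 r hr x
        simp only [kineticForce, IsMobility.deriv_eq_zero h (ha.density.pos r hr x)] at this ⊢
        simpa using this
  have hg : ∀ r ∈ Icc s t, ∀ x, v₁ r x = gradient (Φ r) x := fun r hr x => by
    ext i
    rw [hgrad r hr x i, gradient_apply]
    rfl
  refine ⟨Φ, ⟨ha.density, hΦ, fun r hr x => ?_, fun r hr x => ?_, ha.initial, hT⟩,
    fun r hr x => ⟨hg r hr x, hv₂ r hr x⟩⟩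
  · rw [← hv₂ r hr x, mul_comm, ← ha.continuity r hr x]
    simp only [hg r hr]
  · rw [← hHJ r hr x, hg r hr x, add_assoc]

lemma SolvesHamiltonianSystem.isFirstVariation (hyp : StandingAssumptions F G R V₂) (hst : s < t)
    {Φ : ℝ → Space d → ℝ} (h : SolvesHamiltonianSystem b F G V₂ s t u₀ u Φ) :
    IsFirstVariation b (energy b G) (u t) (fun x => -Φ t x) := fun η hη _ => by
  have htt : t ∈ Icc s t := ⟨hst.le, le_rfl⟩
  simp only [h.terminal, neg_neg]
  exact hasDerivAt_energy hyp.smooth_G (h.density.continuous_slice htt) hη.continuous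
    (h.density.pos t htt)

end

/-! ### A comparison principle for transport equations -/

section Comparison

variable {b : Module.Basis (Fin d) ℝ (Space d)} {s t : ℝ}

lemma hasDerivWithinAt_nonpos_of_max {g : ℝ → ℝ} {g' r : ℝ} (hr : r ∈ Ico s t)
    (hg : HasDerivWithinAt g g' (Icc s t) r) (hmax : ∀ τ ∈ Icc r t, g τ ≤ g r) : g' ≤ 0 := by
  have h1 : IsLocalMaxOn g (Icc r t) r := IsMaxOn.localize hmax
  have h2 := h1.hasFDerivWithinAt_nonpos (y := t - r)
    (hg.mono (Icc_subset_Icc_left hr.1)).hasFDerivWithinAt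
    (sub_mem_posTangentConeAt_of_segment_subset (by rw [segment_eq_Icc hr.2.le]))
  simp only [ContinuousLinearMap.toSpanSingleton_apply, smul_eq_mul] at h2
  have := sub_pos.2 hr.2
  by_contra! h
  nlinarith [mul_pos this h]

/-- Backward in time, a finite family of fields which solve transport equations at their spatial
maxima with bounded right-hand sides stays bounded on a short time interval. -/
lemma transport_comparison {J : Type*} [Finite J] {f : J → ℝ → Space d → ℝ}
    (hf : ∀ j, IsSmoothField b s t (f j)) {K C : ℝ} (hC : 0 ≤ C) (hlen : (C + 1) * (t - s) ≤ 1)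
    (hT : ∀ j x, f j t x ≤ K)
    (hstep : ∀ j, ∀ r ∈ Icc s t, ∀ x, (∀ j', f j' r x ≤ K + 2) → (∀ l, dx l (f j) r x = 0) →
      -C ≤ timeDeriv s t (f j) r x) (j : J) {r : ℝ} (hr : r ∈ Icc s t) (x : Space d) :
    f j r x ≤ K + 2 := by
  -- A barrier strictly above the terminal data, growing backward in time at rate C + 1 and, on so
  -- short an interval, never exceeding K + 2.
  set B : ℝ → ℝ := fun r => K + 1 + (C + 1) * (t - r) with hB
  have hBle : ∀ r ∈ Icc s t, B r ≤ K + 2 := fun r hr => by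
    have : (C + 1) * (t - r) ≤ (C + 1) * (t - s) :=
      mul_le_mul_of_nonneg_left (by linarith [hr.1]) (by linarith)
    simp only [hB]
    linarith
  by_contra! hbad
  set Z : Set (ℝ × Space d) := ⋃ j, {p ∈ cell b s t | 0 ≤ f j p.1 p.2 - B p.1} with hZ
  have hZc : IsCompact Z := isCompact_iUnion fun j => by
    have hc : ContinuousOn (fun p : ℝ × Space d => f j p.1 p.2 - B p.1) (cell b s t) :=
      ((hf j).continuousOn.mono cell_subset_slab).sub (by fun_prop)
    exact isCompact_cell.of_isClosed_subset
      (hc.preimage_isClosed_of_isClosed isCompact_cell.isClosed isClosed_Ici) (sep_subset _ _)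
  have hper : ∀ j, ∀ r ∈ Icc s t, ∀ x, B r ≤ f j r x → (r, ZSpan.fract b x) ∈ Z :=
    fun j r hr x h => mem_iUnion.2 ⟨j, ⟨hr, fract_mem_domain x⟩, by
      simp only [((hf j).periodic r hr).exists_mem_domain x]
      linarith⟩
  -- The last time at which some member of the family reaches the barrier. There it touches the
  -- barrier at a spatial maximum, so its gradient vanishes and its time derivative is at least -C;
  -- staying below the barrier afterwards forces it to be at most -(C + 1).
  obtain ⟨⟨r₀, x₀⟩, hp₀, hmax⟩ := hZc.exists_isMaxOn
    ⟨_, hper j r hr x ((hBle r hr).trans hbad.le)⟩ continuousOn_fst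
  obtain ⟨i, ⟨hr₀, -⟩, hi⟩ := mem_iUnion.1 hp₀
  simp only at hr₀ hi
  have hlt : r₀ < t := by
    refine lt_of_le_of_ne hr₀.2 fun h => ?_
    have := hT i x₀
    simp only [h, hB, sub_self, mul_zero, add_zero] at hi
    linarith
  have hafter : ∀ j x, ∀ τ ∈ Ioc r₀ t, f j τ x < B τ := fun j x τ hτ => by
    by_contra! h
    have := hmax (hper j τ ⟨hr₀.1.trans hτ.1.le, hτ.2⟩ x h)
    exact absurd hτ.1 (not_lt.2 this)
  have hat : ∀ j x, f j r₀ x ≤ B r₀ := fun j x => by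
    have hc : ContinuousWithinAt (fun τ => f j τ x) (Ioc r₀ t) r₀ :=
      ((hf j).hasDerivWithinAt hr₀ x).continuousWithinAt.mono
        fun τ hτ => ⟨hr₀.1.trans hτ.1.le, hτ.2⟩
    have hBc : ContinuousWithinAt B (Ioc r₀ t) r₀ :=
      (by fun_prop : Continuous B).continuousWithinAt
    have hcl : r₀ ∈ closure (Ioc r₀ t) := by
      rw [closure_Ioc hlt.ne]
      exact ⟨le_rfl, hlt.le⟩
    exact hc.closure_le hcl hBc fun τ hτ => (hafter j x τ hτ).le
  have heq : f i r₀ x₀ = B r₀ := le_antisymm (hat i x₀) (by linarith)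
  have hdx : ∀ l, dx l (f i) r₀ x₀ = 0 := fun l => by
    have : IsLocalMax (f i r₀) x₀ :=
      Filter.Eventually.of_forall fun y => (hat i y).trans heq.ge
    simp [dx, this.fderiv_eq_zero]
  have h1 := hstep i r₀ hr₀ x₀ (fun j => (hat j x₀).trans (hBle r₀ hr₀)) hdx
  have hBd : HasDerivWithinAt B (-(C + 1)) (Icc s t) r₀ := by
    have := (((hasDerivAt_id r₀).const_sub t).const_mul (C + 1)).const_add (K + 1)
    simpa [hB] using this.hasDerivWithinAt
  have h2 := hasDerivWithinAt_nonpos_of_max ⟨hr₀.1, hlt⟩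
    (((hf i).hasDerivWithinAt hr₀ x₀).sub hBd) fun τ hτ => by
      simp only [Pi.sub_apply]
      rcases eq_or_lt_of_le hτ.1 with h | h
      · rw [h]
      · linarith [hafter i x₀ τ ⟨h, hτ.2⟩]
  linarith

/-- Restrict to a line. A positive second derivative would make the maximum also a local minimum, so
the restriction would be locally constant with zero second derivative. -/
lemma dx_dx_nonpos_of_max (hst : s < t) {f : ℝ → Space d → ℝ} (hf : IsSmoothField b s t f) {r : ℝ}
    (hr : r ∈ Icc s t) {x : Space d} (hmax : ∀ y, f r y ≤ f r x) (i : Fin d) :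
    dx i (dx i f) r x ≤ 0 := by
  set e : Space d := EuclideanSpace.single i 1 with he
  have hline : ∀ {g : ℝ → Space d → ℝ}, IsSmoothField b s t g → ∀ a : ℝ,
      HasDerivAt (fun a : ℝ => g r (x + a • e)) (dx i g r (x + a • e)) a := fun hg a => by
    have h1 : HasDerivAt (fun a : ℝ => x + a • e) e a := by
      simpa using ((hasDerivAt_id a).smul_const e).const_add x
    exact (hg.differentiable hr _).hasFDerivAt.comp_hasDerivAt a h1
  set g : ℝ → ℝ := fun a => f r (x + a • e) with hg
  have hg1 : deriv g = fun a => dx i f r (x + a • e) := funext fun a => (hline hf a).deriv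
  have hg2 : deriv (deriv g) 0 = dx i (dx i f) r x := by
    rw [hg1]
    simpa using (hline (hf.dx hst i) 0).deriv
  have hgmax : IsLocalMax g 0 := Filter.Eventually.of_forall fun a => by
    simpa [hg] using hmax (x + a • e)
  by_contra! hpos
  have hmin := isLocalMin_of_deriv_deriv_pos (hg2 ▸ hpos) hgmax.deriv_eq_zero
    (hline hf 0).continuousAt
  have hconst : g =ᶠ[nhds 0] fun _ => g 0 := by
    filter_upwards [hgmax, hmin] with a h1 h2 using le_antisymm h1 h2
  have : deriv (deriv g) 0 = 0 := by
    rw [hconst.deriv.deriv_eq]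
    simp
  rw [hg2] at this
  exact hpos.ne' this

end Comparison

/-! ### Differential polynomials

Differential polynomials in a finite family of fields, with coefficients which are smooth functions
of one distinguished positive field, for families of such data: the bounds below are uniform in the
index of the family. -/

section DiffPoly

variable {ι κ : Type*}

/-- `gen k i` is the `k`-th field of the `i`-th member of the family, and `gen k₀ i` is positive. -/
structure IsJetFamily (b : Module.Basis (Fin d) ℝ (Space d)) (s t : ι → ℝ)
    (gen : κ → ι → ℝ → Space d → ℝ) (k₀ : κ) : Prop where
  lt : ∀ i, s i < t i
  smooth : ∀ k i, IsSmoothField b (s i) (t i) (gen k i)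
  pos : ∀ i, ∀ r ∈ Icc (s i) (t i), ∀ x, 0 < gen k₀ i r x

/-- Differential polynomials of order at most `m`. -/
inductive DiffPoly (s t : ι → ℝ) (gen : κ → ι → ℝ → Space d → ℝ) (k₀ : κ) :
    ℕ → (ι → ℝ → Space d → ℝ) → Prop
  | comp {m : ℕ} (h : ℝ → ℝ) (hh : ContDiffOn ℝ ∞ h (Ioi 0)) :
      DiffPoly s t gen k₀ m (fun i r x => h (gen k₀ i r x))
  | jet {m : ℕ} (k : κ) (α : List (Fin d)) (hα : α.length ≤ m) :
      DiffPoly s t gen k₀ m (fun i => dxs α (gen k i))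
  | add {m : ℕ} {f g : ι → ℝ → Space d → ℝ} (hf : DiffPoly s t gen k₀ m f)
      (hg : DiffPoly s t gen k₀ m g) : DiffPoly s t gen k₀ m (fun i r x => f i r x + g i r x)
  | mul {m : ℕ} {f g : ι → ℝ → Space d → ℝ} (hf : DiffPoly s t gen k₀ m f)
      (hg : DiffPoly s t gen k₀ m g) : DiffPoly s t gen k₀ m (fun i r x => f i r x * g i r x)
  | congr {m : ℕ} {f g : ι → ℝ → Space d → ℝ} (hf : DiffPoly s t gen k₀ m f)
      (h : ∀ i, ∀ r ∈ Icc (s i) (t i), ∀ x, g i r x = f i r x) : DiffPoly s t gen k₀ m g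

namespace DiffPoly

variable {b : Module.Basis (Fin d) ℝ (Space d)} {s t : ι → ℝ}
  {gen : κ → ι → ℝ → Space d → ℝ} {k₀ : κ} {m n : ℕ} {f g : ι → ℝ → Space d → ℝ}

lemma mono (hf : DiffPoly s t gen k₀ m f) (hmn : m ≤ n) : DiffPoly s t gen k₀ n f := by
  induction hf with
  | comp h hh => exact comp h hh
  | jet k α hα => exact jet k α (hα.trans hmn)
  | add _ _ h1 h2 => exact add h1 h2
  | mul _ _ h1 h2 => exact mul h1 h2
  | congr _ h h1 => exact congr h1 h

lemma const (c : ℝ) : DiffPoly s t gen k₀ m (fun _ _ _ => c) :=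
  comp (fun _ => c) contDiffOn_const

lemma neg (hf : DiffPoly s t gen k₀ m f) : DiffPoly s t gen k₀ m (fun i r x => -f i r x) :=
  congr (mul (const (-1)) hf) fun i r _ x => by ring

lemma sub (hf : DiffPoly s t gen k₀ m f) (hg : DiffPoly s t gen k₀ m g) :
    DiffPoly s t gen k₀ m (fun i r x => f i r x - g i r x) :=
  congr (add hf (neg hg)) fun i r _ x => by ring

lemma sum {σ : Type*} (A : Finset σ) {f : σ → ι → ℝ → Space d → ℝ}
    (h : ∀ a ∈ A, DiffPoly s t gen k₀ m (f a)) :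
    DiffPoly s t gen k₀ m (fun i r x => ∑ a ∈ A, f a i r x) := by
  classical
  induction A using Finset.induction_on with
  | empty => exact congr (const 0) fun i r _ x => by simp
  | insert a A ha ih =>
    refine congr (add (h a (Finset.mem_insert_self _ _))
      (ih fun c hc => h c (Finset.mem_insert_of_mem hc))) fun i r _ x => ?_
    simp [Finset.sum_insert ha]

lemma smooth (hgen : IsJetFamily b s t gen k₀) (hf : DiffPoly s t gen k₀ m f) (i : ι) :
    IsSmoothField b (s i) (t i) (f i) := by
  induction hf with
  | comp h hh => exact (hgen.smooth k₀ i).comp hh (hgen.pos i)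
  | jet k α hα => exact (hgen.smooth k i).dxs (hgen.lt i) α
  | add _ _ h1 h2 => exact h1.add h2
  | mul _ _ h1 h2 => exact h1.mul h2
  | congr _ h h1 => exact h1.congr (h i)

lemma dx (hgen : IsJetFamily b s t gen k₀) (hf : DiffPoly s t gen k₀ m f) (j : Fin d) :
    DiffPoly s t gen k₀ (m + 1) (fun i => dx j (f i)) := by
  induction hf with
  | comp h hh =>
    exact congr (mul (comp (deriv h) (contDiffOn_deriv hh)) (jet k₀ [j] (by simp)))
      fun i r hr x => dx_comp hh (hgen.smooth k₀ i) (hgen.pos i) hr j x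
  | jet k α hα => exact jet k (j :: α) (by simpa using hα)
  | add hf hg h1 h2 =>
    exact congr (add h1 h2) fun i r hr x => dx_add (hf.smooth hgen i) (hg.smooth hgen i) hr j x
  | mul hf hg h1 h2 =>
    exact congr (add (mul (hf.mono (Nat.le_succ _)) h2) (mul h1 (hg.mono (Nat.le_succ _))))
      fun i r hr x => dx_mul (hf.smooth hgen i) (hg.smooth hgen i) hr j x
  | congr _ h h1 => exact congr h1 fun i r hr x => dx_congr (h i r hr) j x

lemma dxs (hgen : IsJetFamily b s t gen k₀) (hf : DiffPoly s t gen k₀ m f) (α : List (Fin d)) :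
    DiffPoly s t gen k₀ (m + α.length) (fun i => dxs α (f i)) := by
  induction α with
  | nil => exact hf
  | cons j α ih => exact ih.dx hgen j

/-- The constant depends only on the way f is built, since the coefficients are bounded on the
compact range [a, A]. The hypotheses concern a single point (r, x). -/
lemma exists_bound (hf : DiffPoly s t gen k₀ m f) {a A : ℝ} (ha : 0 < a) (K : ℝ) :
    ∃ C, 0 ≤ C ∧ ∀ i, ∀ r ∈ Icc (s i) (t i), ∀ x, gen k₀ i r x ∈ Icc a A →
      (∀ k α, α.length ≤ m → |MeanField.dxs α (gen k i) r x| ≤ K) → |f i r x| ≤ C := by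
  induction hf with
  | comp h hh =>
    obtain ⟨C, hC⟩ := (isCompact_Icc (a := a) (b := A)).exists_bound_of_continuousOn
      (hh.continuousOn.mono fun y hy => ha.trans_le hy.1)
    exact ⟨|C|, abs_nonneg C, fun i r _ x hx _ => (hC _ hx).trans (le_abs_self C)⟩
  | jet k α hα => exact ⟨|K|, abs_nonneg K, fun i r _ x _ h => (h k α hα).trans (le_abs_self K)⟩
  | add _ _ h1 h2 =>
    obtain ⟨C₁, h₁, h1⟩ := h1
    obtain ⟨C₂, h₂, h2⟩ := h2
    exact ⟨C₁ + C₂, add_nonneg h₁ h₂, fun i r hr x hx h =>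
      (abs_add_le _ _).trans (add_le_add (h1 i r hr x hx h) (h2 i r hr x hx h))⟩
  | mul _ _ h1 h2 =>
    obtain ⟨C₁, h₁, h1⟩ := h1
    obtain ⟨C₂, h₂, h2⟩ := h2
    refine ⟨C₁ * C₂, mul_nonneg h₁ h₂, fun i r hr x hx h => ?_⟩
    rw [abs_mul]
    exact mul_le_mul (h1 i r hr x hx h) (h2 i r hr x hx h) (abs_nonneg _) h₁
  | congr _ h h1 =>
    obtain ⟨C, h₁, h1⟩ := h1
    exact ⟨C, h₁, fun i r hr x hx hk => by rw [h i r hr x]; exact h1 i r hr x hx hk⟩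

end DiffPoly

end DiffPoly

/-! ### Coordinate bounds for regular densities. -/

section Regular

variable {b : Module.Basis (Fin d) ℝ (Space d)} {s t M : ℝ} {u : ℝ → Space d → ℝ}

/-- Each partial derivative evaluates the differential on a unit vector. The induction needs all m;
the case m = 0 is the one applied. -/
lemma norm_iteratedFDeriv_dxs_le (hst : s < t) (hu : IsSmoothField b s t u) {r : ℝ}
    (hr : r ∈ Icc s t) (α : List (Fin d)) (m : ℕ) (x : Space d) :
    ‖iteratedFDeriv ℝ m (dxs α u r) x‖ ≤ ‖iteratedFDeriv ℝ (m + α.length) (u r) x‖ := by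
  induction α generalizing m with
  | nil => simp
  | cons i α ih =>
    have hs := (hu.dxs hst α).slice hr
    have h1 : ‖iteratedFDeriv ℝ m (dx i (dxs α u) r) x‖ ≤
        ‖(EuclideanSpace.single i 1 : Space d)‖ * ‖iteratedFDeriv ℝ m (fderiv ℝ (dxs α u r)) x‖ :=
      norm_iteratedFDeriv_clm_apply_const (N := ∞)
        (hs.fderiv_right (m := ∞) (by simp)).contDiffAt (by exact_mod_cast le_top)
    rw [norm_iteratedFDeriv_fderiv] at h1
    simp only [PiLp.norm_single, norm_one, one_mul] at h1
    refine h1.trans ((ih (m + 1)).trans_eq ?_)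
    rw [List.length_cons, add_assoc, add_comm 1]

lemma IsRegular.abs_dxs_le (hst : s < t) (hu : IsSmoothField b s t u) (hM : IsRegular M s t u)
    {r : ℝ} (hr : r ∈ Icc s t) {α : List (Fin d)} (hα : α.length ≤ 3) (x : Space d) :
    |dxs α u r x| ≤ M := by
  have h := norm_iteratedFDeriv_dxs_le hst hu hr α 0 x
  rw [norm_iteratedFDeriv_zero, zero_add] at h
  exact h.trans ((hM r hr x).2 _ hα)

lemma IsRegular.pos (hst : s < t) (hu : IsDensityPath b s t u) (hM : IsRegular M s t u) :
    0 < M := by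
  have h := hM.abs_dxs_le hst hu.toIsSmoothField (left_mem_Icc.2 hst.le) (α := []) (by simp) 0
  exact (hu.pos s (left_mem_Icc.2 hst.le) 0).trans_le ((le_abs_self _).trans h)

lemma IsRegular.mem_Icc (hst : s < t) (hu : IsSmoothField b s t u) (hM : IsRegular M s t u)
    {r : ℝ} (hr : r ∈ Icc s t) (x : Space d) : u r x ∈ Icc M⁻¹ M :=
  ⟨(hM r hr x).1, (le_abs_self _).trans (hM.abs_dxs_le hst hu hr (α := []) (by simp) x)⟩

end Regular

/-! ### Bounds for regular solutions of the Hamiltonian system -/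

section

variable {b : Module.Basis (Fin d) ℝ (Space d)} {s t : ℝ}

lemma dx_dx_eq {f : ℝ → Space d → ℝ} (hf : IsSmoothField b s t f) {r : ℝ} (hr : r ∈ Icc s t)
    (i j : Fin d) (x : Space d) : dx i (dx j f) r x =
      fderiv ℝ (fderiv ℝ (f r)) x (EuclideanSpace.single i 1) (EuclideanSpace.single j 1) := by
  have hd : Differentiable ℝ (fderiv ℝ (f r)) :=
    ((hf.slice hr).fderiv_right (m := ∞) (by simp)).differentiable (by simp)
  have := ((hd x).hasFDerivAt.clm_apply
    (hasFDerivAt_const (EuclideanSpace.single j (1 : ℝ)) x)).fderiv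
  change fderiv ℝ (fun y => fderiv ℝ (f r) y (EuclideanSpace.single j 1)) x _ = _
  rw [this]
  simp

lemma dx_comm {f : ℝ → Space d → ℝ} (hf : IsSmoothField b s t f) {r : ℝ} (hr : r ∈ Icc s t)
    (i j : Fin d) (x : Space d) : dx i (dx j f) r x = dx j (dx i f) r x := by
  rw [dx_dx_eq hf hr, dx_dx_eq hf hr]
  exact ((hf.slice hr).contDiffAt (x := x)).isSymmSndFDerivAt
    (by simpa using (by norm_cast : (2 : WithTop ℕ∞) ≤ ∞)) _ _

end

/-- A solution of the Hamiltonian system on some time interval with a regular density. -/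
structure RegularSolution (b : Module.Basis (Fin d) ℝ (Space d)) (F G V₂ : ℝ → ℝ) (M : ℝ) where
  s : ℝ
  t : ℝ
  u₀ : Space d → ℝ
  u : ℝ → Space d → ℝ
  Φ : ℝ → Space d → ℝ
  lt : s < t
  solves : SolvesHamiltonianSystem b F G V₂ s t u₀ u Φ
  regular : IsRegular M s t u

namespace RegularSolution

variable {b : Module.Basis (Fin d) ℝ (Space d)} {F G R V₂ : ℝ → ℝ} {M : ℝ}

lemma smooth_u (p : RegularSolution b F G V₂ M) : IsSmoothField b p.s p.t p.u :=
  p.solves.density.toIsSmoothField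

lemma mem_right (p : RegularSolution b F G V₂ M) : p.t ∈ Icc p.s p.t := right_mem_Icc.2 p.lt.le

/-- The density and the momentum of a solution. -/
def pair : Bool → RegularSolution b F G V₂ M → ℝ → Space d → ℝ
  | false => RegularSolution.u
  | true => RegularSolution.Φ

lemma isJetFamily_pair : IsJetFamily b (RegularSolution.s (b := b) (F := F) (G := G) (V₂ := V₂)
    (M := M)) RegularSolution.t pair false where
  lt p := p.lt
  smooth
    | false, p => p.smooth_u
    | true, p => p.solves.smooth_Φ
  pos p := p.solves.density.pos

/-- The density of a solution. -/
def single : Unit → RegularSolution b F G V₂ M → ℝ → Space d → ℝ := fun _ => RegularSolution.u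

lemma isJetFamily_single : IsJetFamily b (RegularSolution.s (b := b) (F := F) (G := G) (V₂ := V₂)
    (M := M)) RegularSolution.t single () where
  lt p := p.lt
  smooth _ p := p.smooth_u
  pos p := p.solves.density.pos

/-- Differential polynomials in the density and the momentum. -/
abbrev PairPoly (b : Module.Basis (Fin d) ℝ (Space d)) (F G V₂ : ℝ → ℝ) (M : ℝ) (m : ℕ)
    (f : RegularSolution b F G V₂ M → ℝ → Space d → ℝ) : Prop :=
  DiffPoly RegularSolution.s RegularSolution.t pair false m f

/-- Differential polynomials in the density. -/
abbrev DensityPoly (b : Module.Basis (Fin d) ℝ (Space d)) (F G V₂ : ℝ → ℝ) (M : ℝ) (m : ℕ)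
    (f : RegularSolution b F G V₂ M → ℝ → Space d → ℝ) : Prop :=
  DiffPoly RegularSolution.s RegularSolution.t single () m f

/-- Nothing about Φ enters, so this bounds the terminal data before Φ is controlled. -/
lemma exists_bound_densityPoly (hM : 0 < M) {m : ℕ} (hm : m ≤ 3)
    {f : RegularSolution b F G V₂ M → ℝ → Space d → ℝ} (hf : DensityPoly b F G V₂ M m f) :
    ∃ C, 0 ≤ C ∧ ∀ p : RegularSolution b F G V₂ M, ∀ r ∈ Icc p.s p.t, ∀ x, |f p r x| ≤ C := by
  obtain ⟨C, hC0, hC⟩ := hf.exists_bound (inv_pos.2 hM) (A := M) M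
  exact ⟨C, hC0, fun p r hr x => hC p r hr x (p.regular.mem_Icc p.lt p.smooth_u hr x)
    fun _ α hα => p.regular.abs_dxs_le p.lt p.smooth_u hr (hα.trans hm) x⟩

/-- The bound on Φ is assumed only at the point considered, as needed at the touching point of the
comparison argument. -/
lemma exists_bound_pairPoly (hM : 0 < M) (K : ℝ) {m : ℕ} (hm : m ≤ 3)
    {f : RegularSolution b F G V₂ M → ℝ → Space d → ℝ} (hf : PairPoly b F G V₂ M m f) :
    ∃ C, 0 ≤ C ∧ ∀ p : RegularSolution b F G V₂ M, ∀ r ∈ Icc p.s p.t, ∀ x,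
      (∀ α : List (Fin d), α.length ≤ 3 → |dxs α p.Φ r x| ≤ K) → |f p r x| ≤ C := by
  obtain ⟨C, hC0, hC⟩ := hf.exists_bound (inv_pos.2 hM) (A := M) (max M K)
  refine ⟨C, hC0, fun p r hr x h => hC p r hr x (p.regular.mem_Icc p.lt p.smooth_u hr x) ?_⟩
  rintro (_ | _) α hα
  · exact (p.regular.abs_dxs_le p.lt p.smooth_u hr (hα.trans hm) x).trans (le_max_left _ _)
  · exact (h α (hα.trans hm)).trans (le_max_right _ _)

lemma timeDeriv_Φ (p : RegularSolution b F G V₂ M) {r : ℝ} (hr : r ∈ Icc p.s p.t) (x : Space d) :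
    timeDeriv p.s p.t p.Φ r x =
      -(1 / 2 * ∑ l, deriv (V₁ F G) (p.u r x) * (dx l p.Φ r x * dx l p.Φ r x)) -
        1 / 2 * deriv V₂ (p.u r x) * (p.Φ r x * p.Φ r x) := by
  have h := p.solves.eq_Φ r hr x
  have hn : ‖gradient (p.Φ r) x‖ ^ 2 = ∑ l, dx l p.Φ r x * dx l p.Φ r x := by
    rw [EuclideanSpace.real_norm_sq_eq]
    simp only [gradient_apply, sq, dx]
  rw [hn, sq_abs] at h
  rw [← Finset.mul_sum]
  linear_combination h

lemma timeDeriv_u (p : RegularSolution b F G V₂ M) {r : ℝ} (hr : r ∈ Icc p.s p.t) (x : Space d) :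
    timeDeriv p.s p.t p.u r x =
      -(∑ l, dx l (fun r x => V₁ F G (p.u r x) * dx l p.Φ r x) r x) + V₂ (p.u r x) * p.Φ r x := by
  have h := p.solves.eq_u r hr x
  have hdiv : divergence (fun y => V₁ F G (p.u r y) • gradient (p.Φ r) y) x =
      ∑ l, dx l (fun r x => V₁ F G (p.u r x) * dx l p.Φ r x) r x := by
    refine Finset.sum_congr rfl fun l _ => ?_
    simp only [PiLp.smul_apply, smul_eq_mul, gradient_apply, dx]
  rw [hdiv] at h
  linear_combination h

lemma pairPoly_comp {m : ℕ} {h : ℝ → ℝ} (hh : ContDiffOn ℝ ∞ h (Ioi 0)) :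
    PairPoly b F G V₂ M m fun p r x => h (p.u r x) := DiffPoly.comp (k₀ := false) h hh

lemma pairPoly_dxs_Φ {m : ℕ} {α : List (Fin d)} (hα : α.length ≤ m) :
    PairPoly b F G V₂ M m fun p => dxs α p.Φ := DiffPoly.jet (gen := pair) true α hα

lemma pairPoly_dx_Φ (l : Fin d) : PairPoly b F G V₂ M 1 fun p => dx l p.Φ :=
  pairPoly_dxs_Φ (α := [l]) le_rfl

lemma pairPoly_timeDeriv_Φ (hyp : StandingAssumptions F G R V₂) :
    PairPoly b F G V₂ M 1 fun p => timeDeriv p.s p.t p.Φ := by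
  have hΦ : PairPoly b F G V₂ M 1 fun p => p.Φ := pairPoly_dxs_Φ (α := []) (by simp)
  refine DiffPoly.congr (((DiffPoly.const (1 / 2)).mul (DiffPoly.sum Finset.univ fun l _ =>
    (pairPoly_comp (contDiffOn_deriv hyp.smooth_V₁)).mul
      ((pairPoly_dx_Φ l).mul (pairPoly_dx_Φ l)))).neg.sub
    (((DiffPoly.const (1 / 2)).mul (pairPoly_comp (contDiffOn_deriv hyp.smooth_V₂))).mul
      (hΦ.mul hΦ))) fun p r hr x => p.timeDeriv_Φ hr x

/-- The spatial derivatives of the momentum solve transport equations with the same drift. -/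
lemma exists_transport (hyp : StandingAssumptions F G R V₂) (α : List (Fin d)) :
    ∃ L, PairPoly b F G V₂ M (max 1 α.length) L ∧
      ∀ p : RegularSolution b F G V₂ M, ∀ r ∈ Icc p.s p.t, ∀ x,
        timeDeriv p.s p.t (dxs α p.Φ) r x =
          -(∑ l, deriv (V₁ F G) (p.u r x) * dx l p.Φ r x * dx l (dxs α p.Φ) r x) + L p r x := by
  have hJ := isJetFamily_pair (b := b) (F := F) (G := G) (V₂ := V₂) (M := M)
  have hA : ∀ {m}, PairPoly b F G V₂ M m fun p r x => deriv (V₁ F G) (p.u r x) :=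
    pairPoly_comp (contDiffOn_deriv hyp.smooth_V₁)
  have hE := fun p : RegularSolution b F G V₂ M => p.solves.smooth_Φ
  induction α with
  | nil =>
    -- For Φ itself L is whatever remains. It has order 1 rather than 0, which is the origin of the
    -- maximum in the statement.
    refine ⟨fun p r x => timeDeriv p.s p.t p.Φ r x +
      ∑ l, deriv (V₁ F G) (p.u r x) * dx l p.Φ r x * dx l p.Φ r x, ?_, fun p r hr x => ?_⟩
    · exact (pairPoly_timeDeriv_Φ hyp).add (DiffPoly.sum _ fun l _ =>
        (hA.mul (pairPoly_dx_Φ l)).mul (pairPoly_dx_Φ l))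
    · simp only [dxs_nil]
      ring
  | cons j α ih =>
    have hcomm : ∀ p : RegularSolution b F G V₂ M, ∀ r ∈ Icc p.s p.t, ∀ x,
        timeDeriv p.s p.t (dxs (j :: α) p.Φ) r x = dx j (timeDeriv p.s p.t (dxs α p.Φ)) r x :=
      fun p r hr x => ((hE p).dxs p.lt α).timeDeriv_dx p.lt j hr x
    rcases α with _ | ⟨k, β⟩
    -- First derivatives are computed directly: differentiating the square ½ V₁' ‖∇Φ‖² yields
    -- exactly the drift term, and L keeps order 1. Differentiating the remainder of the previous
    -- case would give order 2.
    · have hQ : PairPoly b F G V₂ M 0 fun p r x =>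
          1 / 2 * deriv V₂ (p.u r x) * (p.Φ r x * p.Φ r x) :=
        ((DiffPoly.const (1 / 2)).mul (pairPoly_comp (contDiffOn_deriv hyp.smooth_V₂))).mul
          ((pairPoly_dxs_Φ (α := []) le_rfl).mul (pairPoly_dxs_Φ (α := []) le_rfl))
      refine ⟨fun p r x => -(1 / 2 * ∑ l, dx j (fun r x => deriv (V₁ F G) (p.u r x)) r x *
        (dx l p.Φ r x * dx l p.Φ r x)) - dx j (fun r x => 1 / 2 * deriv V₂ (p.u r x) *
          (p.Φ r x * p.Φ r x)) r x, ?_, fun p r hr x => ?_⟩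
      · exact ((DiffPoly.const (1 / 2)).mul (DiffPoly.sum Finset.univ fun l _ =>
          ((hA (m := 0)).dx hJ j).mul ((pairPoly_dx_Φ l).mul (pairPoly_dx_Φ l)))).neg.sub
            (hQ.dx hJ j)
      · rw [hcomm p r hr x, dxs_nil, dx_congr (fun x => p.timeDeriv_Φ hr x)
          (g := fun r x => -(1 / 2 * ∑ l, deriv (V₁ F G) (p.u r x) *
            (dx l p.Φ r x * dx l p.Φ r x)) - 1 / 2 * deriv V₂ (p.u r x) * (p.Φ r x * p.Φ r x))]
        have hAs := (hA (m := 0)).smooth hJ p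
        have hl := fun l => (hE p).dx p.lt l
        have hterm := fun l => hAs.mul ((hl l).mul (hl l))
        have hsum := IsSmoothField.sum Finset.univ fun l _ => hterm l
        have hc := IsSmoothField.const (b := b) (s := p.s) (t := p.t) (1 / 2 : ℝ)
        rw [dx_sub (hc.mul hsum).neg (hQ.smooth hJ p) hr, dx_neg, dx_mul hc hsum hr,
          dx_sum _ (fun l _ => hterm l) hr]
        have hz : dx j (fun _ _ => (1 / 2 : ℝ)) r x = 0 := by simp [dx]
        have hl2 : ∀ l, dx j (fun r x => deriv (V₁ F G) (p.u r x) *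
            (dx l p.Φ r x * dx l p.Φ r x)) r x =
            2 * (deriv (V₁ F G) (p.u r x) * dx l p.Φ r x * dx l (dx j p.Φ) r x) +
              dx j (fun r x => deriv (V₁ F G) (p.u r x)) r x *
                (dx l p.Φ r x * dx l p.Φ r x) := fun l => by
          rw [dx_mul hAs ((hl l).mul (hl l)) hr, dx_mul (hl l) (hl l) hr,
            dx_comm (hE p) hr j l]
          ring
        simp only [hz, hl2, Finset.sum_add_distrib, ← Finset.mul_sum, dxs_cons, dxs_nil]
        ring
    · obtain ⟨L, hL, hLeq⟩ := ih
      set α := k :: β with hα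
      have hlen : 1 ≤ α.length := by simp [hα]
      rw [max_eq_right hlen] at hL
      -- When the new derivative hits the drift coefficient, the factor ∂_l ∂^α Φ has order |α| + 1,
      -- and the coefficient has order 2 ≤ |α| + 1; no derivative is lost.
      refine ⟨fun p r x => -(∑ l, dx j (fun r x => deriv (V₁ F G) (p.u r x) * dx l p.Φ r x) r x *
        dx l (dxs α p.Φ) r x) + dx j (L p) r x, ?_, fun p r hr x => ?_⟩
      · rw [List.length_cons, max_eq_right (by omega)]
        refine (DiffPoly.sum Finset.univ fun l _ => ?_).neg.add (hL.dx hJ j)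
        exact (((hA.mul (pairPoly_dx_Φ l)).dx hJ j).mono (by omega)).mul
          (pairPoly_dxs_Φ (α := l :: α) (by simp))
      · rw [hcomm p r hr x, dx_congr (fun x => hLeq p r hr x)
          (g := fun r x => -(∑ l, deriv (V₁ F G) (p.u r x) * dx l p.Φ r x *
            dx l (dxs α p.Φ) r x) + L p r x)]
        have hAs := (hA (m := 0)).smooth hJ p
        have hl := fun l => hAs.mul ((hE p).dx p.lt l)
        have hαs := (hE p).dxs p.lt α
        have hterm := fun l => (hl l).mul (hαs.dx p.lt l)
        have hsum := IsSmoothField.sum Finset.univ fun l _ => hterm l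
        rw [dx_add hsum.neg (hL.smooth hJ p) hr, dx_neg, dx_sum _ (fun l _ => hterm l) hr]
        simp only [dx_mul (hl _) (hαs.dx p.lt _) hr, dx_comm hαs hr j,
          Finset.sum_add_distrib, dxs_cons]
        ring

lemma Φ_terminal (p : RegularSolution b F G V₂ M) (α : List (Fin d)) (x : Space d) :
    dxs α p.Φ p.t x = dxs α (fun r x => -deriv G (p.u r x)) p.t x :=
  dxs_congr p.solves.terminal α x

/-- On short time intervals, the momentum of a regular solution is bounded in `C³`. -/
lemma exists_bound_Φ (hyp : StandingAssumptions F G R V₂) (hM : 0 < M) :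
    ∃ δ > 0, ∃ K, ∀ p : RegularSolution b F G V₂ M, p.t - p.s ≤ δ →
      ∀ r ∈ Icc p.s p.t, ∀ x, ∀ α : List (Fin d), α.length ≤ 3 → |dxs α p.Φ r x| ≤ K := by
  have hfin : Finite {α : List (Fin d) // α.length ≤ 3} := List.finite_length_le (Fin d) 3
  have hT : ∀ α : {α : List (Fin d) // α.length ≤ 3}, ∃ K, ∀ p : RegularSolution b F G V₂ M,
      ∀ x, |dxs α.1 p.Φ p.t x| ≤ K := fun α => by
    have h0 : DensityPoly b F G V₂ M 0 fun p r x => -deriv G (p.u r x) :=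
      (DiffPoly.comp (k₀ := ()) (deriv G) (contDiffOn_deriv hyp.smooth_G)).neg
    obtain ⟨K, -, hK⟩ := exists_bound_densityPoly hM (by simpa using α.2)
      (h0.dxs isJetFamily_single α.1)
    exact ⟨K, fun p x => by rw [p.Φ_terminal]; exact hK p p.t p.mem_right x⟩
  choose KT hKT using hT
  obtain ⟨K₀, hK₀⟩ := (Set.finite_range KT).bddAbove
  have hK₀' : ∀ α, KT α ≤ K₀ := fun α => hK₀ (mem_range_self α)
  choose L hL hLeq using exists_transport (b := b) (M := M) hyp
  have hLb : ∀ α : {α : List (Fin d) // α.length ≤ 3}, ∃ C, 0 ≤ C ∧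
      ∀ p : RegularSolution b F G V₂ M, ∀ r ∈ Icc p.s p.t, ∀ x,
      (∀ α : List (Fin d), α.length ≤ 3 → |dxs α p.Φ r x| ≤ K₀ + 2) → |L α.1 p r x| ≤ C :=
    fun α => exists_bound_pairPoly hM (K₀ + 2) (max_le (by norm_num) α.2) (hL α.1)
  choose CL hCL0 hCL using hLb
  obtain ⟨C, hC⟩ := (Set.finite_range CL).bddAbove
  have hC' : ∀ α, CL α ≤ C := fun α => hC (mem_range_self α)
  have hC0 : 0 ≤ C := (hCL0 ⟨[], by simp⟩).trans (hC' _)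
  -- C bounds all remainders as long as Φ stays below K₀ + 2 in C³, which is what the comparison
  -- lemma preserves on intervals of length at most 1 / (C + 1).
  refine ⟨1 / (C + 1), by positivity, K₀ + 2, fun p hp => ?_⟩
  have hlen : (C + 1) * (p.t - p.s) ≤ 1 := by
    rw [le_div_iff₀ (by positivity)] at hp
    linarith
  -- Both signs of every derivative join the family, so that the one-sided comparison bounds
  -- absolute values.
  let sgn : Bool → ℝ := fun σ => if σ then 1 else -1
  let f : {α : List (Fin d) // α.length ≤ 3} × Bool → ℝ → Space d → ℝ :=
    fun j r x => sgn j.2 * dxs j.1.1 p.Φ r x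
  have hs := fun α => p.solves.smooth_Φ.dxs p.lt α
  have hconst := fun σ => IsSmoothField.const (b := b) (s := p.s) (t := p.t) (sgn σ)
  have hf : ∀ j, IsSmoothField b p.s p.t (f j) := fun j => (hconst j.2).mul (hs j.1.1)
  have habs : ∀ r x B, (∀ j, f j r x ≤ B) → ∀ α : List (Fin d), α.length ≤ 3 →
      |dxs α p.Φ r x| ≤ B := fun r x B h α hα => by
    have h1 := h (⟨α, hα⟩, true)
    have h2 := h (⟨α, hα⟩, false)
    simp only [f, sgn, if_true, one_mul, Bool.false_eq_true, if_false] at h1 h2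
    exact abs_le.2 ⟨by linarith, h1⟩
  have hsgn : ∀ σ a, sgn σ * a ≤ |a| := fun σ a => by
    cases σ
    · simpa [sgn] using neg_le_abs a
    · simpa [sgn] using le_abs_self a
  have hne : ∀ σ, sgn σ ≠ 0 := fun σ => by cases σ <;> simp [sgn]
  intro r hr x
  refine habs r x _ fun j => transport_comparison hf hC0 hlen (fun j x => ?_)
    (fun j r hr x hle hdx => ?_) j hr x
  · exact (hsgn _ _).trans ((hKT j.1 p x).trans (hK₀' _))
  · have hdx' : ∀ l, dx l (dxs j.1.1 p.Φ) r x = 0 := fun l => by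
      have := hdx l
      rw [dx_mul (hconst j.2) (hs j.1.1) hr] at this
      simpa [dx, hne] using this
    have h1 : timeDeriv p.s p.t (f j) r x = sgn j.2 * L j.1.1 p r x := by
      rw [timeDeriv_mul p.lt (hconst j.2) (hs j.1.1) hr, hLeq j.1.1 p r hr x]
      simp [timeDeriv, hdx']
    rw [h1]
    have h2 := (hCL j.1 p r hr x (habs r x _ hle)).trans (hC' _)
    have h3 := hsgn (!j.2) (L j.1.1 p r x)
    have h4 : sgn (!j.2) = -sgn j.2 := by cases j.2 <;> simp [sgn]
    rw [h4] at h3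
    linarith

/-- Time derivatives are eliminated with the equations: ∂_t Φ has order 1, ∂_t u order 2 and ∂_t² u
order 3, exactly the number of derivatives that regularity controls. -/
lemma exists_bound_timeDeriv2_u (hyp : StandingAssumptions F G R V₂) (hM : 0 < M) :
    ∃ δ > 0, ∃ C, 0 ≤ C ∧ ∀ p : RegularSolution b F G V₂ M, p.t - p.s ≤ δ →
      ∀ r ∈ Icc p.s p.t, ∀ x, |timeDeriv p.s p.t (timeDeriv p.s p.t p.u) r x| ≤ C := by
  have hJ := isJetFamily_pair (b := b) (F := F) (G := G) (V₂ := V₂) (M := M)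
  have hflux : ∀ l, PairPoly b F G V₂ M 1 fun p r x => V₁ F G (p.u r x) * dx l p.Φ r x := fun l =>
    (pairPoly_comp hyp.smooth_V₁).mul (pairPoly_dx_Φ l)
  have hΦ : ∀ {m}, PairPoly b F G V₂ M m fun p => p.Φ := pairPoly_dxs_Φ (α := []) (by simp)
  have hreact : ∀ {m}, PairPoly b F G V₂ M m fun p r x => V₂ (p.u r x) * p.Φ r x :=
    (pairPoly_comp hyp.smooth_V₂).mul hΦ
  have hut : PairPoly b F G V₂ M 2 fun p => timeDeriv p.s p.t p.u :=
    DiffPoly.congr ((DiffPoly.sum Finset.univ fun l _ => (hflux l).dx hJ l).neg.add hreact)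
      fun p r hr x => p.timeDeriv_u hr x
  have hΦt := (pairPoly_timeDeriv_Φ (b := b) (M := M) hyp)
  have hVt : ∀ {h : ℝ → ℝ}, ContDiffOn ℝ ∞ h (Ioi 0) →
      PairPoly b F G V₂ M 2 fun p => timeDeriv p.s p.t (fun r x => h (p.u r x)) := fun hh =>
    DiffPoly.congr ((pairPoly_comp (contDiffOn_deriv hh)).mul hut) fun p r hr x =>
      timeDeriv_comp p.lt hh p.smooth_u p.solves.density.pos hr x
  have hfluxt : ∀ l, PairPoly b F G V₂ M 2 fun p =>
      timeDeriv p.s p.t (fun r x => V₁ F G (p.u r x) * dx l p.Φ r x) := fun l =>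
    DiffPoly.congr (((pairPoly_comp hyp.smooth_V₁).mul (hΦt.dx hJ l)).add
      ((hVt hyp.smooth_V₁).mul ((pairPoly_dx_Φ l).mono (by norm_num)))) fun p r hr x => by
        rw [timeDeriv_mul p.lt (p.smooth_u.comp hyp.smooth_V₁ p.solves.density.pos)
          (p.solves.smooth_Φ.dx p.lt l) hr, p.solves.smooth_Φ.timeDeriv_dx p.lt l hr]
  have hreactt : PairPoly b F G V₂ M 2 fun p =>
      timeDeriv p.s p.t (fun r x => V₂ (p.u r x) * p.Φ r x) :=
    DiffPoly.congr (((pairPoly_comp hyp.smooth_V₂).mul (hΦt.mono (by norm_num))).add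
      ((hVt hyp.smooth_V₂).mul hΦ)) fun p r hr x =>
        timeDeriv_mul p.lt (p.smooth_u.comp hyp.smooth_V₂ p.solves.density.pos)
          p.solves.smooth_Φ hr x
  have hutt : PairPoly b F G V₂ M 3 fun p => timeDeriv p.s p.t (timeDeriv p.s p.t p.u) := by
    refine DiffPoly.congr ((DiffPoly.sum Finset.univ fun l _ => (hfluxt l).dx hJ l).neg.add
      (hreactt.mono (by norm_num))) fun p r hr x => ?_
    have hfs := fun l => (hflux l).smooth hJ p
    have hsum := IsSmoothField.sum Finset.univ fun l _ => (hfs l).dx p.lt l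
    rw [timeDeriv_congr (fun r hr x => p.timeDeriv_u hr x) hr,
      timeDeriv_add p.lt hsum.neg ((hreact (m := 0)).smooth hJ p) hr, timeDeriv_neg]
    simp only
    rw [timeDeriv_sum p.lt _ (fun l _ => (hfs l).dx p.lt l) hr]
    simp only [(hfs _).timeDeriv_dx p.lt _ hr]
  obtain ⟨δ, hδ, K, hK⟩ := exists_bound_Φ (b := b) hyp hM
  obtain ⟨C, hC0, hC⟩ := exists_bound_pairPoly hM K le_rfl hutt
  exact ⟨δ, hδ, C, hC0, fun p hp r hr x => hC p r hr x fun α hα => hK p hp r hr x α hα⟩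

end RegularSolution

/-! ### Consistency -/

/-- Taylor expansion at the right end point by two uses of the mean value inequality. The larger
interval [a, c] is there for the exact solution, whose derivatives are taken within [0, T]. -/
lemma abs_sub_sub_mul_le {g g' g'' : ℝ → ℝ} {a c C : ℝ}
    (h1 : ∀ r ∈ Icc a c, HasDerivWithinAt g (g' r) (Icc a c) r)
    (h2 : ∀ r ∈ Icc a c, HasDerivWithinAt g' (g'' r) (Icc a c) r)
    (hC : ∀ r ∈ Icc a c, |g'' r| ≤ C) {s t : ℝ} (hs : a ≤ s) (hst : s ≤ t) (ht : t ≤ c) :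
    |g t - g s - (t - s) * g' t| ≤ C * (t - s) ^ 2 := by
  have hsub : Icc s t ⊆ Icc a c := Icc_subset_Icc hs ht
  have hC0 : 0 ≤ C := (abs_nonneg _).trans (hC t ⟨hs.trans hst, ht⟩)
  have hg' : ∀ r ∈ Icc s t, |g' r - g' t| ≤ C * (t - s) := fun r hr => by
    have := (convex_Icc s t).norm_image_sub_le_of_norm_hasDerivWithin_le
      (fun x hx => (h2 x (hsub hx)).mono hsub) (fun x hx => hC x (hsub hx))
      (right_mem_Icc.2 hst) hr
    refine this.trans (mul_le_mul_of_nonneg_left ?_ hC0)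
    rw [Real.norm_eq_abs, abs_sub_comm, abs_of_nonneg (by linarith [hr.2])]
    linarith [hr.1]
  have := (convex_Icc s t).norm_image_sub_le_of_norm_hasDerivWithin_le
    (f := fun r => g r - r * g' t) (f' := fun r => g' r - g' t) (C := C * (t - s))
    (fun x hx => (((h1 x (hsub hx)).mono hsub).sub
      ((hasDerivAt_id x).mul_const (g' t)).hasDerivWithinAt).congr_deriv (by simp)) hg'
    (left_mem_Icc.2 hst) (right_mem_Icc.2 hst)
  rw [Real.norm_eq_abs, Real.norm_eq_abs, abs_of_nonneg (sub_nonneg.2 hst)] at this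
  calc |g t - g s - (t - s) * g' t| = |g t - t * g' t - (g s - s * g' t)| := by congr 1; ring
    _ ≤ C * (t - s) * (t - s) := this
    _ = C * (t - s) ^ 2 := by ring

section

variable {b : Module.Basis (Fin d) ℝ (Space d)} {F G R V₂ : ℝ → ℝ} {M s t : ℝ}
  {u : ℝ → Space d → ℝ}

lemma reactionDiffusion_eq_sum (hF : ContDiffOn ℝ ∞ F (Ioi 0)) (hu : IsDensityPath b s t u) {r : ℝ}
    (hr : r ∈ Icc s t) (x : Space d) : reactionDiffusion F R (u r) x =
      (∑ l, dx l (dx l fun r x => F (u r x)) r x) + R (u r x) := by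
  have hFu := hu.toIsSmoothField.comp hF hu.pos
  rw [reactionDiffusion, InnerProductSpace.laplacian_eq_iteratedFDeriv_orthonormalBasis _
    (EuclideanSpace.basisFun (Fin d) ℝ)]
  congr 1
  refine Finset.sum_congr rfl fun l _ => ?_
  rw [dx_dx_eq hFu hr, iteratedFDeriv_two_apply]
  simp

lemma reactionDiffusion_eq (hF : ContDiffOn ℝ ∞ F (Ioi 0)) (hst : s < t)
    (hu : IsDensityPath b s t u) {r : ℝ} (hr : r ∈ Icc s t) (x : Space d) :
    reactionDiffusion F R (u r) x = (∑ l, (deriv F (u r x) * dx l (dx l u) r x +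
      deriv (deriv F) (u r x) * (dx l u r x * dx l u r x))) + R (u r x) := by
  have hus := hu.toIsSmoothField
  rw [reactionDiffusion_eq_sum hF hu hr]
  congr 1
  refine Finset.sum_congr rfl fun l _ => ?_
  rw [dx_congr (fun x => dx_comp hF hus hu.pos hr l x) (g := fun r x => deriv F (u r x) * dx l u r x),
    dx_mul (hus.comp (contDiffOn_deriv hF) hu.pos) (hus.dx hst l) hr,
    dx_comp (contDiffOn_deriv hF) hus hu.pos hr]
  ring

namespace RegularSolution

/-- Since V₁ G'' = F' and V₂ G' = -R, the terminal momentum -G'(u) has flux -∇F(u) and source R(u).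
-/
lemma timeDeriv_u_terminal (hyp : StandingAssumptions F G R V₂) (p : RegularSolution b F G V₂ M)
    (x : Space d) : timeDeriv p.s p.t p.u p.t x = reactionDiffusion F R (p.u p.t) x := by
  have hdens := p.solves.density
  have ht := p.mem_right
  rw [p.timeDeriv_u ht, reactionDiffusion_eq_sum hyp.smooth_F hdens ht, p.solves.terminal,
    ← Finset.sum_neg_distrib]
  congr 1
  · refine Finset.sum_congr rfl fun l _ => ?_
    rw [← dx_neg]
    refine dx_congr (fun y => ?_) l x
    have h1 : dx l p.Φ p.t y = -(iteratedDeriv 2 G (p.u p.t y) * dx l p.u p.t y) := by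
      rw [dx_congr p.solves.terminal (g := fun r x => -deriv G (p.u r x)), dx_neg,
        dx_comp (contDiffOn_deriv hyp.smooth_G) p.smooth_u hdens.pos ht, iteratedDeriv_succ,
        iteratedDeriv_one]
    have h2 := (hyp.deriv2_G_pos _ (hdens.pos _ ht y)).ne'
    rw [h1, dx_comp hyp.smooth_F p.smooth_u hdens.pos ht, V₁]
    field_simp
  · linear_combination -hyp.V₂_mul _ (hdens.pos _ ht x)

lemma exists_bound_consistency (hyp : StandingAssumptions F G R V₂) (hM : 0 < M) :
    ∃ C, ∀ p : RegularSolution b F G V₂ M, ∀ x,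
      |p.u p.t x - (p.u p.s x + (p.t - p.s) * reactionDiffusion F R (p.u p.t) x)| ≤
        C * (p.t - p.s) ^ 2 := by
  obtain ⟨δ, hδ, C, hC0, hC⟩ := exists_bound_timeDeriv2_u (b := b) hyp hM
  have hRD : DensityPoly b F G V₂ M 2 fun p r x =>
      (∑ l, dx l (dx l fun r x => F (p.u r x)) r x) + R (p.u r x) :=
    (DiffPoly.sum Finset.univ fun l _ => ((DiffPoly.comp (m := 0) (k₀ := ()) F hyp.smooth_F).dx
      isJetFamily_single l).dx isJetFamily_single l).add
      (DiffPoly.comp (k₀ := ()) R hyp.smooth_R)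
  obtain ⟨B, hB0, hB⟩ := exists_bound_densityPoly hM (by norm_num) hRD
  -- The first summand serves steps h ≤ δ. For h ≥ δ the trivial bound 2M + hB is absorbed through 1
  -- ≤ h² / δ² and h ≤ h² / δ.
  refine ⟨C + 2 * M / δ ^ 2 + B / δ, fun p x => ?_⟩
  have hs : p.s ∈ Icc p.s p.t := left_mem_Icc.2 p.lt.le
  have ht := p.mem_right
  set h := p.t - p.s with hh
  have hpos : 0 < h := sub_pos.2 p.lt
  rcases le_total h δ with hle | hle
  · have h1 := abs_sub_sub_mul_le (fun r hr => p.smooth_u.hasDerivWithinAt hr x)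
      (fun r hr => (p.smooth_u.timeDeriv p.lt).hasDerivWithinAt hr x)
      (fun r hr => hC p hle r hr x) le_rfl p.lt.le le_rfl
    rw [timeDeriv_u_terminal hyp, ← hh, sub_sub] at h1
    refine h1.trans (mul_le_mul_of_nonneg_right ?_ (sq_nonneg h))
    have : 0 ≤ 2 * M / δ ^ 2 := by positivity
    have : 0 ≤ B / δ := by positivity
    linarith
  · have hu := fun {r} hr => p.regular.abs_dxs_le p.lt p.smooth_u (r := r) hr (α := []) (by simp) x
    have h1 : |p.u p.t x| ≤ M := hu ht
    have h2 : |p.u p.s x| ≤ M := hu hs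
    have h3 : |reactionDiffusion F R (p.u p.t) x| ≤ B := by
      rw [reactionDiffusion_eq_sum hyp.smooth_F p.solves.density ht]
      exact hB p p.t ht x
    have h4 : |h * reactionDiffusion F R (p.u p.t) x| ≤ h * B := by
      rw [abs_mul, abs_of_pos hpos]
      exact mul_le_mul_of_nonneg_left h3 hpos.le
    have h5 : 2 * M ≤ 2 * M / δ ^ 2 * h ^ 2 := by
      rw [div_mul_eq_mul_div, le_div_iff₀ (by positivity)]
      exact mul_le_mul_of_nonneg_left (pow_le_pow_left₀ hδ.le hle 2) (by positivity)
    have h6 : h * B ≤ B / δ * h ^ 2 := by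
      rw [div_mul_eq_mul_div, le_div_iff₀ hδ]
      nlinarith [mul_le_mul_of_nonneg_left hle (mul_nonneg hB0 hpos.le)]
    have h7 : 0 ≤ C * h ^ 2 := by positivity
    have h8 := abs_le.1 h1
    have h9 := abs_le.1 h2
    have h10 := abs_le.1 h4
    rw [abs_le]
    constructor <;> nlinarith

end RegularSolution

lemma gridTime_succ_sub (Δt : ℝ) (k : ℕ) : gridTime Δt (k + 1) - gridTime Δt k = Δt := by
  simp only [gridTime]
  push_cast
  ring

lemma gridTime_lt {Δt : ℝ} (h : 0 < Δt) (k : ℕ) : gridTime Δt k < gridTime Δt (k + 1) :=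
  sub_pos.1 (by rwa [gridTime_succ_sub])

theorem hamiltonianStep_consistent (hyp : StandingAssumptions F G R V₂) :
    FirstOrderConsistent F R (hamiltonianStep b F G V₂) := fun M => by
  rcases lt_or_ge 0 M with hM | hM
  · obtain ⟨C, hC⟩ := RegularSolution.exists_bound_consistency (b := b) hyp hM
    refine ⟨C, fun Δt hΔt k u₀ u ⟨Φ, hΦ⟩ hreg x => ?_⟩
    have := hC ⟨_, _, u₀, u, Φ, gridTime_lt hΔt k, hΦ, hreg⟩ x
    simp only [gridTime_succ_sub, hΦ.initial] at this
    exact this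
  · exact ⟨0, fun Δt hΔt k u₀ u ⟨Φ, hΦ⟩ hreg x =>
      absurd (hreg.pos (gridTime_lt hΔt k) hΦ.density) hM.not_gt⟩

/-! ### Convergence -/

lemma exists_lipschitz {h : ℝ → ℝ} (hh : ContDiffOn ℝ ∞ h (Ioi 0)) {a : ℝ} (ha : 0 < a) (A : ℝ) :
    ∃ L, 0 ≤ L ∧ ∀ y ∈ Icc a A, ∀ z ∈ Icc a A, |h y - h z| ≤ L * |y - z| := by
  have hpos : Icc a A ⊆ Ioi 0 := fun y hy => ha.trans_le hy.1
  obtain ⟨C, hC⟩ := (isCompact_Icc (a := a) (b := A)).exists_bound_of_continuousOn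
    ((contDiffOn_deriv hh).continuousOn.mono hpos)
  exact ⟨|C|, abs_nonneg C, fun y hy z hz =>
    (convex_Icc a A).norm_image_sub_le_of_norm_hasDerivWithin_le
      (fun x hx => (hasDerivAt_of_contDiffOn hh (hpos hx)).hasDerivWithinAt)
      (fun x hx => (hC x hx).trans (le_abs_self C)) hz hy⟩

lemma IsPeriodic.exists_max {f : Space d → ℝ} (hp : IsPeriodic b f) (hf : Continuous f) :
    ∃ x, ∀ y, f y ≤ f x := by
  obtain ⟨x, -, hx⟩ := (isCompact_domain b).exists_isMaxOn
    ⟨_, fract_mem_domain (b := b) 0⟩ hf.continuousOn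
  refine ⟨x, fun y => ?_⟩
  rw [← hp.exists_mem_domain]
  exact hx (fract_mem_domain y)

/-- Bounds on a density and on its first two spatial derivatives. -/
structure HasBounds (a A B : ℝ) (w : Space d → ℝ) : Prop where
  mem_Icc : ∀ x, w x ∈ Icc a A
  abs_dx_le : ∀ l x, |dx l (fun _ => w) 0 x| ≤ B
  abs_dx_dx_le : ∀ l x, |dx l (dx l fun _ => w) 0 x| ≤ B

lemma HasBounds.of_path {a A B r : ℝ} (h0 : ∀ x, u r x ∈ Icc a A)
    (h1 : ∀ l x, |dx l u r x| ≤ B) (h2 : ∀ l x, |dx l (dx l u) r x| ≤ B) : HasBounds a A B (u r) :=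
  ⟨h0, h1, h2⟩

/-- One-sided Lipschitz estimate for the reaction-diffusion operator at a maximum of the
difference. -/
lemma exists_reactionDiffusion_sub_le (hF : ContDiffOn ℝ ∞ F (Ioi 0))
    (hF' : ∀ a, 0 < a → 0 < deriv F a) (hR : ContDiffOn ℝ ∞ R (Ioi 0)) {a : ℝ} (ha : 0 < a)
    (A B : ℝ) : ∃ L, 0 ≤ L ∧ ∀ v w : Space d → ℝ, ContDiff ℝ ∞ v → ContDiff ℝ ∞ w →
      IsPeriodic b v → IsPeriodic b w → HasBounds a A B v → HasBounds a A B w →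
      ∀ x, (∀ y, v y - w y ≤ v x - w x) →
        reactionDiffusion F R v x - reactionDiffusion F R w x ≤ L * |v x - w x| := by
  obtain ⟨L₁, hL₁, h1⟩ := exists_lipschitz (contDiffOn_deriv hF) ha A
  obtain ⟨L₂, hL₂, h2⟩ := exists_lipschitz (contDiffOn_deriv (contDiffOn_deriv hF)) ha A
  obtain ⟨L₃, hL₃, h3⟩ := exists_lipschitz hR ha A
  refine ⟨d * (L₁ * |B| + L₂ * B ^ 2) + L₃, by positivity,
    fun v w hv hw hvp hwp hvb hwb x hmax => ?_⟩
  have h01 : (0 : ℝ) < 1 := one_pos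
  have h0 : (0 : ℝ) ∈ Icc (0 : ℝ) 1 := ⟨le_rfl, zero_le_one⟩
  -- The two densities are viewed as constant paths, so that the calculus of fields applies.
  have hV : IsDensityPath b 0 1 (fun _ => v) :=
    ⟨.space hv hvp, fun _ _ x => ha.trans_le (hvb.mem_Icc x).1⟩
  have hW : IsDensityPath b 0 1 (fun _ => w) :=
    ⟨.space hw hwp, fun _ _ x => ha.trans_le (hwb.mem_Icc x).1⟩
  have hVs := hV.toIsSmoothField
  have hWs := hW.toIsSmoothField
  have hg : ∀ l, dx l (fun _ => v) 0 x = dx l (fun _ => w) 0 x := fun l => by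
    have hloc : IsLocalMax (fun y => v y - w y) x := Filter.Eventually.of_forall hmax
    have := dx_sub hVs hWs h0 l x
    simp only [dx] at this ⊢
    rw [hloc.fderiv_eq_zero] at this
    simp only [zero_apply] at this
    linarith
  have hgg : ∀ l, dx l (dx l fun _ => v) 0 x ≤ dx l (dx l fun _ => w) 0 x := fun l => by
    have := dx_dx_nonpos_of_max h01 (hVs.sub hWs) h0 hmax l
    rw [dx_congr (fun x => dx_sub hVs hWs h0 l x)
      (g := fun r x => dx l (fun _ => v) r x - dx l (fun _ => w) r x),
      dx_sub (hVs.dx h01 l) (hWs.dx h01 l) h0] at this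
    linarith
  have e1 := reactionDiffusion_eq (R := R) hF h01 hV h0 x
  have e2 := reactionDiffusion_eq (R := R) hF h01 hW h0 x
  rw [e1, e2, add_sub_add_comm, ← Finset.sum_sub_distrib, add_mul]
  refine add_le_add ?_ ((le_abs_self _).trans (h3 _ (hvb.mem_Icc x) _ (hwb.mem_Icc x)))
  have hterm : ∀ l ∈ Finset.univ, (deriv F (v x) * dx l (dx l fun _ => v) 0 x +
      deriv (deriv F) (v x) * (dx l (fun _ => v) 0 x * dx l (fun _ => v) 0 x)) -
      (deriv F (w x) * dx l (dx l fun _ => w) 0 x +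
      deriv (deriv F) (w x) * (dx l (fun _ => w) 0 x * dx l (fun _ => w) 0 x)) ≤
      (L₁ * |B| + L₂ * B ^ 2) * |v x - w x| := fun l _ => by
    have hB1 := hwb.abs_dx_le l x
    have hB2 := (hwb.abs_dx_dx_le l x).trans (le_abs_self B)
    rw [hg l]
    set p := dx l (fun _ => w) 0 x
    set q := dx l (dx l fun _ => w) 0 x
    -- The only use of F' > 0: the second-order difference has the good sign. The other terms are
    -- differences of coefficients at v and w, multiplied by bounded derivatives of w.
    have k1 : deriv F (v x) * dx l (dx l fun _ => v) 0 x ≤ deriv F (v x) * q :=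
      mul_le_mul_of_nonneg_left (hgg l) (hF' _ (ha.trans_le (hvb.mem_Icc x).1)).le
    have k2 : (deriv F (v x) - deriv F (w x)) * q ≤ L₁ * |v x - w x| * |B| := by
      refine (le_abs_self _).trans ?_
      rw [abs_mul]
      exact mul_le_mul (h1 _ (hvb.mem_Icc x) _ (hwb.mem_Icc x)) hB2 (abs_nonneg _) (by positivity)
    have k3 : (deriv (deriv F) (v x) - deriv (deriv F) (w x)) * (p * p) ≤
        L₂ * |v x - w x| * B ^ 2 := by
      refine (le_abs_self _).trans ?_
      rw [abs_mul, abs_mul, ← sq]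
      exact mul_le_mul (h2 _ (hvb.mem_Icc x) _ (hwb.mem_Icc x))
        (pow_le_pow_left₀ (abs_nonneg _) hB1 2) (by positivity) (by positivity)
    nlinarith
  refine (Finset.sum_le_sum hterm).trans_eq ?_
  rw [Finset.sum_const, Finset.card_univ, Fintype.card_fin, nsmul_eq_mul]
  ring

/-- For Lh ≤ 1/2 one has 1 ≤ (1 - Lh)(1 + 2Lh), so after k steps the error is at most k C h² (1 +
2Lh)^k. Quantifying over all bounds E avoids suprema. -/
lemma gronwall_discrete {L C h T : ℝ} (hL : 0 ≤ L) (hC : 0 ≤ C) (hh : 0 < h) (hLh : L * h ≤ 1 / 2)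
    {N : ℕ} (hN : N * h ≤ T) {X : Type*} {e : ℕ → X → ℝ} (h0 : ∀ x, |e 0 x| ≤ 0)
    (hstep : ∀ k < N, ∀ E, (∀ x, |e k x| ≤ E) → ∀ x, (1 - L * h) * |e (k + 1) x| ≤ E + C * h ^ 2)
    {k : ℕ} (hk : k ≤ N) (x : X) : |e k x| ≤ T * C * Real.exp (2 * L * T) * h := by
  have hq : 1 ≤ 1 + 2 * L * h := by nlinarith [mul_nonneg hL hh.le]
  have hT : 0 ≤ T := le_trans (by positivity) hN
  have key : ∀ k ≤ N, ∀ x, |e k x| ≤ k * (C * h ^ 2) * (1 + 2 * L * h) ^ k := by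
    intro k
    induction k with
    | zero => intro _ x; simpa using h0 x
    | succ k ih =>
      intro hk x
      have h1 := hstep k (by omega) _ (ih (by omega)) x
      set E := (k : ℝ) * (C * h ^ 2) * (1 + 2 * L * h) ^ k
      have hE : 0 ≤ E := by positivity
      have hCh : 0 ≤ C * h ^ 2 := by positivity
      have hqk : 1 ≤ (1 + 2 * L * h) ^ k := one_le_pow₀ hq
      have h2 : |e (k + 1) x| ≤ (1 + 2 * L * h) * (E + C * h ^ 2) := by
        have h3 : 1 ≤ (1 + 2 * L * h) * (1 - L * h) := by
          nlinarith [mul_nonneg (mul_nonneg hL hh.le) (sub_nonneg.2 hLh)]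
        calc |e (k + 1) x| ≤ ((1 + 2 * L * h) * (1 - L * h)) * |e (k + 1) x| :=
              le_mul_of_one_le_left (abs_nonneg _) h3
          _ = (1 + 2 * L * h) * ((1 - L * h) * |e (k + 1) x|) := by ring
          _ ≤ _ := mul_le_mul_of_nonneg_left h1 (by linarith)
      refine h2.trans ?_
      have h4 : C * h ^ 2 ≤ C * h ^ 2 * (1 + 2 * L * h) ^ k := le_mul_of_one_le_right hCh hqk
      calc (1 + 2 * L * h) * (E + C * h ^ 2)
          ≤ (1 + 2 * L * h) * (E + C * h ^ 2 * (1 + 2 * L * h) ^ k) :=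
            mul_le_mul_of_nonneg_left (by linarith) (by linarith)
        _ = _ := by
          simp only [E]
          push_cast
          ring
  have hkh : k * h ≤ T := (mul_le_mul_of_nonneg_right (by exact_mod_cast hk) hh.le).trans hN
  have hexp : (1 + 2 * L * h) ^ k ≤ Real.exp (2 * L * T) := by
    calc (1 + 2 * L * h) ^ k ≤ Real.exp (2 * L * h) ^ k :=
          pow_le_pow_left₀ (by linarith) (by linarith [Real.add_one_le_exp (2 * L * h)]) k
      _ = Real.exp (2 * L * (k * h)) := by
          rw [← Real.exp_nat_mul]
          ring_nf
      _ ≤ _ := Real.exp_le_exp.2 (mul_le_mul_of_nonneg_left hkh (by positivity))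
  calc |e k x| ≤ k * (C * h ^ 2) * (1 + 2 * L * h) ^ k := key k hk x
    _ = (k * h) * (C * h * (1 + 2 * L * h) ^ k) := by ring
    _ ≤ T * (C * h * Real.exp (2 * L * T)) := by gcongr
    _ = _ := by ring

lemma exists_hasBounds_path (hst : s < t) (hu : IsDensityPath b s t u) :
    ∃ a > 0, ∃ A B, ∀ r ∈ Icc s t, HasBounds a A B (u r) := by
  have hus := hu.toIsSmoothField
  obtain ⟨A, hA⟩ := hus.exists_bound
  obtain ⟨A', hA'⟩ := (hus.comp (h := fun y => y⁻¹)
    (contDiffOn_id.inv fun y hy => (ne_of_gt hy)) hu.pos).exists_bound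
  choose B₁ hB₁ using fun l => (hus.dx hst l).exists_bound
  choose B₂ hB₂ using fun l => ((hus.dx hst l).dx hst l).exists_bound
  refine ⟨(|A'| + 1)⁻¹, by positivity, A, ∑ l, (|B₁ l| + |B₂ l|), fun r hr =>
    .of_path (fun x => ⟨?_, (le_abs_self _).trans (hA r hr x)⟩) (fun l x => ?_) fun l x => ?_⟩
  · have hpos := hu.pos r hr x
    rw [inv_le_comm₀ (by positivity) hpos]
    have := (hA' r hr x).trans (le_abs_self A')
    rw [abs_of_pos (inv_pos.2 hpos)] at this
    linarith
  · have h1 := Finset.single_le_sum (f := fun l => |B₁ l| + |B₂ l|)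
      (fun l _ => by positivity) (Finset.mem_univ l)
    have h2 := (hB₁ l r hr x).trans (le_abs_self _)
    linarith [abs_nonneg (B₂ l)]
  · have h1 := Finset.single_le_sum (f := fun l => |B₁ l| + |B₂ l|)
      (fun l _ => by positivity) (Finset.mem_univ l)
    have h2 := (hB₂ l r hr x).trans (le_abs_self _)
    linarith [abs_nonneg (B₁ l)]

lemma HasBounds.mono {a a' A A' B B' : ℝ} {w : Space d → ℝ} (h : HasBounds a A B w) (ha : a' ≤ a)
    (hA : A ≤ A') (hB : B ≤ B') : HasBounds a' A' B' w :=
  ⟨fun x => ⟨ha.trans (h.mem_Icc x).1, (h.mem_Icc x).2.trans hA⟩,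
    fun l x => (h.abs_dx_le l x).trans hB, fun l x => (h.abs_dx_dx_le l x).trans hB⟩

lemma IsRegular.hasBounds (hst : s < t) (hu : IsSmoothField b s t u) (hM : IsRegular M s t u)
    {r : ℝ} (hr : r ∈ Icc s t) : HasBounds M⁻¹ M M (u r) :=
  .of_path (hM.mem_Icc hst hu hr) (fun l x => hM.abs_dxs_le hst hu hr (α := [l]) (by simp) x)
    fun l x => hM.abs_dxs_le hst hu hr (α := [l, l]) (by simp) x

/-- Subtracting the Taylor expansion of the exact solution from the consistency estimate leaves the
difference of the two operators, controlled at an extremum of the error. Regularity makes its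
Lipschitz constant uniform over all steps. -/
theorem FirstOrderConsistent.convergent (hF : ContDiffOn ℝ ∞ F (Ioi 0))
    (hF' : ∀ a, 0 < a → 0 < deriv F a) (hR : ContDiffOn ℝ ∞ R (Ioi 0)) {Step : StepRelation d}
    (hStep : ∀ {s t u₀ u}, s < t → Step s t u₀ u → IsDensityPath b s t u)
    (hcons : FirstOrderConsistent F R Step) : FirstOrderConvergent b F R Step := by
  intro T U hT hU M
  rcases le_or_gt M 0 with hM | hM
  · refine ⟨0, fun Δt hΔt N w hN h0 hseq k hk x => ?_⟩
    rcases k with _ | k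
    · simp [h0, gridTime]
    · obtain ⟨u, hu, hreg, -⟩ := hseq k (by omega)
      have hlt := gridTime_lt hΔt k
      exact absurd (hreg.pos hlt (hStep hlt hu)) hM.not_gt
  have hUs := hU.toIsDensityPath.toIsSmoothField
  obtain ⟨a₀, ha₀, A₀, B₀, hbU⟩ := exists_hasBounds_path hT hU.toIsDensityPath
  obtain ⟨C₁, hC₁⟩ := hcons M
  obtain ⟨C₂, hC₂⟩ := ((hUs.timeDeriv hT).timeDeriv hT).exists_bound
  obtain ⟨L', hL', hRD⟩ := exists_reactionDiffusion_sub_le (b := b) hF hF' hR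
    (lt_min (inv_pos.2 hM) ha₀) (max M A₀) (max M B₀)
  -- Positivity of L ensures that 1 < 2LΔt for the steps not covered by the Gronwall argument; the
  -- second summand of the constant below handles these.
  set L := L' + 1 with hLdef
  have hL : 0 < L := by positivity
  set C := |C₁| + |C₂| with hCdef
  have hC : 0 ≤ C := by positivity
  refine ⟨T * C * Real.exp (2 * L * T) + (M + |A₀|) * (2 * L),
    fun Δt hΔt N w hN h0 hseq k hk x => ?_⟩
  have hgrid : ∀ k ≤ N, gridTime Δt k ∈ Icc 0 T := fun k hk =>
    ⟨mul_nonneg (Nat.cast_nonneg k) hΔt.le,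
      (mul_le_mul_of_nonneg_right (by exact_mod_cast hk) hΔt.le).trans hN⟩
  have hterm₁ : 0 ≤ T * C * Real.exp (2 * L * T) * Δt := by positivity
  have hterm₂ : 0 ≤ (M + |A₀|) * (2 * L) * Δt := by positivity
  rw [add_mul]
  rcases le_or_gt (L * Δt) (1 / 2) with hsmall | hlarge
  · refine le_trans ?_ (le_add_of_nonneg_right hterm₂)
    refine gronwall_discrete (e := fun k x => w k x - U (gridTime Δt k) x) hL.le hC hΔt hsmall hN
      (fun x => by simp [h0, gridTime]) (fun k hk E hE => ?_) hk x
    obtain ⟨u, hu, hreg, hw⟩ := hseq k hk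
    have hlt := gridTime_lt hΔt k
    have hdens := hStep hlt hu
    have hmem : gridTime Δt (k + 1) ∈ Icc (gridTime Δt k) (gridTime Δt (k + 1)) :=
      right_mem_Icc.2 hlt.le
    have hτ := hgrid (k + 1) hk
    set τ := gridTime Δt (k + 1) with hτdef
    have hbw : HasBounds (min M⁻¹ a₀) (max M A₀) (max M B₀) (w (k + 1)) := by
      rw [hw]
      exact (hreg.hasBounds hlt hdens.toIsSmoothField hmem).mono (min_le_left _ _)
        (le_max_left _ _) (le_max_left _ _)
    have hbU' : HasBounds (min M⁻¹ a₀) (max M A₀) (max M B₀) (U τ) :=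
      (hbU τ hτ).mono (min_le_right _ _) (le_max_right _ _) (le_max_right _ _)
    have hws : ContDiff ℝ ∞ (w (k + 1)) := by rw [hw]; exact hdens.slice hmem
    have hwp : IsPeriodic b (w (k + 1)) := by rw [hw]; exact hdens.periodic _ hmem
    have hUτs := hUs.slice hτ
    have hUτp := hUs.periodic _ hτ
    -- At a maximum of |w - U| either w - U or U - w is maximal; the one-sided estimate is applied
    -- to w and U in the corresponding order.
    obtain ⟨z, hz⟩ := IsPeriodic.exists_max (b := b) (f := fun y => |w (k + 1) y - U τ y|)
      (fun i y => by simp only [hwp i y, hUτp i y]) (hws.continuous.sub hUτs.continuous).abs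
    have h1 := hC₁ Δt hΔt k (w k) u hu hreg z
    rw [← hw] at h1
    have h2 := abs_sub_sub_mul_le (fun r hr => hUs.hasDerivWithinAt hr z)
      (fun r hr => (hUs.timeDeriv hT).hasDerivWithinAt hr z) (fun r hr => hC₂ r hr z)
      (hgrid k hk.le).1 hlt.le hτ.2
    rw [gridTime_succ_sub, hU.equation _ hτ] at h2
    have hC1 : C₁ * Δt ^ 2 ≤ |C₁| * Δt ^ 2 :=
      mul_le_mul_of_nonneg_right (le_abs_self _) (sq_nonneg _)
    have hC2 : C₂ * Δt ^ 2 ≤ |C₂| * Δt ^ 2 :=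
      mul_le_mul_of_nonneg_right (le_abs_self _) (sq_nonneg _)
    have hEz := abs_le.1 (hE z)
    have h1' := abs_le.1 h1
    have h2' := abs_le.1 h2
    have hmain : (1 - L * Δt) * |w (k + 1) z - U τ z| ≤ E + C * Δt ^ 2 := by
      have hz0 := abs_nonneg (w (k + 1) z - U τ z)
      have hLL : L' * |w (k + 1) z - U τ z| * Δt ≤ L * |w (k + 1) z - U τ z| * Δt := by
        gcongr
        linarith
      rcases le_total 0 (w (k + 1) z - U τ z) with hsign | hsign
      · have h3 := hRD _ _ hws hUτs hwp hUτp hbw hbU' z fun y =>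
          (le_abs_self _).trans ((hz y).trans_eq (abs_of_nonneg hsign))
        have h4 := mul_le_mul_of_nonneg_right h3 hΔt.le
        rw [abs_of_nonneg hsign] at *
        rw [hCdef]
        nlinarith
      · have h3 := hRD _ _ hUτs hws hUτp hwp hbU' hbw z fun y => by
          have := (neg_le_abs _).trans ((hz y).trans_eq (abs_of_nonpos hsign))
          linarith
        rw [abs_sub_comm] at h3
        have h4 := mul_le_mul_of_nonneg_right h3 hΔt.le
        rw [abs_of_nonpos hsign] at *
        rw [hCdef]
        nlinarith
    exact fun y => (mul_le_mul_of_nonneg_left (hz y) (by linarith)).trans hmain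
  -- Large steps: the error is at most M + |A₀| by boundedness of both densities, and 1 ≤ 2LΔt.
  · refine le_trans ?_ (le_add_of_nonneg_left hterm₁)
    rcases k with _ | k
    · simpa [h0, gridTime] using hterm₂
    · obtain ⟨u, hu, hreg, hw⟩ := hseq k (by omega)
      have hlt := gridTime_lt hΔt k
      have hdens := hStep hlt hu
      have h1 := hreg.mem_Icc hlt hdens.toIsSmoothField (right_mem_Icc.2 hlt.le) x
      have h2 := (hbU _ (hgrid (k + 1) hk)).mem_Icc x
      have h3 := hU.pos _ (hgrid (k + 1) hk) x
      have h4 := hdens.pos _ (right_mem_Icc.2 hlt.le) x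
      have h5 : M + |A₀| ≤ (M + |A₀|) * (2 * L) * Δt := by
        rw [mul_assoc]
        refine le_mul_of_one_le_right (by positivity) ?_
        linarith
      refine le_trans ?_ h5
      rw [hw, abs_le]
      constructor <;> linarith [h1.2, h2.2, le_abs_self A₀, abs_nonneg A₀]

/-! ### The minimizing movement scheme -/

theorem hamiltonianStep_accurate (hyp : StandingAssumptions F G R V₂) :
    FirstOrderAccurate b F R (hamiltonianStep b F G V₂) :=
  ⟨hamiltonianStep_consistent hyp, (hamiltonianStep_consistent hyp).convergent hyp.smooth_F
    hyp.deriv_F_pos hyp.smooth_R fun _ ⟨_, h⟩ => h.density⟩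

theorem minimizerStep_accurate (hyp : StandingAssumptions F G R V₂) :
    FirstOrderAccurate b F R (minimizerStep b F G V₂) := by
  have hcons : FirstOrderConsistent F R (minimizerStep b F G V₂) := fun M => by
    obtain ⟨C, hC⟩ := hamiltonianStep_consistent (b := b) hyp M
    refine ⟨C, fun Δt hΔt k u₀ u ⟨v₁, v₂, h⟩ => hC Δt hΔt k u₀ u ?_⟩
    obtain ⟨Φ, hΦ, -⟩ := h.exists_momentum hyp (gridTime_lt hΔt k)
    exact ⟨Φ, hΦ⟩
  exact ⟨hcons, hcons.convergent hyp.smooth_F hyp.deriv_F_pos hyp.smooth_R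
    fun _ ⟨_, _, h⟩ => h.admissible.density⟩

end

end MeanField

end

theorem mainTheorem6 (d : ℕ) (b : Module.Basis (Fin d) ℝ (MeanField.Space d))
    (F G R V₂ : ℝ → ℝ) (hyp : MeanField.StandingAssumptions F G R V₂) :
    (∀ (Δt : ℝ) (k : ℕ) (u₀ : MeanField.Space d → ℝ) (u : ℝ → MeanField.Space d → ℝ)
        (v₁ : ℝ → MeanField.Space d → MeanField.Space d) (v₂ : ℝ → MeanField.Space d → ℝ),
      0 < Δt →
      MeanField.IsMinimizer b F G V₂ (MeanField.gridTime Δt k) (MeanField.gridTime Δt (k + 1))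
        u₀ u v₁ v₂ →
      ∃ Φ : ℝ → MeanField.Space d → ℝ,
        MeanField.SolvesHamiltonianSystem b F G V₂
          (MeanField.gridTime Δt k) (MeanField.gridTime Δt (k + 1)) u₀ u Φ ∧
        MeanField.IsFirstVariation b (MeanField.energy b G) (u (MeanField.gridTime Δt (k + 1)))
          (fun x => -Φ (MeanField.gridTime Δt (k + 1)) x) ∧
        (∀ r ∈ Set.Icc (MeanField.gridTime Δt k) (MeanField.gridTime Δt (k + 1)), ∀ x,
          v₁ r x = gradient (Φ r) x ∧ V₂ (u r x) * v₂ r x = V₂ (u r x) * Φ r x)) ∧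
    MeanField.FirstOrderAccurate b F R (MeanField.hamiltonianStep b F G V₂) ∧
    MeanField.FirstOrderAccurate b F R (MeanField.minimizerStep b F G V₂) := by
  refine ⟨fun Δt k u₀ u v₁ v₂ hΔt hmin => ?_, MeanField.hamiltonianStep_accurate hyp,
    MeanField.minimizerStep_accurate hyp⟩
  have hlt := MeanField.gridTime_lt hΔt k
  obtain ⟨Φ, hΦ, hv⟩ := hmin.exists_momentum hyp hlt
  exact ⟨Φ, hΦ, hΦ.isFirstVariation hyp hlt, hv⟩
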